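/- Setting. Let $M$ be a smooth $n$-manifold and $\mathcal F\colon TM\to\mathbb R$ a Finsler function: continuous, smooth on $\hat TM=TM\setminus\{0\}$, positively homogeneous of degree $1$ on each $T_xM$, and such that $g_{x,y}(u,v)=\frac12\frac{\partial^2}{\partial s\,\partial t}\mathcal F^2(x,y+su+tv)\big|_{s=t=0}$ is positive definite for all $y\in T_xM\setminus\{0\}$. In induced coordinates $(x^i,y^i)$ on $TM$ put $$G^i=\tfrac14 g^{il}\Big(2\frac{\partial g_{jl}}{\partial x^k}-\frac{\partial g_{jk}}{\partial x^l}\Big)y^jy^k,\qquad G^i_j=\frac{\partial G^i}{\partial y^j},\qquad \Big(X^i\frac{\partial}{\partial x^i}\Big)^{h}=X^i\Big(\frac{\partial}{\partial x^i}-G_i^k\frac{\partial}{\partial y^k}\Big).$$ A vector field $V$ along a curve $c$ is parallel if $\dot V^i+G^i_j(c,V)\dot c^j=0$; this defines (nonlinear) parallel translation along piecewise smooth curves. Let $v$ be the projection of $T\hat TM$ onto the vertical bundle along the horizontal lifts. Let $\mathcal I_pM=\{y\in T_pM:\mathcal F(y)=1\}$ be the indicatrix at $p$ and $\mathcal IM=\{z\in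 TM:\mathcal F(z)=1\}$ the indicatrix bundle. The holonomy group $\mathsf{Hol}(p)\subset\mathsf{Diff}^\infty(\mathcal I_pM)$ is the group of parallel translations of $\mathcal I_pM$ along piecewise smooth closed curves at $p$. The fibred holonomy group $\mathsf{Hol_f}(M)\subset\mathsf{Diff}^\infty(\mathcal IM)$ consists of the fibre preserving diffeomorphisms whose restriction to $\mathcal I_pM$ belongs to $\mathsf{Hol}(p)$ for every $p\in M$. For smooth vector fields $X,Y$ on $M$, the curvature vector field $r(X,Y)\in\mathfrak X^\infty(\mathcal IM)$ is $r(X,Y)(x,y)=v[X^h,Y^h]_{(x,y)}$; the curvature algebra $\mathfrak R(M)$ is the Lie subalgebra of $\mathfrak X^\infty(\mathcal IM)$ generated by all $r(X,Y)$. Let $P$ be a smooth manifold and $H$ a subgroup of $\mathsf{Diff}^\infty(P)$. A field $\xi\in\mathfrak X^\infty(P)$ is tangent to $H$ if there is a $C^1$ family $\phi_t\in H$, $|t|<\varepsilon$, with $\phi_0=\mathrm{Id}$ and $\frac{\partial\phi_t}{\partial t}\big|_{t=0}=\xi$. It is strongly tangent to $H$ if, for some $k\ge1$ and $\varepsilon>0$,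 there is a $C^\infty$ family $\phi_{(t_1,\dots,t_k)}\in H$, $t_i\in(-\varepsilon,\varepsilon)$, with $\phi_{(t_1,\dots,t_k)}=\mathrm{Id}$ whenever some $t_j=0$ (a commutator-like family) and $\frac{\partial^k\phi}{\partial t_1\cdots\partial t_k}\big|_{(0,\dots,0)}=\xi$. A Lie subalgebra of $\mathfrak X^\infty(P)$ is tangent to $H$ if all its elements are. Theorem. Suppose that $\varphi\colon M\to\mathbb R^n$ is a diffeomorphism. (1) For all smooth vector fields $X,Y$ on $M$, the curvature vector field $r(X,Y)$ is strongly tangent to $\mathsf{Hol_f}(M)$. More precisely, for $s,t\in(-1,1)$ and $p\in M$ let $\Pi(sX_p,tY_p)$ be the closed curve that corresponds under $\varphi$ to the boundary of the parallelogram with successive vertices $\varphi(p)$, $\varphi(p)+s\,d\varphi_pX_p$, $\varphi(p)+s\,d\varphi_pX_p+t\,d\varphi_pY_p$, $\varphi(p)+t\,d\varphi_pY_p$, starting and ending at $p$. The parallel translations of the indicatrices $\mathcal I_pM$, $p\in M$, along $\Pi(sX_p,tY_p)$ form a $C^\infty$ commutator-like family $\Phi_{(s,t)}\in\mathsf{Hol_f}(M)$,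 $s,t\in(-1,1)$, with $\frac{\partial^2\Phi_{(s,t)}}{\partial s\,\partial t}\big|_{(0,0)}=r(X,Y)$. (2) The curvature algebra $\mathfrak R(M)$ is tangent to $\mathsf{Hol_f}(M)$. -/

import Mathlib

open Set
open scoped Manifold ContDiff

noncomputable section

/-! ## Diffeomorphisms and vector fields of an embedded submanifold

`S` is (the underlying set of) an embedded submanifold of a manifold `N`.  For such an `S`, a map on
`S` is smooth for the submanifold structure iff it is smooth on the set `S` in the sense of
`ContMDiffOn`. -/

namespace FinslerHol

section Submanifold

variable {N : Type*}

open Classical in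
/-- A self-map of `S`, extended to `N` by the identity off `S`. -/
def extendMap {S : Set N} (f : S → S) (z : N) : N := if h : z ∈ S then (f ⟨z, h⟩ : N) else z

theorem extendMap_coe {S : Set N} (f : S → S) (z : S) : extendMap f (z : N) = f z := by
  simp [extendMap]

theorem extendMap_of_mem {S : Set N} (f : S → S) {z : N} (h : z ∈ S) :
    extendMap f z = f ⟨z, h⟩ := by
  simp [extendMap, h]

variable {E H : Type*} [NormedAddCommGroup E] [NormedSpace ℝ E] [TopologicalSpace H]
  (I : ModelWithCorners ℝ E H) [TopologicalSpace N] [ChartedSpace H N]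

/-- The group `Diff^∞(S)` of smooth diffeomorphisms of the submanifold `S`. -/
def diffGroup (S : Set N) : Subgroup (Equiv.Perm S) where
  carrier := {φ | ContMDiffOn I I ∞ (extendMap (φ : S → S)) S ∧
    ContMDiffOn I I ∞ (extendMap (φ.symm : S → S)) S}
  one_mem' := by
    have h : ContMDiffOn I I ∞ (extendMap (id : S → S)) S :=
      contMDiffOn_id.congr fun z hz => by rw [extendMap_of_mem _ hz]; rfl
    exact ⟨h, h⟩
  mul_mem' := by
    rintro φ ψ ⟨h₁, h₂⟩ ⟨h₃, h₄⟩
    have key : ∀ f g : S → S, ContMDiffOn I I ∞ (extendMap f) S →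
        ContMDiffOn I I ∞ (extendMap g) S → ContMDiffOn I I ∞ (extendMap (f ∘ g)) S := by
      intro f g hf hg
      refine (hf.comp hg fun z hz => ?_).congr fun z hz => ?_
      · rw [mem_preimage, extendMap_of_mem _ hz]; exact (g ⟨z, hz⟩).2
      · rw [Function.comp_apply, extendMap_of_mem g hz, extendMap_coe, extendMap_of_mem _ hz]
        rfl
    exact ⟨key φ ψ h₁ h₃, key ψ.symm φ.symm h₄ h₂⟩
  inv_mem' := by
    rintro φ ⟨h₁, h₂⟩
    exact ⟨h₂, h₁⟩

/-- A family of vectors `X z ∈ T_z N`, `z ∈ S` (a candidate vector field on `S`). -/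
abbrev FieldOn (S : Set N) := ∀ z : S, TangentSpace I (z : N)

open Classical in
/-- Extension by zero off `S`; only the values on `S` ever matter. -/
def extendField {S : Set N} (X : FieldOn I S) (z : N) : TangentSpace I z :=
  if h : z ∈ S then X ⟨z, h⟩ else 0

/-- `X ∈ 𝔛^∞(S)`: `X` is smooth and tangent to `S` at each point of `S`.  Recall that `T_z N` is
identified with the model space `E` through the preferred chart at `z`. -/
def IsSmoothField [IsManifold I 1 N] {S : Set N} (X : FieldOn I S) : Prop :=
  ContMDiffOn I I.tangent ∞ (fun z => (⟨z, extendField I X z⟩ : TangentBundle I N)) S ∧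
  ∀ z : S, (X z : E) ∈
    tangentConeAt ℝ ((extChartAt I (z : N)).symm ⁻¹' S ∩ range I) (extChartAt I (z : N) z)

/-- The Lie bracket of two vector fields on `S`.  As both fields are tangent to `S`, the bracket
`DY(X) - DX(Y)` only involves derivatives along `S`. -/
def bracketOn {S : Set N} (X Y : FieldOn I S) : FieldOn I S := fun z =>
  VectorField.mlieBracketWithin I (extendField I X) (extendField I Y) S z

/-- The real Lie algebra of vector fields on `S` generated by a set `A` of vector fields. -/
inductive InLieSpan {S : Set N} (A : Set (FieldOn I S)) : FieldOn I S → Prop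
  | base (X : FieldOn I S) : X ∈ A → InLieSpan A X
  | zero : InLieSpan A (fun _ => 0)
  | add (X Y : FieldOn I S) : InLieSpan A X → InLieSpan A Y → InLieSpan A (fun z => X z + Y z)
  | smul (a : ℝ) (X : FieldOn I S) : InLieSpan A X → InLieSpan A (fun z => a • X z)
  | bracket (X Y : FieldOn I S) : InLieSpan A X → InLieSpan A Y → InLieSpan A (bracketOn I X Y)

/-- The vector field `X` is tangent to the subgroup `G` of `Diff^∞(S)`: it is the velocity at `t = 0`
of a `C^1` family `φ_t ∈ G`, `|t| < ε`, with `φ_0 = id`. -/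
def IsTangentTo [IsManifold I 1 N] {S : Set N} (G : Subgroup (Equiv.Perm S)) (X : FieldOn I S) :
    Prop :=
  IsSmoothField I X ∧
  ∃ (ε : ℝ) (φ : ℝ → Equiv.Perm S), 0 < ε ∧
    (∀ t ∈ Ioo (-ε) ε, φ t ∈ G) ∧
    ContMDiffOn (𝓘(ℝ, ℝ).prod I) I 1 (fun q : ℝ × N => extendMap (φ q.1) q.2) (Ioo (-ε) ε ×ˢ S) ∧
    φ 0 = 1 ∧
    ∀ z : S, HasDerivAt (fun t => extChartAt I (z : N) (φ t z : N)) (X z : E) 0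

/-- The cube `(-ε, ε)^k`. -/
def cube (k : ℕ) (ε : ℝ) : Set (Fin k → ℝ) := {t | ∀ i, t i ∈ Ioo (-ε) ε}

/-- `φ` is a smooth commutator-like `k`-parameter family of diffeomorphisms of `S`, with parameters
in `(-ε, ε)^k`. -/
structure IsCommutatorLike {S : Set N} (k : ℕ) (ε : ℝ) (φ : (Fin k → ℝ) → Equiv.Perm S) :
    Prop where
  diffeo : ∀ t ∈ cube k ε, φ t ∈ diffGroup I S
  smooth : ContMDiffOn (𝓘(ℝ, Fin k → ℝ).prod I) I ∞
    (fun q : (Fin k → ℝ) × N => extendMap (φ q.1) q.2) (cube k ε ×ˢ S)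
  eq_one : ∀ t ∈ cube k ε, (∃ j, t j = 0) → φ t = 1

/-- The commutator-like family `φ` exhibits `X` as strongly tangent to `G`: it lies in `G`, and
`∂^k φ / ∂t_1 ⋯ ∂t_k` at `t = 0` equals `X`. -/
structure ExhibitsStrongTangency {S : Set N} (G : Subgroup (Equiv.Perm S)) (X : FieldOn I S)
    (k : ℕ) (ε : ℝ) (φ : (Fin k → ℝ) → Equiv.Perm S) : Prop where
  commutatorLike : IsCommutatorLike I k ε φ
  mem : ∀ t ∈ cube k ε, φ t ∈ G
  deriv_eq : ∀ z : S,
    iteratedFDeriv ℝ k (fun t => extChartAt I (z : N) (φ t z : N)) 0 (fun i => Pi.single i 1)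
      = (X z : E)

/-- The vector field `X` is strongly tangent to the subgroup `G` of `Diff^∞(S)`. -/
def IsStronglyTangentTo [IsManifold I 1 N] {S : Set N} (G : Subgroup (Equiv.Perm S))
    (X : FieldOn I S) : Prop :=
  IsSmoothField I X ∧
  ∃ (k : ℕ) (ε : ℝ) (φ : (Fin k → ℝ) → Equiv.Perm S), 0 < k ∧ 0 < ε ∧
    ExhibitsStrongTangency I G X k ε φ

end Submanifold

/-! ## Local formulas of Finsler geometry

`L x y` is the Finsler function in coordinates `(x, y)` of the tangent bundle. -/

section Coordinates

variable {n : ℕ}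

/-- The `i`-th coordinate vector. -/
abbrev ei (i : Fin n) : EuclideanSpace ℝ (Fin n) := EuclideanSpace.single i 1

/-- `g_{ij}(x, y) = (1/2) ∂²L² / ∂y^i ∂y^j`. -/
def metricMatrix (L : EuclideanSpace ℝ (Fin n) → EuclideanSpace ℝ (Fin n) → ℝ)
    (x y : EuclideanSpace ℝ (Fin n)) : Matrix (Fin n) (Fin n) ℝ := Matrix.of fun i j =>
  (1 / 2) * deriv (fun s : ℝ => deriv (fun t : ℝ => L x (y + s • ei i + t • ei j) ^ 2) 0) 0

/-- `∂g_{ij} / ∂x^k`. -/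
def dMetric (L : EuclideanSpace ℝ (Fin n) → EuclideanSpace ℝ (Fin n) → ℝ)
    (k i j : Fin n) (x y : EuclideanSpace ℝ (Fin n)) : ℝ :=
  lineDeriv ℝ (fun x' => metricMatrix L x' y i j) x (ei k)

/-- `G^i = (1/4) g^{il} (2 ∂g_{jl}/∂x^k - ∂g_{jk}/∂x^l) y^j y^k`. -/
def sprayCoeff (L : EuclideanSpace ℝ (Fin n) → EuclideanSpace ℝ (Fin n) → ℝ)
    (i : Fin n) (x y : EuclideanSpace ℝ (Fin n)) : ℝ :=
  (1 / 4) * ∑ l, ∑ j, ∑ k, (metricMatrix L x y)⁻¹ i l *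
    (2 * dMetric L k j l x y - dMetric L l j k x y) * y j * y k

/-- `G^i_j = ∂G^i / ∂y^j`. -/
def connCoeff (L : EuclideanSpace ℝ (Fin n) → EuclideanSpace ℝ (Fin n) → ℝ)
    (i j : Fin n) (x y : EuclideanSpace ℝ (Fin n)) : ℝ :=
  lineDeriv ℝ (fun y' => sprayCoeff L i x y') y (ei j)

/-- The vector with components `G^i_j(x, y) a^j`. -/
def connVec (L : EuclideanSpace ℝ (Fin n) → EuclideanSpace ℝ (Fin n) → ℝ)
    (x y a : EuclideanSpace ℝ (Fin n)) : EuclideanSpace ℝ (Fin n) :=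
  WithLp.toLp 2 fun i => ∑ j, connCoeff L i j x y * a j

end Coordinates

/-! ## Finsler manifolds, parallel translation, holonomy and curvature -/

section Finsler

variable {n : ℕ} {M : Type*} [TopologicalSpace M] [ChartedSpace (EuclideanSpace ℝ (Fin n)) M]
  [IsManifold (𝓡 n) ∞ M]

/-- `F : TM → ℝ` is a Finsler function on `M`. -/
structure IsFinsler (F : TangentBundle (𝓡 n) M → ℝ) : Prop where
  continuous : Continuous F
  smooth : ContMDiffOn (𝓡 n).tangent 𝓘(ℝ, ℝ) ∞ F {z | z.2 ≠ 0}
  homogeneous : ∀ (p : M) (y : TangentSpace (𝓡 n) p) (a : ℝ), 0 < a →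
    F ⟨p, a • y⟩ = a * F ⟨p, y⟩
  posDef : ∀ (p : M) (y u : TangentSpace (𝓡 n) p), y ≠ 0 → u ≠ 0 →
    0 < (1 / 2) * deriv (fun s : ℝ => deriv (fun t : ℝ => F ⟨p, y + s • u + t • u⟩ ^ 2) 0) 0

/-- `G^i_j a^j` at the point `z = (p, y)` of `TM`, in the coordinates `(x, y)` of `TM` induced by the
preferred chart at `p`. -/
def connAt (F : TangentBundle (𝓡 n) M → ℝ) (z : TangentBundle (𝓡 n) M)
    (a : EuclideanSpace ℝ (Fin n)) : EuclideanSpace ℝ (Fin n) :=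
  connVec (fun x y => F ((extChartAt (𝓡 n).tangent z).symm (x, y)))
    (extChartAt (𝓡 n).tangent z z).1 (extChartAt (𝓡 n).tangent z z).2 a

/-- The horizontal lift `X^h = X^i (∂/∂x^i - G_i^k ∂/∂y^k)` at `z ∈ TM` of a tangent vector of `M` at
the base point of `z`. -/
def horLift (F : TangentBundle (𝓡 n) M → ℝ) (z : TangentBundle (𝓡 n) M)
    (a : TangentSpace (𝓡 n) z.proj) : TangentSpace (𝓡 n).tangent z :=
  ((a, -connAt F z a) : EuclideanSpace ℝ (Fin n) × EuclideanSpace ℝ (Fin n))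

/-- The projection `v` of `T_z TM` onto the vertical space along the horizontal space. -/
def vertProj (F : TangentBundle (𝓡 n) M → ℝ) (z : TangentBundle (𝓡 n) M)
    (w : EuclideanSpace ℝ (Fin n) × EuclideanSpace ℝ (Fin n)) : TangentSpace (𝓡 n).tangent z :=
  ((0, w.2 + connAt F z w.1) : EuclideanSpace ℝ (Fin n) × EuclideanSpace ℝ (Fin n))

/-- `V` is a parallel vector field along the smooth curve `c : [0, 1] → M`: it lies over `c` and its
velocity is everywhere horizontal, i.e. `dV^i/dt + G^i_j(c, V) dc^j/dt = 0` in coordinates. -/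
structure IsParallelField (F : TangentBundle (𝓡 n) M → ℝ) (c : ℝ → M)
    (V : ℝ → TangentBundle (𝓡 n) M) : Prop where
  smooth_curve : ContMDiffOn 𝓘(ℝ, ℝ) (𝓡 n) ∞ c (Icc 0 1)
  continuousOn : ContinuousOn V (Icc 0 1)
  proj_eq : ∀ t ∈ Icc (0 : ℝ) 1, (V t).proj = c t
  horizontal : ∀ t ∈ Icc (0 : ℝ) 1, ∃ a : TangentSpace (𝓡 n) (V t).proj,
    HasDerivWithinAt (fun s => extChartAt (𝓡 n).tangent (V t) (V s)) (horLift F (V t) a)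
      (Icc 0 1) t

/-- The list `γ` of smooth curves `[0, 1] → M`, run through one after the other, is a piecewise
smooth curve from `p` to `q`. -/
def IsPiecewiseSmoothPath : List (ℝ → M) → M → M → Prop
  | [], p, q => p = q
  | c :: γ, p, q =>
    ContMDiffOn 𝓘(ℝ, ℝ) (𝓡 n) ∞ c (Icc 0 1) ∧ c 0 = p ∧ IsPiecewiseSmoothPath γ (c 1) q

/-- Parallel translation along the piecewise smooth curve `γ` takes `v` to `w`. -/
def ParallelTranslates (F : TangentBundle (𝓡 n) M → ℝ) :
    List (ℝ → M) → TangentBundle (𝓡 n) M → TangentBundle (𝓡 n) M → Prop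
  | [], v, w => v = w
  | c :: γ, v, w => ∃ V, IsParallelField F c V ∧ V 0 = v ∧ ParallelTranslates F γ (V 1) w

/-- The indicatrix `I_p M`, as a submanifold of `TM` contained in the fibre `T_p M`. -/
def indicatrix (F : TangentBundle (𝓡 n) M → ℝ) (p : M) : Set (TangentBundle (𝓡 n) M) :=
  {z | z.proj = p ∧ F z = 1}

/-- The indicatrix bundle `IM`, as a submanifold of `TM`. -/
def indicatrixBundle (F : TangentBundle (𝓡 n) M → ℝ) : Set (TangentBundle (𝓡 n) M) :=
  {z | F z = 1}

/-- The holonomy group `Hol(p)`: the group of diffeomorphisms of `I_p M` given by the parallel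
translations along piecewise smooth closed curves at `p`. -/
def holonomyGroup (F : TangentBundle (𝓡 n) M → ℝ) (p : M) :
    Subgroup (Equiv.Perm (indicatrix F p)) :=
  Subgroup.closure {τ | τ ∈ diffGroup (𝓡 n).tangent (indicatrix F p) ∧
    ∃ γ : List (ℝ → M), IsPiecewiseSmoothPath (n := n) γ p p ∧
      ∀ z : indicatrix F p, ParallelTranslates F γ z (τ z)}

/-- The fibred holonomy group `Hol_f(M)`: the fibre preserving diffeomorphisms of `IM` whose
restriction to `I_p M` belongs to `Hol(p)`, for all `p`. -/
def fibredHolonomyGroup (F : TangentBundle (𝓡 n) M → ℝ) :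
    Subgroup (Equiv.Perm (indicatrixBundle F)) where
  carrier := {Φ | Φ ∈ diffGroup (𝓡 n).tangent (indicatrixBundle F) ∧
    ∀ p : M, ∃ τ ∈ holonomyGroup F p, ∀ z : indicatrix F p,
      (Φ ⟨z, z.2.2⟩ : TangentBundle (𝓡 n) M) = τ z}
  one_mem' := ⟨one_mem _, fun p => ⟨1, one_mem _, fun _ => rfl⟩⟩
  mul_mem' := by
    rintro Φ Ψ ⟨h₁, h₂⟩ ⟨h₃, h₄⟩
    refine ⟨mul_mem h₁ h₃, fun p => ?_⟩
    obtain ⟨τ, hτ, hτ'⟩ := h₂ p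
    obtain ⟨σ, hσ, hσ'⟩ := h₄ p
    refine ⟨τ * σ, mul_mem hτ hσ, fun z => ?_⟩
    have e : Ψ ⟨z, z.2.2⟩ = ⟨σ z, (σ z).2.2⟩ := Subtype.ext (hσ' z)
    rw [Equiv.Perm.mul_apply, e, hτ', Equiv.Perm.mul_apply]
  inv_mem' := by
    rintro Φ ⟨h₁, h₂⟩
    refine ⟨inv_mem h₁, fun p => ?_⟩
    obtain ⟨τ, hτ, hτ'⟩ := h₂ p
    refine ⟨τ⁻¹, inv_mem hτ, fun z => ?_⟩
    have e : Φ ⟨τ⁻¹ z, (τ⁻¹ z).2.2⟩ = ⟨z, z.2.2⟩ := by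
      apply Subtype.ext
      rw [hτ' (τ⁻¹ z)]
      exact congrArg Subtype.val (τ.apply_symm_apply z)
    rw [← e]
    exact congrArg Subtype.val (Φ.symm_apply_apply _)

/-- `X` is a smooth vector field on `M`. -/
def IsSmoothVectorField (X : ∀ p : M, TangentSpace (𝓡 n) p) : Prop :=
  ContMDiff (𝓡 n) (𝓡 n).tangent ∞ (fun p => (⟨p, X p⟩ : TangentBundle (𝓡 n) M))

/-- `r(X, Y)(x, y) = R_{(x, y)}(X, Y) = v[X^h, Y^h]`, for `(x, y) ∈ IM`. -/
def curvatureField (F : TangentBundle (𝓡 n) M → ℝ) (X Y : ∀ p : M, TangentSpace (𝓡 n) p) :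
    FieldOn (𝓡 n).tangent (indicatrixBundle F) := fun z =>
  vertProj F z (VectorField.mlieBracket (𝓡 n).tangent
    (fun w => horLift F w (X w.proj)) (fun w => horLift F w (Y w.proj)) (z : TangentBundle (𝓡 n) M))

/-- Membership in the curvature algebra: the Lie algebra of vector fields on `IM` generated by the
curvature vector fields. -/
def InCurvatureAlgebra (F : TangentBundle (𝓡 n) M → ℝ)
    (ξ : FieldOn (𝓡 n).tangent (indicatrixBundle F)) : Prop :=
  InLieSpan (𝓡 n).tangent
    {η | ∃ X Y : ∀ p : M, TangentSpace (𝓡 n) p,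
      IsSmoothVectorField X ∧ IsSmoothVectorField Y ∧ η = curvatureField F X Y} ξ

/-- The coordinate parallelogram with vertices `p, p + u, p + u + w, p + w` in the global coordinate
system `φ`, run through in this order and back to `p`. -/
def parallelogram (φ : M ≃ₘ⟮𝓡 n, 𝓡 n⟯ EuclideanSpace ℝ (Fin n)) (p : M)
    (u w : EuclideanSpace ℝ (Fin n)) : List (ℝ → M) :=
  [fun r => φ.symm (φ p + r • u),
   fun r => φ.symm (φ p + u + r • w),
   fun r => φ.symm (φ p + (1 - r) • u + w),
   fun r => φ.symm (φ p + (1 - r) • w)]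

end Finsler

end FinslerHol

end

/-! The global coordinate system `φ` identifies `TM` with `E × E` and `F` with a Finsler function
`L` on it. In these coordinates opposite sides of a parallelogram are translates of each other, so
transport around it is a group commutator. Let the side vectors `u`, `w` be carried along as inert
parameters; transport along `s u` and along `t w` are then permutations `id + s g` and `id + t h`,
and the loop is `ψ_t⁻¹ φ_s⁻¹ ψ_t φ_s`.

The engine is `IsFamilyOfOrder.exists_commutator`: for smooth families `φ_a = id + a^k g` and `ψ_b =
id + b^l h` the commutator is `id + a^k b^l K`, where `K` is smooth and `K` at `a = b = 0` is the
Lie bracket of the leading coefficients. With `k = l = 1` the coefficients are horizontal fields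
with constant base components. Their bracket is vertical, and it is the curvature
(`exists_coeff_loopPerm`, `lieBracket_horField`). The loop ends over its starting point, so `u`, `w`
may be specialised to the values of `X`, `Y` there. This gives (1).

For (2), brackets and sums have to be handled by different classes of fields. A strong field is the
leading coefficient of a smooth family `id + t^k g` in the group with `k` odd. Commutators of such
families, with parameters `t` and `t²`, have odd order `k + 2l`, so strong fields are closed under
brackets. The substitution `t = σ^(1/k)`, available on both sides of `0` because `k` is odd, turns
the family into a `C¹` family with velocity the strong field, and velocities of `C¹` families are
closed under sums and scalar multiples. By bilinearity the linear span of the strong fields is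
closed under brackets; it contains the curvature fields (the loop with parameters `t`, `t²` has
order `3`), hence the curvature algebra, and all its members are velocities.

Three analytic facts support this. Quotients such as `K` are smooth by Hadamard division
(`contDiffOn_paramQuotient`). Flows depend smoothly on initial values, by inverting a smooth
perturbation of the identity on a space of curves (`exists_flow`). Transport exists for the whole
time interval because the energy is constant along horizontal directions, which confines it to a
compact region away from the zero section (`exists_transport_flow`).

Two facts transfer the result to `M`. The connection is defined in the preferred chart at each
point, so the horizontal lift has to be natural under changes of coordinates
(`tangentLiftDeriv_horizontal`); this follows from the Euler-Lagrange characterisation of the spray.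
The bracket on `IM` differentiates only along `IM`; it agrees with the ambient bracket because the
fields are tangent to `IM`, being velocities of curves in it. -/

noncomputable section

namespace FinslerHol

/-! ### The superposition operator on spaces of curves -/

section Nemytskii

open scoped NNReal Topology

/-- The unit interval as a compact space of times. -/
abbrev TimeInterval : Type := Icc (0 : ℝ) 1

/-- The Banach space of continuous curves `[0, 1] → V`. -/
def Curve (V : Type) [NormedAddCommGroup V] : Type := C(TimeInterval, V)

namespace Curve

variable {V F : Type} [NormedAddCommGroup V] [NormedAddCommGroup F]

instance : NormedAddCommGroup (Curve V) := inferInstanceAs (NormedAddCommGroup C(TimeInterval, V))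

instance [NormedSpace ℝ V] : NormedSpace ℝ (Curve V) :=
  inferInstanceAs (NormedSpace ℝ C(TimeInterval, V))

instance [CompleteSpace V] : CompleteSpace (Curve V) :=
  inferInstanceAs (CompleteSpace C(TimeInterval, V))

instance : FunLike (Curve V) TimeInterval V := inferInstanceAs (FunLike C(TimeInterval, V) _ _)

/-- The curve given by a continuous function. -/
def mk (α : TimeInterval → V) (h : Continuous α) : Curve V := ContinuousMap.mk α h

@[simp] theorem mk_apply (α : TimeInterval → V) (h : Continuous α) (t : TimeInterval) :
    mk α h t = α t := rfl

@[ext] theorem ext {α β : Curve V} (h : ∀ t, α t = β t) : α = β := ContinuousMap.ext h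

@[simp] theorem add_apply (α β : Curve V) (t : TimeInterval) : (α + β) t = α t + β t := rfl

@[simp] theorem sub_apply (α β : Curve V) (t : TimeInterval) : (α - β) t = α t - β t := rfl

@[simp] theorem smul_apply [NormedSpace ℝ V] (a : ℝ) (α : Curve V) (t : TimeInterval) :
    (a • α) t = a • α t := rfl

protected theorem continuous (α : Curve V) : Continuous α := ContinuousMap.continuous α

theorem norm_apply_le (α : Curve V) (t : TimeInterval) : ‖α t‖ ≤ ‖α‖ :=
  ContinuousMap.norm_coe_le_norm (α : C(TimeInterval, V)) t

theorem norm_le (α : Curve V) {C : ℝ} (hC : 0 ≤ C) : ‖α‖ ≤ C ↔ ∀ t, ‖α t‖ ≤ C :=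
  ContinuousMap.norm_le _ hC

end Curve

/-- The superposition operator `α ↦ f ∘ α` on continuous curves. -/
def superpose {V F : Type} [NormedAddCommGroup V] [NormedAddCommGroup F] (f : C(V, F)) :
    Curve V → Curve F := fun α => Curve.mk (fun t => f (α t)) (f.continuous.comp α.continuous)

theorem continuous_superpose {V F : Type} [NormedAddCommGroup V] [NormedAddCommGroup F]
    (f : C(V, F)) : Continuous (superpose f) :=
  ContinuousMap.continuous_postcomp (X := TimeInterval) f

/-- A curve in a space `L` acting linearly on `V` acts on curves in `V`. -/
def applyCurve {L V F : Type} [NormedAddCommGroup L] [NormedSpace ℝ L] [NormedAddCommGroup V]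
    [NormedSpace ℝ V] [NormedAddCommGroup F] [NormedSpace ℝ F] (B : L →L[ℝ] V →L[ℝ] F) : Curve L →L[ℝ] Curve V →L[ℝ] Curve F :=
  LinearMap.mkContinuous₂
    (LinearMap.mk₂ ℝ (fun (A : Curve L) (h : Curve V) =>
        Curve.mk (fun t => B (A t) (h t))
          ((B.continuous.comp A.continuous).clm_apply h.continuous))
      (by intros; ext; simp) (by intros; ext; simp) (by intros; ext; simp) (by intros; ext; simp))
    ‖B‖ (by
      intro A h
      rw [Curve.norm_le _ (by positivity)]
      intro t
      simp only [LinearMap.mk₂_apply, Curve.mk_apply]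
      refine (B.le_opNorm₂ _ _).trans ?_
      gcongr
      · exact A.norm_apply_le t
      · exact h.norm_apply_le t)

/-- At each time the mean value inequality on the segment from `α t` to `α t + h t` bounds the
remainder by the oscillation of `f'`. The bound is uniform in time because superposition with `f'`
is continuous in the supremum norm. -/
theorem hasFDerivAt_superpose {L V F : Type} [NormedAddCommGroup L] [NormedSpace ℝ L]
    [NormedAddCommGroup V] [NormedSpace ℝ V] [NormedAddCommGroup F] [NormedSpace ℝ F]
    (B : L →L[ℝ] V →L[ℝ] F) (f : C(V, F)) (f' : C(V, L))
    (hf : ∀ x, HasFDerivAt f (B (f' x)) x) (α : Curve V) :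
    HasFDerivAt (superpose f) (applyCurve B (superpose f' α)) α := by
  rw [hasFDerivAt_iff_isLittleO_nhds_zero, Asymptotics.isLittleO_iff]
  intro c hc
  have hcont : Continuous (superpose f') := continuous_superpose f'
  obtain ⟨δ, hδ, H⟩ := Metric.continuous_iff.1 hcont α (c / (‖B‖ + 1)) (by positivity)
  filter_upwards [Metric.ball_mem_nhds (0 : Curve V) hδ] with h hh
  rw [Curve.norm_le _ (by positivity)]
  intro t
  have hh' : ‖h‖ < δ := by simpa using hh
  have key := Convex.norm_image_sub_le_of_norm_hasFDerivWithin_le' (f := f)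
    (f' := fun x => B (f' x)) (φ := B (f' (α t))) (C := c)
    (s := segment ℝ (α t) (α t + h t)) (x := α t) (y := α t + h t)
    (fun x _ => (hf x).hasFDerivWithinAt) ?_ (convex_segment _ _) (left_mem_segment _ _ _)
    (right_mem_segment _ _ _)
  · simp only [add_sub_cancel_left] at key
    refine key.trans ?_
    gcongr
    exact h.norm_apply_le t
  · intro x hx
    rw [segment_eq_image'] at hx
    obtain ⟨θ, hθ, rfl⟩ := hx
    have h1 := H (α + θ • h) (by
      rw [dist_eq_norm, add_sub_cancel_left, norm_smul]
      refine lt_of_le_of_lt ?_ hh'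
      rw [Real.norm_eq_abs, abs_of_nonneg hθ.1]
      exact mul_le_of_le_one_left (norm_nonneg _) hθ.2)
    have h2 := (Curve.norm_apply_le (superpose f' (α + θ • h) - superpose f' α) t)
    rw [dist_eq_norm] at h1
    have h3 : ‖f' (α t + θ • h t) - f' (α t)‖ ≤ c / (‖B‖ + 1) := by
      simpa [superpose] using h2.trans h1.le
    simp only [add_sub_cancel_left]
    rw [← map_sub]
    refine (B.le_opNorm _).trans ((mul_le_mul_of_nonneg_left h3 (norm_nonneg _)).trans ?_)
    rw [mul_div_assoc', div_le_iff₀ (by positivity)]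
    nlinarith [norm_nonneg B]

theorem contDiff_succ_superpose {L V F : Type} [NormedAddCommGroup L] [NormedSpace ℝ L]
    [NormedAddCommGroup V] [NormedSpace ℝ V] [NormedAddCommGroup F] [NormedSpace ℝ F]
    (B : L →L[ℝ] V →L[ℝ] F) (f : C(V, F)) (f' : C(V, L))
    (hf : ∀ x, HasFDerivAt f (B (f' x)) x) {m : ℕ} (h : ContDiff ℝ m (superpose f')) :
    ContDiff ℝ (m + 1) (superpose f) :=
  contDiff_succ_iff_hasFDerivAt.2
    ⟨fun α => applyCurve B (superpose f' α), (applyCurve B).contDiff.comp h,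
      hasFDerivAt_superpose B f f' hf⟩

/-- The derivative of a superposition operator is again a superposition operator, followed by a
bounded bilinear map. The target changes from `F` to `V →L[ℝ] F`, so the induction quantifies over
all spaces of one universe. -/
theorem contDiff_superpose_nat (m : ℕ) : ∀ {V F : Type} [NormedAddCommGroup V] [NormedSpace ℝ V]
    [NormedAddCommGroup F] [NormedSpace ℝ F] (f : C(V, F)), ContDiff ℝ m f →
    ContDiff ℝ m (superpose f) := by
  induction m with
  | zero =>
    intro V F _ _ _ _ f _
    exact contDiff_zero.2 (continuous_superpose f)
  | succ m ih =>
    intro V F _ _ _ _ f hf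
    have hf' : ContDiff ℝ m (fderiv ℝ f) := hf.fderiv_right (by norm_cast)
    exact contDiff_succ_superpose (ContinuousLinearMap.id ℝ (V →L[ℝ] F)) f
      (ContinuousMap.mk (fderiv ℝ f) hf'.continuous)
      (fun x => (hf.differentiable (by simp) x).hasFDerivAt) (ih _ hf')

theorem contDiff_superpose {V F : Type} [NormedAddCommGroup V] [NormedSpace ℝ V]
    [NormedAddCommGroup F] [NormedSpace ℝ F] (f : C(V, F)) (hf : ContDiff ℝ ∞ f) :
    ContDiff ℝ ∞ (superpose f) :=
  contDiff_infty.2 fun m => contDiff_superpose_nat m f (hf.of_le (mod_cast le_top))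

/-- The primitive of a curve that vanishes at time `0`. -/
def primitive (V : Type) [NormedAddCommGroup V] [NormedSpace ℝ V] : Curve V →L[ℝ] Curve V :=
  LinearMap.mkContinuous
    { toFun := fun α => Curve.mk (fun t => ∫ s in (0 : ℝ)..t, IccExtend zero_le_one α s) (by
        have h : Continuous fun t : ℝ => ∫ s in (0 : ℝ)..t, IccExtend zero_le_one α s :=
          intervalIntegral.continuous_primitive
            (fun a b => (α.continuous.Icc_extend' (h := zero_le_one)).intervalIntegrable a b) 0
        exact h.comp continuous_subtype_val)
      map_add' := by
        intro α β
        ext t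
        simp only [Curve.mk_apply, Curve.add_apply]
        rw [← intervalIntegral.integral_add
          ((α.continuous.Icc_extend' (h := zero_le_one)).intervalIntegrable _ _)
          ((β.continuous.Icc_extend' (h := zero_le_one)).intervalIntegrable _ _)]
        rfl
      map_smul' := by
        intro a α
        ext t
        simp only [Curve.mk_apply, Curve.smul_apply, RingHom.id_apply]
        rw [← intervalIntegral.integral_smul]
        rfl } 1 (by
      intro α
      rw [Curve.norm_le _ (by positivity)]
      intro t
      simp only [LinearMap.coe_mk, AddHom.coe_mk, Curve.mk_apply, one_mul]
      refine (intervalIntegral.norm_integral_le_of_norm_le_const (C := ‖α‖) fun s _ =>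
        α.norm_apply_le _).trans ?_
      rw [sub_zero, abs_of_nonneg t.2.1]
      exact mul_le_of_le_one_right (norm_nonneg _) t.2.2)

theorem primitive_apply {V : Type} [NormedAddCommGroup V] [NormedSpace ℝ V]
    (α : Curve V) (t : TimeInterval) :
    primitive V α t = ∫ s in (0 : ℝ)..t, IccExtend zero_le_one α s := rfl

end Nemytskii

end FinslerHol

namespace FinslerHol

/-! ### Smooth dependence on initial values -/

section Flow

open scoped NNReal Topology

/-- Constant curves. -/
def constCurve (V : Type) [NormedAddCommGroup V] [NormedSpace ℝ V] : V →L[ℝ] Curve V :=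
  LinearMap.mkContinuous
    { toFun := fun x => Curve.mk (fun _ => x) continuous_const
      map_add' := fun _ _ => rfl
      map_smul' := fun _ _ => rfl } 1 (by
      intro x
      rw [Curve.norm_le _ (by positivity)]
      intro t
      exact (one_mul ‖x‖).ge)

@[simp] theorem constCurve_apply {V : Type} [NormedAddCommGroup V] [NormedSpace ℝ V] (x : V)
    (t : TimeInterval) : constCurve V x t = x := rfl

/-- Evaluation of a curve at a given time. -/
def evalCurve (V : Type) [NormedAddCommGroup V] [NormedSpace ℝ V] (t : TimeInterval) :
    Curve V →L[ℝ] V :=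
  LinearMap.mkContinuous
    { toFun := fun α => α t
      map_add' := fun _ _ => rfl
      map_smul' := fun _ _ => rfl } 1 (by
      intro α
      exact (α.norm_apply_le t).trans (one_mul ‖α‖).ge)

@[simp] theorem evalCurve_apply {V : Type} [NormedAddCommGroup V] [NormedSpace ℝ V]
    (t : TimeInterval) (α : Curve V) : evalCurve V t α = α t := rfl

/-- Multiplication of a curve by a continuous scalar function. -/
def scaleCurve (V : Type) [NormedAddCommGroup V] [NormedSpace ℝ V] (a : C(ℝ, ℝ)) :
    Curve V →L[ℝ] Curve V :=
  applyCurve (ContinuousLinearMap.lsmul ℝ ℝ : ℝ →L[ℝ] V →L[ℝ] V)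
    (Curve.mk (fun t => a t) (a.continuous.comp continuous_subtype_val))

@[simp] theorem scaleCurve_apply {V : Type} [NormedAddCommGroup V] [NormedSpace ℝ V] (a : C(ℝ, ℝ))
    (α : Curve V) (t : TimeInterval) : scaleCurve V a α t = a t • α t := rfl

variable {V : Type} [NormedAddCommGroup V] [NormedSpace ℝ V]

/-- The exponential weight `t ↦ exp (a t)`. -/
def expWeight (a : ℝ) : C(ℝ, ℝ) := ⟨fun t => Real.exp (a * t), by fun_prop⟩

/-- The Picard operator of the vector field `f`, conjugated by an exponential weight. -/
def picardPart (f : C(V, V)) (a : ℝ) (β : Curve V) : Curve V :=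
  scaleCurve V (expWeight (-a)) (primitive V (superpose f (scaleCurve V (expWeight a) β)))

/-- Bielecki's weighted norm, realised by conjugation: `exp (-a t) ∫₀ᵗ K exp (a s) ds ≤ K / a`, so a
large `a` gives a contraction on all of `[0, 1]`, however large `K` is. -/
theorem norm_picardPart_sub_le (f : C(V, V)) {K : ℝ≥0} (hK : LipschitzWith K f) {a : ℝ}
    (ha : 0 < a) (β₁ β₂ : Curve V) :
    ‖picardPart f a β₁ - picardPart f a β₂‖ ≤ K / a * ‖β₁ - β₂‖ := by
  rw [Curve.norm_le _ (by positivity)]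
  intro t
  simp only [picardPart, Curve.sub_apply, scaleCurve_apply]
  rw [← smul_sub, ← Curve.sub_apply, ← map_sub, primitive_apply, norm_smul]
  have hexp : ‖expWeight (-a) t‖ = Real.exp (-a * t) := by
    simp [expWeight]
  rw [hexp]
  have h1 : ‖∫ s in (0 : ℝ)..t, IccExtend zero_le_one
      (superpose f (scaleCurve V (expWeight a) β₁) - superpose f (scaleCurve V (expWeight a) β₂) :
        Curve V) s‖ ≤ ∫ s in (0 : ℝ)..t, K * ‖β₁ - β₂‖ * Real.exp (a * s) := by
    have hc : Continuous fun s : ℝ => K * ‖β₁ - β₂‖ * Real.exp (a * s) := by fun_prop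
    refine intervalIntegral.norm_integral_le_of_norm_le t.2.1
      (Filter.Eventually.of_forall fun s hs => ?_) (hc.intervalIntegrable _ _)
    have hs' : s ∈ Icc (0 : ℝ) 1 := ⟨hs.1.le, hs.2.trans t.2.2⟩
    rw [IccExtend_of_mem _ _ hs']
    have h2 := hK.dist_le_mul (Real.exp (a * s) • β₁ ⟨s, hs'⟩) (Real.exp (a * s) • β₂ ⟨s, hs'⟩)
    rw [dist_eq_norm, dist_eq_norm, ← smul_sub, norm_smul, Real.norm_eq_abs, Real.abs_exp] at h2
    refine (show _ ≤ _ from h2).trans ?_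
    rw [mul_comm (Real.exp _), ← mul_assoc]
    gcongr
    exact (β₁ - β₂).norm_apply_le ⟨s, hs'⟩
  have h3 : ∫ s in (0 : ℝ)..t, K * ‖β₁ - β₂‖ * Real.exp (a * s) =
      K * ‖β₁ - β₂‖ * (Real.exp (a * t) / a) - K * ‖β₁ - β₂‖ * (Real.exp (a * 0) / a) := by
    have hc : Continuous fun s : ℝ => K * ‖β₁ - β₂‖ * Real.exp (a * s) := by fun_prop
    refine intervalIntegral.integral_eq_sub_of_hasDerivAt
      (f := fun s => K * ‖β₁ - β₂‖ * (Real.exp (a * s) / a)) (fun s _ => ?_)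
      (hc.intervalIntegrable _ _)
    have := (((hasDerivAt_id s).const_mul a).exp.div_const a).const_mul (K * ‖β₁ - β₂‖)
    refine this.congr_deriv ?_
    simp only [id]
    field_simp
  have h4 : Real.exp (-a * t) * Real.exp (a * t) = 1 := by
    rw [← Real.exp_add]; simp
  calc _ ≤ Real.exp (-a * t) * (K * ‖β₁ - β₂‖ * (Real.exp (a * t) / a)) := by
        gcongr
        refine h1.trans (h3.le.trans (sub_le_self _ (by positivity)))
    _ = (Real.exp (-a * t) * Real.exp (a * t)) * (K / a * ‖β₁ - β₂‖) := by ring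
    _ = _ := by rw [h4, one_mul]

theorem contDiff_picardPart (f : C(V, V)) (hf : ContDiff ℝ ∞ f) (a : ℝ) :
    ContDiff ℝ ∞ (picardPart f a) :=
  (scaleCurve V _).contDiff.comp ((primitive V).contDiff.comp
    ((contDiff_superpose f hf).comp (scaleCurve V _).contDiff))

/-- A smooth map that differs from the identity by a contraction has a smooth inverse. -/
theorem exists_contDiff_inverse_of_contraction {B : Type} [NormedAddCommGroup B] [NormedSpace ℝ B]
    [CompleteSpace B] (p : B → B) (hp : ContDiff ℝ ∞ p) {c : ℝ≥0} (hc : c < 1)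
    (hcontr : ∀ x y, ‖p x - p y‖ ≤ c * ‖x - y‖) :
    ∃ q : B → B, ContDiff ℝ ∞ q ∧ ∀ x, q x - p (q x) = x := by
  set Ξ : B → B := fun x => x - p x with hΞ
  -- `id - p` is within `c < 1` of the identity, hence a homeomorphism; its derivative `id - p'` is
  -- invertible by the Neumann series, so the inverse is smooth.
  have happrox : ApproximatesLinearOn Ξ
      ((ContinuousLinearEquiv.refl ℝ B : B ≃L[ℝ] B) : B →L[ℝ] B) univ c := by
    intro x _ y _
    have : Ξ x - Ξ y - ((ContinuousLinearEquiv.refl ℝ B : B ≃L[ℝ] B) : B →L[ℝ] B) (x - y) =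
        -(p x - p y) := by
      simp [hΞ]
      abel
    rw [this, norm_neg]
    exact hcontr x y
  have hcond : Subsingleton B ∨
      c < ‖((ContinuousLinearEquiv.refl ℝ B).symm : B →L[ℝ] B)‖₊⁻¹ := by
    rcases subsingleton_or_nontrivial B with h | h
    · exact Or.inl h
    · right
      have : ‖((ContinuousLinearEquiv.refl ℝ B).symm : B →L[ℝ] B)‖₊ = 1 :=
        ContinuousLinearMap.nnnorm_id
      rw [this, inv_one]
      exact hc
  let e : B ≃ₜ B := happrox.toHomeomorph Ξ hcond
  have he : ⇑e = Ξ := rfl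
  have hlip : LipschitzWith c p := LipschitzWith.of_dist_le_mul fun x y => by
    rw [dist_eq_norm, dist_eq_norm]; exact hcontr x y
  have hunit : ∀ a, ‖fderiv ℝ p a‖ < 1 := fun a =>
    lt_of_le_of_lt (norm_fderiv_le_of_lipschitz ℝ hlip) (by exact_mod_cast hc)
  let D : B → B ≃L[ℝ] B := fun a =>
    ContinuousLinearEquiv.unitsEquiv ℝ B (Units.oneSub (fderiv ℝ p a) (hunit a))
  have hD : ∀ a, HasFDerivAt e (D a : B →L[ℝ] B) a := by
    intro a
    rw [he]
    have h := (hasFDerivAt_id (𝕜 := ℝ) a).sub (hp.differentiable (by simp) a).hasFDerivAt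
    exact h
  refine ⟨e.symm, e.contDiff_symm hD (contDiff_id.sub hp), fun x => ?_⟩
  exact e.apply_symm_apply x

/-- The integral curves on `[0, 1]` of a smooth Lipschitz vector field depend smoothly on the
initial value. -/
theorem exists_flow [CompleteSpace V] {f : V → V} (hf : ContDiff ℝ ∞ f) {K : ℝ≥0}
    (hK : LipschitzWith K f) :
    ∃ γ : V → ℝ → V, (∀ x, γ x 0 = x) ∧ (∀ x t, t ∈ Icc (0 : ℝ) 1 →
      HasDerivAt (γ x) (f (γ x t)) t) ∧ ContDiff ℝ ∞ (fun x => γ x 1) := by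
  let fc : C(V, V) := ⟨f, hf.continuous⟩
  -- With this weight the contraction constant is `K / (K + 1) < 1`.
  set a : ℝ := K + 1 with ha
  have ha0 : 0 < a := by positivity
  obtain ⟨q, hq, hqeq⟩ := exists_contDiff_inverse_of_contraction (picardPart fc a)
    (contDiff_picardPart fc hf a) (c := K / (K + 1))
    (by rw [div_lt_one (by positivity)]; exact lt_add_one K)
    (fun x y => by
      have := norm_picardPart_sub_le fc hK ha0 x y
      simpa [ha] using this)
  let α : V → Curve V := fun x =>
    scaleCurve V (expWeight a) (q (scaleCurve V (expWeight (-a)) (constCurve V x)))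
  have hw : ∀ t : ℝ, expWeight a t * expWeight (-a) t = 1 := by
    intro t
    simp only [expWeight, ContinuousMap.coe_mk]
    rw [← Real.exp_add]; simp
  -- Removing the exponential weight gives the integral equation of the flow.
  have hα : ∀ x, α x = constCurve V x + primitive V (superpose fc (α x)) := by
    intro x
    have h := hqeq (scaleCurve V (expWeight (-a)) (constCurve V x))
    ext t
    have h' := congrArg (fun β : Curve V => expWeight a t • β t) (sub_eq_iff_eq_add.1 h)
    simp only [picardPart, Curve.add_apply, scaleCurve_apply, smul_add, smul_smul, hw,
      one_smul] at h'
    exact h'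
  have hαc : ∀ x, Continuous (IccExtend zero_le_one (superpose fc (α x))) := fun x =>
    (superpose fc (α x)).continuous.Icc_extend'
  have key : ∀ x (t : TimeInterval),
      x + ∫ s in (0 : ℝ)..t, IccExtend zero_le_one (superpose fc (α x)) s = α x t := by
    intro x t
    conv_rhs => rw [hα]
    rfl
  -- The integral formula also makes sense outside `[0, 1]`, so the derivative is two-sided at the
  -- endpoints too.
  refine ⟨fun x t => x + ∫ s in (0 : ℝ)..t, IccExtend zero_le_one (superpose fc (α x)) s,
    fun x => by simp, fun x t ht => ?_, ?_⟩
  · have h1 := ((hαc x).integral_hasStrictDerivAt 0 t).hasDerivAt.const_add x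
    refine h1.congr_deriv ?_
    rw [IccExtend_of_mem _ _ ht]
    have := key x ⟨t, ht⟩
    simp only at this
    simp only [this]
    rfl
  · have : (fun x => x + ∫ s in (0 : ℝ)..1, IccExtend zero_le_one (superpose fc (α x)) s) =
        fun x => α x ⟨1, by simp⟩ := by
      funext x
      exact key x ⟨1, by simp⟩
    rw [this]
    exact (evalCurve V ⟨1, by simp⟩).contDiff.comp ((scaleCurve V _).contDiff.comp (hq.comp
      ((scaleCurve V _).contDiff.comp (constCurve V).contDiff)))

end Flow

/-! ### Division of smooth functions by a parameter -/

section Division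

open scoped Topology

variable {V F P : Type} [NormedAddCommGroup V] [NormedSpace ℝ V] [NormedAddCommGroup F]
  [NormedSpace ℝ F] [NormedAddCommGroup P] [NormedSpace ℝ P]

theorem exists_cutoff [FiniteDimensional ℝ V] {K Ω : Set V} (hK : IsCompact K) (hΩ : IsOpen Ω)
    (h : K ⊆ Ω) :
    ∃ χ : V → ℝ, ContDiff ℝ ∞ χ ∧ HasCompactSupport χ ∧ tsupport χ ⊆ Ω ∧
      (∀ᶠ x in 𝓝ˢ K, χ x = 1) ∧ ∀ x, χ x ∈ Icc (0 : ℝ) 1 := by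
  obtain ⟨K', hK', h1, h2⟩ := exists_compact_between hK hΩ h
  obtain ⟨χ, hχ1, hχ0, hχ⟩ :=
    exists_contMDiffMap_one_nhds_of_subset_interior (n := ⊤) 𝓘(ℝ, V) hK.isClosed h1
  have hsupp : Function.support χ ⊆ K' := fun x hx => by
    by_contra hx'
    exact hx (hχ0 x hx')
  exact ⟨χ, χ.contMDiff.contDiff, HasCompactSupport.of_support_subset_isCompact hK' hsupp,
    (closure_minimal hsupp hK'.isClosed).trans h2, hχ1, hχ⟩

theorem contDiff_cutoff_smul {Ω : Set V} (hΩ : IsOpen Ω) {χ : V → ℝ} (hχ : ContDiff ℝ ∞ χ)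
    (hsupp : tsupport χ ⊆ Ω) {f : V → F} (hf : ContDiffOn ℝ ∞ f Ω) :
    ContDiff ℝ ∞ fun x => χ x • f x := by
  rw [contDiff_iff_contDiffAt]
  intro x
  by_cases hx : x ∈ tsupport χ
  · exact hχ.contDiffAt.smul (hf.contDiffAt (hΩ.mem_nhds (hsupp hx)))
  · refine (contDiffAt_const (c := (0 : F))).congr_of_eventuallyEq ?_
    filter_upwards [notMem_tsupport_iff_eventuallyEq.1 hx] with y hy
    simp [hy]

/-- Hadamard's lemma: the quotient is `∫₀¹ ∂f/∂τ (s τ, p) ds`. The curve `s ↦ (s τ, p)` depends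
linearly on `(τ, p)`, so smoothness of the integral is smoothness of superposition followed by a
continuous linear map. -/
theorem exists_contDiff_div [CompleteSpace F] {f : ℝ × P → F} (hf : ContDiff ℝ ∞ f)
    (h0 : ∀ p, f (0, p) = 0) :
    ∃ g : ℝ × P → F, ContDiff ℝ ∞ g ∧ ∀ q, f q = q.1 • g q := by
  let f₁ : C(ℝ × P, F) := ⟨fun q => fderiv ℝ f q (1, 0), by
    have := (hf.fderiv_right (m := ∞) (by simp)).continuous
    fun_prop⟩
  have hf₁ : ContDiff ℝ ∞ f₁ := by
    have := hf.fderiv_right (m := ∞) (by simp)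
    exact this.clm_apply contDiff_const
  let c : ℝ × P →L[ℝ] Curve (ℝ × P) :=
    scaleCurve _ (ContinuousMap.id ℝ) ∘L constCurve _ ∘L
      ((ContinuousLinearMap.fst ℝ ℝ P).prod (0 : ℝ × P →L[ℝ] P)) +
    constCurve _ ∘L ((0 : ℝ × P →L[ℝ] ℝ).prod (ContinuousLinearMap.snd ℝ ℝ P))
  have hc : ∀ q t, c q t = ((t : ℝ) * q.1, q.2) := by
    intro q t
    simp [c]
  refine ⟨fun q => evalCurve F ⟨1, by simp⟩ (primitive F (superpose f₁ (c q))),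
    (evalCurve F ⟨1, by simp⟩).contDiff.comp ((primitive F).contDiff.comp
      ((contDiff_superpose f₁ hf₁).comp c.contDiff)), fun q => ?_⟩
  simp only [evalCurve_apply, primitive_apply]
  have hcont : Continuous (IccExtend zero_le_one (superpose f₁ (c q))) :=
    (superpose f₁ (c q)).continuous.Icc_extend'
  rw [← intervalIntegral.integral_smul]
  have h1 : ∫ s in (0 : ℝ)..1, q.1 • IccExtend zero_le_one (superpose f₁ (c q)) s =
      f (1 * q.1, q.2) - f (0 * q.1, q.2) := by
    refine intervalIntegral.integral_eq_sub_of_hasDerivAt (f := fun s : ℝ => f (s * q.1, q.2))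
      (fun s hs => ?_) ((hcont.const_smul q.1).intervalIntegrable _ _)
    rw [uIcc_of_le zero_le_one] at hs
    rw [IccExtend_of_mem _ _ hs]
    have h2 : HasDerivAt (fun s : ℝ => (s * q.1, q.2)) (q.1, (0 : P)) s := by
      simpa using ((hasDerivAt_id s).mul_const q.1).prodMk (hasDerivAt_const s q.2)
    have h3 := ((hf.differentiable (by simp) (s * q.1, q.2)).hasFDerivAt).comp_hasDerivAt s h2
    refine h3.congr_deriv ?_
    have h4 : (q.1, (0 : P)) = q.1 • ((1 : ℝ), (0 : P)) := by simp
    rw [h4, map_smul]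
    simp only [superpose, Curve.mk_apply, hc, f₁, ContinuousMap.coe_mk]
  simpa [h0] using h1.symm

/-- The quotient of `f` by its first argument `τ`, completed by `∂f/∂τ` at `τ = 0`. -/
def paramQuotient (f : ℝ × P → F) (q : ℝ × P) : F :=
  open Classical in if q.1 = 0 then deriv (fun τ => f (τ, q.2)) 0 else q.1⁻¹ • f q

omit [NormedAddCommGroup P] [NormedSpace ℝ P] in
theorem paramQuotient_zero (f : ℝ × P → F) (p : P) :
    paramQuotient f (0, p) = deriv (fun τ => f (τ, p)) 0 := by
  simp [paramQuotient]

omit [NormedAddCommGroup P] [NormedSpace ℝ P] in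
theorem smul_paramQuotient {f : ℝ × P → F} {q : ℝ × P} (h : q.1 = 0 → f q = 0) :
    q.1 • paramQuotient f q = f q := by
  by_cases hq : q.1 = 0
  · simp [hq, h hq]
  · simp [paramQuotient, hq, smul_smul]

/-- Only points with `τ = 0` need an argument. There a cutoff extends `f` to a global function
vanishing on `τ = 0`, and the Hadamard quotient of the extension agrees with the quotient of `f`
near the point. Finite dimension provides the cutoff. -/
theorem contDiffOn_paramQuotient [CompleteSpace F] [FiniteDimensional ℝ P] {f : ℝ × P → F}
    {Ω : Set (ℝ × P)} (hΩ : IsOpen Ω) (hf : ContDiffOn ℝ ∞ f Ω)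
    (h0 : ∀ p, (0, p) ∈ Ω → f (0, p) = 0) : ContDiffOn ℝ ∞ (paramQuotient f) Ω := by
  rintro ⟨τ, p⟩ hq
  refine ContDiffAt.contDiffWithinAt ?_
  by_cases hτ : τ = 0
  · subst hτ
    obtain ⟨χ, hχ, -, hsupp, hone, -⟩ :=
      exists_cutoff (isCompact_singleton (x := ((0 : ℝ), p))) hΩ (singleton_subset_iff.2 hq)
    rw [nhdsSet_singleton] at hone
    obtain ⟨g, hg, hgf⟩ := exists_contDiff_div (contDiff_cutoff_smul hΩ hχ hsupp hf) (fun p' => by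
      by_cases h : ((0 : ℝ), p') ∈ Ω
      · simp [h0 p' h]
      · rw [image_eq_zero_of_notMem_tsupport fun h' => h (hsupp h'), zero_smul])
    refine hg.contDiffAt.congr_of_eventuallyEq ?_
    filter_upwards [hone.eventually_nhds, hΩ.mem_nhds hq] with q' hq' hq'Ω
    by_cases hz : q'.1 = 0
    · obtain ⟨τ', p'⟩ := q'
      simp only at hz
      subst hz
      rw [paramQuotient_zero]
      have h1 : HasDerivAt (fun τ => τ • g (τ, p')) (g (0, p')) 0 := by
        have h2 : DifferentiableAt ℝ (fun τ : ℝ => g (τ, p')) 0 :=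
          (hg.comp (contDiff_id.prodMk contDiff_const)).differentiable (by simp) 0
        simpa using (hasDerivAt_id' (0 : ℝ)).fun_smul h2.hasDerivAt
      refine HasDerivAt.deriv (h1.congr_of_eventuallyEq ?_)
      have h3 : Filter.Tendsto (fun τ : ℝ => (τ, p')) (𝓝 0) (𝓝 ((0 : ℝ), p')) :=
        (Continuous.prodMk continuous_id continuous_const).tendsto' _ _ rfl
      filter_upwards [h3.eventually hq'] with τ hτ
      rw [← hgf (τ, p'), hτ, one_smul]
    · have h1 := hgf q'
      rw [hq'.self_of_nhds, one_smul] at h1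
      rw [paramQuotient, if_neg hz, h1, smul_smul, inv_mul_cancel₀ hz, one_smul]
  · have hne : ∀ᶠ q' : ℝ × P in 𝓝 (τ, p), q'.1 ≠ 0 :=
      (continuous_fst.continuousAt (x := (τ, p))).eventually_ne hτ
    have h1 : ContDiffAt ℝ ∞ (fun q : ℝ × P => q.1⁻¹ • f q) (τ, p) :=
      (contDiffAt_fst.inv hτ).smul (hf.contDiffAt (hΩ.mem_nhds hq))
    refine h1.congr_of_eventuallyEq ?_
    filter_upwards [hne] with q' hq'
    rw [paramQuotient, if_neg hq']

end Division

end FinslerHol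

namespace FinslerHol

/-! ### Commutators of families of diffeomorphisms -/

section Commutators

open scoped Topology

variable {W : Type} [NormedAddCommGroup W] [NormedSpace ℝ W]

theorem ContDiffOn.comp_param {A X F : Type} [NormedAddCommGroup A] [NormedSpace ℝ A]
    [NormedAddCommGroup X] [NormedSpace ℝ X] [NormedAddCommGroup F] [NormedSpace ℝ F]
    {U : Set W} {v : A × W → F} {m : WithTop ℕ∞} (hv : ContDiffOn ℝ m v (univ ×ˢ U)) {s : Set X}
    {a : X → A} {z : X → W} (ha : ContDiffOn ℝ m a s) (hz : ContDiffOn ℝ m z s)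
    (hm : ∀ x ∈ s, z x ∈ U) : ContDiffOn ℝ m (fun x => v (a x, z x)) s :=
  hv.comp (ha.prodMk hz) fun x hx => ⟨mem_univ _, hm x hx⟩

/-- `φ` is a smooth one-parameter family of diffeomorphisms of `U` of the form `id + t ^ k g`. -/
structure IsFamilyOfOrder (U : Set W) (k : ℕ) (φ : ℝ → Equiv.Perm W) (g : ℝ × W → W) : Prop where
  maps : ∀ t, ∀ z ∈ U, φ t z ∈ U
  maps_symm : ∀ t, ∀ z ∈ U, (φ t).symm z ∈ U
  smooth : ContDiffOn ℝ ∞ (fun q : ℝ × W => φ q.1 q.2) (univ ×ˢ U)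
  smooth_symm : ContDiffOn ℝ ∞ (fun q : ℝ × W => (φ q.1).symm q.2) (univ ×ˢ U)
  smooth_coeff : ContDiffOn ℝ ∞ g (univ ×ˢ U)
  eq_add : ∀ t, ∀ z ∈ U, φ t z = z + t ^ k • g (t, z)

/-- First-order expansion of `v` along the displacement `τ g` with smooth remainder. The factor `τ`
is a variable independent of the time `a` of `g`, so that `τ = a ^ k` can be substituted afterwards
without losing smoothness. -/
theorem exists_increment [FiniteDimensional ℝ W] {U : Set W} (hU : IsOpen U) {v g : ℝ × W → W}
    (hv : ContDiffOn ℝ ∞ v (univ ×ˢ U)) (hg : ContDiffOn ℝ ∞ g (univ ×ˢ U)) :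
    ∃ Q : ℝ × ((ℝ × ℝ) × W) → W,
      ContDiffOn ℝ ∞ Q {q | q.2.2 ∈ U ∧ q.2.2 + q.1 • g (q.2.1.1, q.2.2) ∈ U} ∧
      (∀ τ a b z, z ∈ U → z + τ • g (a, z) ∈ U →
        v (b, z + τ • g (a, z)) = v (b, z) + τ • Q (τ, ((a, b), z))) ∧
      ∀ a b, ∀ z ∈ U, Q (0, ((a, b), z)) = fderiv ℝ (fun z' => v (b, z')) z (g (a, z)) := by
  have : CompleteSpace W := FiniteDimensional.complete ℝ W
  set A : Set (ℝ × ((ℝ × ℝ) × W)) := {q | q.2.2 ∈ U} with hA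
  set Ω : Set (ℝ × ((ℝ × ℝ) × W)) := {q | q.2.2 ∈ U ∧ q.2.2 + q.1 • g (q.2.1.1, q.2.2) ∈ U} with hΩ
  have hAo : IsOpen A := hU.preimage (by fun_prop)
  have hm : ContDiffOn ℝ ∞ (fun q : ℝ × ((ℝ × ℝ) × W) => q.2.2 + q.1 • g (q.2.1.1, q.2.2)) A := by
    have h1 : ContDiffOn ℝ ∞ (fun q : ℝ × ((ℝ × ℝ) × W) => g (q.2.1.1, q.2.2)) A :=
      ContDiffOn.comp_param hg (by fun_prop) (by fun_prop) fun x hx => hx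
    exact ContDiffOn.add (by fun_prop) (ContDiffOn.smul (by fun_prop) h1)
  have hΩo : IsOpen Ω := hm.continuousOn.isOpen_inter_preimage hAo hU
  have hf : ContDiffOn ℝ ∞ (fun q : ℝ × ((ℝ × ℝ) × W) =>
      v (q.2.1.2, q.2.2 + q.1 • g (q.2.1.1, q.2.2)) - v (q.2.1.2, q.2.2)) Ω :=
    (ContDiffOn.comp_param hv (by fun_prop) (hm.mono fun q hq => hq.1) fun x hx => hx.2).sub
      (ContDiffOn.comp_param hv (by fun_prop) (by fun_prop) fun x hx => hx.1)
  refine ⟨paramQuotient fun q : ℝ × ((ℝ × ℝ) × W) =>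
      v (q.2.1.2, q.2.2 + q.1 • g (q.2.1.1, q.2.2)) - v (q.2.1.2, q.2.2),
    contDiffOn_paramQuotient hΩo hf (by simp), fun τ a b z _ _ => ?_, fun a b z hz => ?_⟩
  · have h1 := smul_paramQuotient (f := fun q : ℝ × ((ℝ × ℝ) × W) =>
      v (q.2.1.2, q.2.2 + q.1 • g (q.2.1.1, q.2.2)) - v (q.2.1.2, q.2.2))
      (q := (τ, ((a, b), z))) (by rintro rfl; simp)
    simp only at h1
    rw [h1]
    abel
  · rw [paramQuotient_zero]
    have h1 : HasDerivAt (fun τ : ℝ => z + τ • g (a, z)) (g (a, z)) 0 := by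
      simpa using ((hasDerivAt_id' (0 : ℝ)).smul_const (g (a, z))).const_add z
    have h2 : DifferentiableAt ℝ (fun z' => v (b, z')) z :=
      ((ContDiffOn.comp_param hv (s := U) (a := fun _ => b) (z := fun z' => z') (by fun_prop)
        (by fun_prop) fun x hx => hx).contDiffAt (hU.mem_nhds hz)).differentiableAt (by simp)
    have h3 : HasFDerivAt (fun z' => v (b, z')) (fderiv ℝ (fun z' => v (b, z')) z)
        (z + (0 : ℝ) • g (a, z)) := by
      simpa using h2.hasFDerivAt
    exact (HasDerivAt.sub_const (v (b, z)) (h3.comp_hasDerivAt (0 : ℝ) h1)).deriv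

/-- The discrepancy between `ψ φ` and `φ ψ` carries the factor `a ^ k * b ^ l`. Replacing this
factor by a free variable `τ` before applying `φ⁻¹` and `ψ⁻¹` yields a smooth function vanishing at
`τ = 0`; its quotient by `τ` gives `K`. -/
theorem IsFamilyOfOrder.exists_commutator [FiniteDimensional ℝ W] {U : Set W} (hU : IsOpen U)
    {k l : ℕ} (hk : k ≠ 0) (hl : l ≠ 0) {φ ψ : ℝ → Equiv.Perm W} {g h : ℝ × W → W}
    (hφ : IsFamilyOfOrder U k φ g) (hψ : IsFamilyOfOrder U l ψ h) :
    ∃ K : (ℝ × ℝ) × W → W, ContDiffOn ℝ ∞ K (univ ×ˢ U) ∧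
      (∀ a b, ∀ z ∈ U,
        ((ψ b)⁻¹ * (φ a)⁻¹ * ψ b * φ a) z = z + (a ^ k * b ^ l) • K ((a, b), z)) ∧
      ∀ z ∈ U, K ((0, 0), z) =
        VectorField.lieBracket ℝ (fun z => g (0, z)) (fun z => h (0, z)) z := by
  have : CompleteSpace W := FiniteDimensional.complete ℝ W
  obtain ⟨Q₁, hQ₁, hQ₁e, hQ₁0⟩ := exists_increment hU hψ.smooth_coeff hφ.smooth_coeff
  obtain ⟨Q₂, hQ₂, hQ₂e, hQ₂0⟩ := exists_increment hU hφ.smooth_coeff hψ.smooth_coeff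
  set κ : (ℝ × ℝ) × W → W := fun q =>
    Q₁ (q.1.1 ^ k, q) - Q₂ (q.1.2 ^ l, ((q.1.2, q.1.1), q.2)) with hκ
  have hκs : ContDiffOn ℝ ∞ κ (univ ×ˢ U) := by
    refine ContDiffOn.sub
      (hQ₁.comp (t := _) (f := fun q : (ℝ × ℝ) × W => (q.1.1 ^ k, q)) (by fun_prop) ?_)
      (hQ₂.comp (f := fun q : (ℝ × ℝ) × W => (q.1.2 ^ l, ((q.1.2, q.1.1), q.2)))
        (by fun_prop) ?_)
    · rintro ⟨⟨a, b⟩, z⟩ ⟨-, hz⟩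
      exact ⟨hz, by simpa [← hφ.eq_add a z hz] using hφ.maps a z hz⟩
    · rintro ⟨⟨a, b⟩, z⟩ ⟨-, hz⟩
      exact ⟨hz, by simpa [← hψ.eq_add b z hz] using hψ.maps b z hz⟩
  -- Both sides contain `z + a ^ k • g + b ^ l • h`. The rest are the increments of `h` along `g`
  -- and of `g` along `h`, each with factor `a ^ k * b ^ l`; at `a = b = 0` their difference is
  -- `Dh(g) - Dg(h)`.
  have hcomm : ∀ a b, ∀ z ∈ U, ψ b (φ a z) = φ a (ψ b z) + (a ^ k * b ^ l) • κ ((a, b), z) := by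
    intro a b z hz
    have e₁ := hQ₁e (a ^ k) a b z hz (by rw [← hφ.eq_add a z hz]; exact hφ.maps a z hz)
    have e₂ := hQ₂e (b ^ l) b a z hz (by rw [← hψ.eq_add b z hz]; exact hψ.maps b z hz)
    rw [hψ.eq_add b _ (hφ.maps a z hz), hφ.eq_add a _ (hψ.maps b z hz), hφ.eq_add a z hz,
      hψ.eq_add b z hz, e₁, e₂]
    simp only [hκ, smul_add, smul_sub, smul_smul, mul_comm (b ^ l) (a ^ k)]
    abel
  set A : Set (ℝ × ((ℝ × ℝ) × W)) := {q | q.2.2 ∈ U} with hA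
  have hAo : IsOpen A := hU.preimage (by fun_prop)
  set m : ℝ × ((ℝ × ℝ) × W) → W := fun q => φ q.2.1.1 (ψ q.2.1.2 q.2.2) + q.1 • κ q.2 with hm
  have hms : ContDiffOn ℝ ∞ m A := by
    have h1 : ContDiffOn ℝ ∞ (fun q : ℝ × ((ℝ × ℝ) × W) => ψ q.2.1.2 q.2.2) A :=
      ContDiffOn.comp_param hψ.smooth (by fun_prop) (by fun_prop) fun x hx => hx
    have h2 : ContDiffOn ℝ ∞ (fun q : ℝ × ((ℝ × ℝ) × W) => φ q.2.1.1 (ψ q.2.1.2 q.2.2)) A :=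
      ContDiffOn.comp_param hφ.smooth (by fun_prop) h1 fun x hx => hψ.maps _ _ hx
    refine h2.add (ContDiffOn.smul (by fun_prop) ?_)
    exact hκs.comp (by fun_prop) fun q hq => ⟨mem_univ _, hq⟩
  set Ω : Set (ℝ × ((ℝ × ℝ) × W)) := A ∩ m ⁻¹' U with hΩ
  have hΩo : IsOpen Ω := hms.continuousOn.isOpen_inter_preimage hAo hU
  -- For free `τ` the point `φ ψ z + τ κ` may leave `U`, whence the open set `Ω`; at `τ = a ^ k * b
  -- ^ l` it is `ψ φ z`, which lies in `U`.
  set f : ℝ × ((ℝ × ℝ) × W) → W := fun q =>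
    (ψ q.2.1.2).symm ((φ q.2.1.1).symm (m q)) - q.2.2 with hf
  have hfs : ContDiffOn ℝ ∞ f Ω := by
    have h1 : ContDiffOn ℝ ∞ (fun q : ℝ × ((ℝ × ℝ) × W) => (φ q.2.1.1).symm (m q)) Ω :=
      ContDiffOn.comp_param hφ.smooth_symm (by fun_prop) (hms.mono inter_subset_left)
        fun x hx => hx.2
    have h2 : ContDiffOn ℝ ∞ (fun q : ℝ × ((ℝ × ℝ) × W) =>
        (ψ q.2.1.2).symm ((φ q.2.1.1).symm (m q))) Ω :=
      ContDiffOn.comp_param hψ.smooth_symm (by fun_prop) h1 fun x hx => hφ.maps_symm _ _ hx.2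
    exact h2.sub (by fun_prop)
  have hf0 : ∀ p, f (0, p) = 0 := by
    rintro ⟨⟨a, b⟩, z⟩
    simp [hf, hm]
  have hφ0 : ∀ z ∈ U, φ 0 z = z := fun z hz => by simp [hφ.eq_add 0 z hz, hk]
  have hψ0 : ∀ z ∈ U, ψ 0 z = z := fun z hz => by simp [hψ.eq_add 0 z hz, hl]
  have hmem : ∀ a b, ∀ z ∈ U, ((a ^ k * b ^ l, ((a, b), z)) : ℝ × ((ℝ × ℝ) × W)) ∈ Ω := by
    intro a b z hz
    refine ⟨hz, ?_⟩
    simp only [hm, mem_preimage]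
    rw [← hcomm a b z hz]
    exact hψ.maps _ _ (hφ.maps _ _ hz)
  refine ⟨fun q => paramQuotient f (q.1.1 ^ k * q.1.2 ^ l, q), ?_, fun a b z hz => ?_,
    fun z hz => ?_⟩
  · refine (contDiffOn_paramQuotient hΩo hfs fun p _ => hf0 p).comp
      (f := fun q : (ℝ × ℝ) × W => (q.1.1 ^ k * q.1.2 ^ l, q)) (by fun_prop) ?_
    rintro ⟨⟨a, b⟩, z⟩ ⟨-, hz⟩
    exact hmem a b z hz
  · have h1 := smul_paramQuotient (f := f) (q := (a ^ k * b ^ l, ((a, b), z)))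
      (by intro h; simp only at h; rw [h, hf0])
    simp only at h1
    simp only
    rw [h1]
    simp only [hf, hm]
    rw [← hcomm a b z hz]
    simp [Equiv.Perm.inv_def]
  · simp only [ne_eq, hk, not_false_eq_true, zero_pow, hl, mul_zero]
    rw [paramQuotient_zero]
    have hκ0 : κ ((0, 0), z) =
        VectorField.lieBracket ℝ (fun z => g (0, z)) (fun z => h (0, z)) z := by
      simp only [hκ, ne_eq, hk, not_false_eq_true, zero_pow, hl, hQ₁0 0 0 z hz, hQ₂0 0 0 z hz]
      rfl
    rw [← hκ0]
    -- At `a = b = 0` both families are the identity on `U`, so `f` reduces to `τ κ` for small `τ`.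
    have h1 : HasDerivAt (fun τ : ℝ => z + τ • κ ((0, 0), z) - z) (κ ((0, 0), z)) 0 := by
      simpa using (((hasDerivAt_id' (0 : ℝ)).smul_const (κ ((0, 0), z))).const_add z).sub_const z
    refine HasDerivAt.deriv (h1.congr_of_eventuallyEq ?_)
    have h2 : ∀ᶠ τ : ℝ in 𝓝 0, z + τ • κ ((0, 0), z) ∈ U :=
      (Continuous.continuousAt (by fun_prop)).eventually_mem (hU.mem_nhds (by simpa using hz))
    filter_upwards [h2] with τ hτ
    simp only [hf, hm]
    rw [hψ0 z hz, hφ0 z hz]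
    rw [(Equiv.symm_apply_eq _).2 (hφ0 _ hτ).symm, (Equiv.symm_apply_eq _).2 (hψ0 _ hτ).symm]

end Commutators

end FinslerHol

namespace FinslerHol

/-! ### Velocity fields of families in a group -/

section VelocityFields

open scoped Topology

variable {W : Type} [NormedAddCommGroup W] [NormedSpace ℝ W]

/-- `ξ` is the leading coefficient of a smooth family `id + t ^ k g` in `G` of odd order `k`. -/
def IsStrongField (G : Subgroup (Equiv.Perm W)) (U : Set W) (ξ : W → W) : Prop :=
  ∃ (k : ℕ) (φ : ℝ → Equiv.Perm W) (g : ℝ × W → W), Odd k ∧ (∀ t, φ t ∈ G) ∧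
    IsFamilyOfOrder U k φ g ∧ ∀ z ∈ U, g (0, z) = ξ z

/-- `ξ` is the velocity at `t = 0` of a `C^1` family in `G`. -/
def IsVelocityField (G : Subgroup (Equiv.Perm W)) (U : Set W) (ξ : W → W) : Prop :=
  ∃ φ : ℝ → Equiv.Perm W, (∀ t, φ t ∈ G) ∧ (∀ t, ∀ z ∈ U, φ t z ∈ U) ∧
    ContDiffOn ℝ 1 (fun q : ℝ × W => φ q.1 q.2) (univ ×ˢ U) ∧ (∀ z ∈ U, φ 0 z = z) ∧
    ∀ z ∈ U, HasDerivAt (fun t => φ t z) (ξ z) 0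

variable {G : Subgroup (Equiv.Perm W)} {U : Set W}

theorem IsStrongField.contDiffOn {ξ : W → W} (h : IsStrongField G U ξ) : ContDiffOn ℝ ∞ ξ U := by
  obtain ⟨k, φ, g, -, -, hφ, h0⟩ := h
  refine (ContDiffOn.comp_param hφ.smooth_coeff (a := fun _ : W => (0 : ℝ)) (z := fun z => z)
    (by fun_prop) (by fun_prop) fun z hz => hz).congr fun z hz => (h0 z hz).symm

theorem IsStrongField.lieBracket [FiniteDimensional ℝ W] (hU : IsOpen U) {ξ η : W → W}
    (hξ : IsStrongField G U ξ) (hη : IsStrongField G U η) :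
    IsStrongField G U (VectorField.lieBracket ℝ ξ η) := by
  obtain ⟨k, φ, g, hk, hG, hφ, hg⟩ := hξ
  obtain ⟨l, ψ, h, hl, hG', hψ, hh⟩ := hη
  obtain ⟨K, hK, hKe, hK0⟩ := hφ.exists_commutator hU hk.pos.ne' hl.pos.ne' hψ
  have hφ1 : ∀ {s : Set (ℝ × W)} {z : ℝ × W → W}, ContDiffOn ℝ ∞ z s → (∀ q ∈ s, z q ∈ U) →
      ContDiffOn ℝ ∞ (fun q => φ q.1 (z q)) s := fun hz hm =>
    ContDiffOn.comp_param hφ.smooth (by fun_prop) hz hm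
  have hφ2 : ∀ {s : Set (ℝ × W)} {z : ℝ × W → W}, ContDiffOn ℝ ∞ z s → (∀ q ∈ s, z q ∈ U) →
      ContDiffOn ℝ ∞ (fun q => (φ q.1).symm (z q)) s := fun hz hm =>
    ContDiffOn.comp_param hφ.smooth_symm (by fun_prop) hz hm
  have hψ1 : ∀ {s : Set (ℝ × W)} {z : ℝ × W → W}, ContDiffOn ℝ ∞ z s → (∀ q ∈ s, z q ∈ U) →
      ContDiffOn ℝ ∞ (fun q => ψ (q.1 ^ 2) (z q)) s := fun hz hm =>
    ContDiffOn.comp_param hψ.smooth (by fun_prop) hz hm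
  have hψ2 : ∀ {s : Set (ℝ × W)} {z : ℝ × W → W}, ContDiffOn ℝ ∞ z s → (∀ q ∈ s, z q ∈ U) →
      ContDiffOn ℝ ∞ (fun q => (ψ (q.1 ^ 2)).symm (z q)) s := fun hz hm =>
    ContDiffOn.comp_param hψ.smooth_symm (by fun_prop) hz hm
  -- Parameters `(t, t)` would give the even order `k + l`, which admits no root substitution
  -- through `0`; running `ψ` at `t ^ 2` keeps the order odd.
  refine ⟨k + 2 * l, fun t => (ψ (t ^ 2))⁻¹ * (φ t)⁻¹ * ψ (t ^ 2) * φ t,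
    fun q => K ((q.1, q.1 ^ 2), q.2), hk.add_even (even_two_mul l),
    fun t => mul_mem (mul_mem (mul_mem (inv_mem (hG' _)) (inv_mem (hG _))) (hG' _)) (hG _),
    ⟨fun t z hz => ?_, fun t z hz => ?_, ?_, ?_, ?_, fun t z hz => ?_⟩, fun z hz => ?_⟩
  · exact hψ.maps_symm _ _ (hφ.maps_symm _ _ (hψ.maps _ _ (hφ.maps _ _ hz)))
  · exact hφ.maps_symm _ _ (hψ.maps_symm _ _ (hφ.maps _ _ (hψ.maps _ _ hz)))
  · exact hψ2 (hφ2 (hψ1 (hφ1 (by fun_prop) fun q hq => hq.2) fun q hq => hφ.maps _ _ hq.2)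
      fun q hq => hψ.maps _ _ (hφ.maps _ _ hq.2))
      fun q hq => hφ.maps_symm _ _ (hψ.maps _ _ (hφ.maps _ _ hq.2))
  · exact hφ2 (hψ2 (hφ1 (hψ1 (by fun_prop) fun q hq => hq.2) fun q hq => hψ.maps _ _ hq.2)
      fun q hq => hφ.maps _ _ (hψ.maps _ _ hq.2))
      fun q hq => hψ.maps_symm _ _ (hφ.maps _ _ (hψ.maps _ _ hq.2))
  · exact hK.comp (f := fun q : ℝ × W => ((q.1, q.1 ^ 2), q.2)) (by fun_prop)
      fun q hq => ⟨mem_univ _, hq.2⟩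
  · rw [hKe t (t ^ 2) z hz, ← pow_mul, pow_add]
  · have : ((0 : ℝ), (0 : ℝ) ^ 2) = (0, 0) := by simp
    simp only
    rw [this, hK0 z hz]
    exact Filter.EventuallyEq.lieBracket_vectorField_eq
      (Filter.eventuallyEq_of_mem (hU.mem_nhds hz) hg)
      (Filter.eventuallyEq_of_mem (hU.mem_nhds hz) hh)

/-- The derivative is stated as `r σ / (k * σ)` because only `σ * r' σ = r σ / k` enters later, and
this is continuous at `0` although `r'` need not be. -/
theorem exists_odd_root {k : ℕ} (hk : Odd k) :
    ∃ r : ℝ → ℝ, Continuous r ∧ r 0 = 0 ∧ (∀ σ, r σ ^ k = σ) ∧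
      ∀ σ, σ ≠ 0 → HasDerivAt r (r σ / (k * σ)) σ := by
  have hk0 : k ≠ 0 := hk.pos.ne'
  have hbot : Filter.Tendsto (fun a : ℝ => a ^ k) Filter.atBot Filter.atBot := by
    have h := Filter.tendsto_neg_atTop_atBot.comp
      ((Filter.tendsto_pow_atTop (α := ℝ) hk0).comp Filter.tendsto_neg_atBot_atTop)
    refine h.congr fun a => ?_
    simp [hk.neg_pow]
  have hsurj : Function.Surjective fun a : ℝ => a ^ k :=
    (continuous_pow k).surjective (Filter.tendsto_pow_atTop hk0) hbot
  let e := StrictMono.orderIsoOfSurjective (fun a : ℝ => a ^ k) hk.strictMono_pow hsurj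
  have he : ∀ σ, e.symm σ ^ k = σ := e.apply_symm_apply
  have h0 : e.symm 0 = 0 := by simpa [hk0] using he 0
  refine ⟨e.symm, e.symm.continuous, h0, he, fun σ hσ => ?_⟩
  have hr : e.symm σ ≠ 0 := fun h => hσ (by rw [← he σ, h, zero_pow hk0])
  have h1 := HasDerivAt.of_local_left_inverse (f := fun a : ℝ => a ^ k) (g := e.symm)
    e.symm.continuous.continuousAt (hasDerivAt_pow k (e.symm σ)) (by positivity)
    (Filter.Eventually.of_forall he)
  refine h1.congr_deriv ?_
  have h2 : σ = e.symm σ ^ (k - 1) * e.symm σ := by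
    rw [← pow_succ, Nat.sub_add_cancel hk.pos, he]
  have h3 : (k : ℝ) ≠ 0 := by exact_mod_cast hk0
  conv_rhs => rw [show (k : ℝ) * σ = k * (e.symm σ ^ (k - 1) * e.symm σ) by rw [← h2]]
  field_simp

/-- The derivative of `(σ, z) ↦ z + σ g (r σ, z)` for a `k`-th root `r`. -/
def rootDeriv (k : ℕ) (r : ℝ → ℝ) (g : ℝ × W → W) (q : ℝ × W) : ℝ × W →L[ℝ] W :=
  ContinuousLinearMap.snd ℝ ℝ W + (ContinuousLinearMap.fst ℝ ℝ W).smulRight (g (r q.1, q.2)) +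
    (fderiv ℝ g (r q.1, q.2)) ∘L
      (((r q.1 / k) • ContinuousLinearMap.fst ℝ ℝ W).prod
        (q.1 • ContinuousLinearMap.snd ℝ ℝ W))

/-- At `σ = 0` the product of `σ` with a merely continuous function is differentiable, since `σ`
vanishes there. Elsewhere the product and chain rules apply, and the factor `σ` cancels the
singularity of `r'`, so one continuous formula covers both cases. -/
theorem hasFDerivAt_add_smul_root (hU : IsOpen U) {k : ℕ} (hk : Odd k) {r : ℝ → ℝ}
    (hr : Continuous r) (hr0 : r 0 = 0)
    (hrd : ∀ σ, σ ≠ 0 → HasDerivAt r (r σ / (k * σ)) σ) {g : ℝ × W → W}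
    (hg : ContDiffOn ℝ ∞ g (univ ×ˢ U)) {q : ℝ × W} (hq : q.2 ∈ U) :
    HasFDerivAt (fun q : ℝ × W => q.2 + q.1 • g (r q.1, q.2)) (rootDeriv k r g q) q := by
  have hUo : IsOpen ((univ : Set ℝ) ×ˢ U) := isOpen_univ.prod hU
  have hgd : ∀ σ, ∀ z ∈ U, HasFDerivAt g (fderiv ℝ g (σ, z)) (σ, z) := fun σ z hz =>
    ((hg.contDiffAt (hUo.mem_nhds ⟨mem_univ _, hz⟩)).differentiableAt (by simp)).hasFDerivAt
  obtain ⟨σ, z⟩ := q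
  by_cases hσ : σ = 0
  · subst hσ
    have hcont : ContinuousAt (fun q : ℝ × W => g (r q.1, q.2)) ((0 : ℝ), z) := by
      have h1 : ContinuousAt g (r 0, z) := (hgd _ _ hq).continuousAt
      exact ContinuousAt.comp (g := g) (f := fun q : ℝ × W => (r q.1, q.2)) h1
        (Continuous.continuousAt (by fun_prop))
    have h2 : HasFDerivAt (fun q : ℝ × W => q.1 • g (r q.1, q.2))
        ((ContinuousLinearMap.fst ℝ ℝ W).smulRight (g (r 0, z))) ((0 : ℝ), z) := by
      rw [hasFDerivAt_iff_isLittleO]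
      have h3 : (fun q : ℝ × W => q.1) =O[𝓝 ((0 : ℝ), z)] fun q => q - ((0 : ℝ), z) :=
        Asymptotics.IsBigO.of_bound 1 (Filter.Eventually.of_forall fun q => by
          simpa using norm_fst_le (q - ((0 : ℝ), z)))
      have h4 : (fun q : ℝ × W => g (r q.1, q.2) - g (r 0, z)) =o[𝓝 ((0 : ℝ), z)]
          fun _ => (1 : ℝ) := by
        rw [Asymptotics.isLittleO_one_iff]
        simpa using (hcont.fun_sub (continuousAt_const (y := g (r 0, z)))).tendsto
      have h5 := (h3.norm_right).smul_isLittleO h4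
      simp only [smul_eq_mul, mul_one] at h5
      refine (Asymptotics.isLittleO_norm_right.1 h5).congr_left fun q => ?_
      simp [smul_sub]
    have h6 := hasFDerivAt_snd (𝕜 := ℝ) (p := ((0 : ℝ), z))
    refine (h6.add h2).congr_fderiv ?_
    ext v <;> simp [rootDeriv, hr0] <;> exact (fderiv ℝ g (0, z)).map_zero
  · have h1 : HasFDerivAt (fun q : ℝ × W => (r q.1, q.2))
        (((r σ / (k * σ)) • ContinuousLinearMap.fst ℝ ℝ W).prod
          (ContinuousLinearMap.snd ℝ ℝ W)) (σ, z) := by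
      refine HasFDerivAt.prodMk ?_ hasFDerivAt_snd
      have h2 := (hrd σ hσ).comp_hasFDerivAt (σ, z)
        (hasFDerivAt_fst (𝕜 := ℝ) (p := ((σ, z) : ℝ × W)))
      exact h2
    have h3 : HasFDerivAt (fun q : ℝ × W => g (r q.1, q.2)) _ (σ, z) :=
      (hgd (r σ) z hq).comp (σ, z) h1
    have h4 := hasFDerivAt_snd (𝕜 := ℝ) (p := (σ, z))
    have h5 := (hasFDerivAt_fst (𝕜 := ℝ) (p := ((σ, z) : ℝ × W))).smul h3
    refine (h4.add h5).congr_fderiv ?_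
    have hk' : (k : ℝ) ≠ 0 := by exact_mod_cast hk.pos.ne'
    ext v
    · have h6 : ((r σ / k, (0 : W)) : ℝ × W) = σ • (r σ / (k * σ), (0 : W)) := by
        rw [Prod.smul_mk, smul_zero, smul_eq_mul]
        congr 1
        field_simp
      simp [rootDeriv, h6, -Prod.smul_mk]
      abel
    · have h6 : (((0 : ℝ), σ • v) : ℝ × W) = σ • ((0 : ℝ), v) := by simp
      simp [rootDeriv, h6, -Prod.smul_mk]

theorem continuousOn_rootDeriv (hU : IsOpen U) {k : ℕ} {r : ℝ → ℝ} (hr : Continuous r)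
    {g : ℝ × W → W} (hg : ContDiffOn ℝ ∞ g (univ ×ˢ U)) :
    ContinuousOn (rootDeriv k r g) (univ ×ˢ U) := by
  have hUo : IsOpen ((univ : Set ℝ) ×ˢ U) := isOpen_univ.prod hU
  have h1 : ContinuousOn (fun q : ℝ × W => (r q.1, q.2)) (univ ×ˢ U) := by fun_prop
  have hm : MapsTo (fun q : ℝ × W => (r q.1, q.2)) (univ ×ˢ U) (univ ×ˢ U) :=
    fun q hq => ⟨mem_univ _, hq.2⟩
  have h2 : ContinuousOn (fun q : ℝ × W => g (r q.1, q.2)) (univ ×ˢ U) :=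
    hg.continuousOn.comp h1 hm
  have h3 : ContinuousOn (fun q : ℝ × W => fderiv ℝ g (r q.1, q.2)) (univ ×ˢ U) :=
    (hg.continuousOn_fderiv_of_isOpen hUo (by simp)).comp h1 hm
  unfold rootDeriv
  refine (continuousOn_const.add ?_).add (h3.clm_comp ?_)
  · exact ((ContinuousLinearMap.smulRightL ℝ (ℝ × W) W
      (ContinuousLinearMap.fst ℝ ℝ W)).continuous.comp_continuousOn h2)
  · have h4 : Continuous fun q : ℝ × W =>
        (ContinuousLinearMap.inl ℝ ℝ W) ∘L ((r q.1 / k) • ContinuousLinearMap.fst ℝ ℝ W) +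
        (ContinuousLinearMap.inr ℝ ℝ W) ∘L (q.1 • ContinuousLinearMap.snd ℝ ℝ W) := by
      fun_prop
    refine h4.continuousOn.congr fun q _ => ContinuousLinearMap.ext fun v => ?_
    simp

theorem IsStrongField.isVelocityField (hU : IsOpen U) {ξ : W → W} (h : IsStrongField G U ξ) :
    IsVelocityField G U ξ := by
  obtain ⟨k, φ, g, hk, hG, hφ, h0⟩ := h
  obtain ⟨r, hr, hr0, hrk, hrd⟩ := exists_odd_root hk
  have hUo : IsOpen ((univ : Set ℝ) ×ˢ U) := isOpen_univ.prod hU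
  have hd : ∀ q ∈ (univ : Set ℝ) ×ˢ U, HasFDerivAt (fun q : ℝ × W => φ (r q.1) q.2)
      (rootDeriv k r g q) q := fun q hq => by
    refine (hasFDerivAt_add_smul_root hU hk hr hr0 hrd hφ.smooth_coeff hq.2).congr_of_eventuallyEq
      (Filter.eventuallyEq_of_mem (hUo.mem_nhds hq) fun q' hq' => ?_)
    rw [hφ.eq_add _ _ hq'.2, hrk]
  refine ⟨fun t => φ (r t), fun t => hG _, fun t z hz => hφ.maps _ _ hz, ?_, fun z hz => ?_,
    fun z hz => ?_⟩
  · rw [show (1 : WithTop ℕ∞) = 0 + 1 from rfl, contDiffOn_succ_iff_fderiv_of_isOpen hUo]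
    refine ⟨fun q hq => (hd q hq).differentiableAt.differentiableWithinAt, by simp, ?_⟩
    rw [contDiffOn_zero]
    exact (continuousOn_rootDeriv hU hr hφ.smooth_coeff).congr fun q hq => (hd q hq).fderiv
  · simp only [hr0]
    rw [hφ.eq_add _ _ hz]
    simp [hk.pos.ne']
  · have h1 := (hd (0, z) ⟨mem_univ _, hz⟩).comp_hasDerivAt (0 : ℝ)
      ((hasDerivAt_id' (0 : ℝ)).prodMk (hasDerivAt_const (0 : ℝ) z))
    refine h1.congr_deriv ?_
    simp [rootDeriv, hr0, h0 z hz]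
    exact (fderiv ℝ g (0, z)).map_zero

/-- The time part of the differential is the velocity and the space part is the identity because `φ
0` is the identity on `U`. Hence the velocity of a product of two families is the sum of their
velocities. -/
theorem IsVelocityField.hasFDerivAt_zero (hU : IsOpen U) {φ : ℝ → Equiv.Perm W} {ξ : W → W}
    (hφ : ContDiffOn ℝ 1 (fun q : ℝ × W => φ q.1 q.2) (univ ×ˢ U)) (h0 : ∀ z ∈ U, φ 0 z = z)
    {z : W} (hd : HasDerivAt (fun t => φ t z) (ξ z) 0) (hz : z ∈ U) :
    HasFDerivAt (fun q : ℝ × W => φ q.1 q.2)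
      ((ContinuousLinearMap.fst ℝ ℝ W).smulRight (ξ z) + ContinuousLinearMap.snd ℝ ℝ W)
      ((0 : ℝ), z) := by
  have hUo : IsOpen ((univ : Set ℝ) ×ˢ U) := isOpen_univ.prod hU
  have h1 := ((hφ.contDiffAt (hUo.mem_nhds (⟨mem_univ (0 : ℝ), hz⟩ : ((0 : ℝ), z) ∈ univ ×ˢ U))
    ).differentiableAt (by simp)).hasFDerivAt
  refine h1.congr_fderiv ?_
  have h2 := h1.comp_hasDerivAt (0 : ℝ)
    ((hasDerivAt_id' (0 : ℝ)).prodMk (hasDerivAt_const (0 : ℝ) z))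
  have h3 := h1.comp z ((hasFDerivAt_const (0 : ℝ) z).prodMk (hasFDerivAt_id (𝕜 := ℝ) z))
  have h4 : HasFDerivAt ((fun q : ℝ × W => φ q.1 q.2) ∘ fun z : W => ((0 : ℝ), id z))
      (ContinuousLinearMap.id ℝ W) z :=
    (hasFDerivAt_id z).congr_of_eventuallyEq
      (Filter.eventuallyEq_of_mem (hU.mem_nhds hz) fun z' hz' => h0 z' hz')
  ext v
  · have := h2.unique hd
    simpa using this
  · have := congrArg (fun L : W →L[ℝ] W => L v) (h3.unique h4)
    simpa using this

theorem IsVelocityField.zero : IsVelocityField G U (fun _ => 0) :=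
  ⟨fun _ => 1, fun _ => one_mem _, fun _ _ hz => hz, by simpa using contDiffOn_snd,
    fun _ _ => rfl, fun z _ => by simpa using hasDerivAt_const (0 : ℝ) z⟩

theorem IsVelocityField.add (hU : IsOpen U) {ξ η : W → W} (hξ : IsVelocityField G U ξ)
    (hη : IsVelocityField G U η) : IsVelocityField G U (ξ + η) := by
  obtain ⟨φ, hG, hm, hφ, h0, hd⟩ := hξ
  obtain ⟨ψ, hG', hm', hψ, h0', hd'⟩ := hη
  refine ⟨fun t => φ t * ψ t, fun t => mul_mem (hG t) (hG' t), fun t z hz => hm t _ (hm' t z hz),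
    ?_, fun z hz => ?_, fun z hz => ?_⟩
  · exact ContDiffOn.comp_param hφ (by fun_prop) hψ fun q hq => hm' _ _ hq.2
  · rw [Equiv.Perm.mul_apply, h0' z hz, h0 z hz]
  · have h1 := IsVelocityField.hasFDerivAt_zero hU hφ h0 (hd z hz) hz
    rw [show ((0 : ℝ), z) = ((0 : ℝ), ψ 0 z) by rw [h0' z hz]] at h1
    refine (h1.comp_hasDerivAt (0 : ℝ) ((hasDerivAt_id' (0 : ℝ)).prodMk (hd' z hz))).congr_deriv ?_
    simp

theorem IsVelocityField.smul (a : ℝ) {ξ : W → W} (hξ : IsVelocityField G U ξ) :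
    IsVelocityField G U (a • ξ) := by
  obtain ⟨φ, hG, hm, hφ, h0, hd⟩ := hξ
  refine ⟨fun t => φ (a * t), fun t => hG _, fun t => hm _, ?_, fun z hz => ?_, fun z hz => ?_⟩
  · exact ContDiffOn.comp_param hφ (by fun_prop) (by fun_prop) fun q hq => hq.2
  · simpa using h0 z hz
  · have h1 : HasDerivAt (fun t => φ t z) (ξ z) (a * 0) := by simpa using hd z hz
    have h2 : HasDerivAt (fun t : ℝ => a * t) a 0 := by
      simpa using (hasDerivAt_id' (0 : ℝ)).const_mul a
    exact h1.scomp (0 : ℝ) h2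

/-- The linear span of the strong fields. -/
def strongSpan (G : Subgroup (Equiv.Perm W)) (U : Set W) : Submodule ℝ (W → W) :=
  Submodule.span ℝ {ξ | IsStrongField G U ξ}

theorem isVelocityField_of_mem_strongSpan (hU : IsOpen U) {ξ : W → W} (h : ξ ∈ strongSpan G U) :
    IsVelocityField G U ξ := by
  induction h using Submodule.span_induction with
  | mem ξ h => exact IsStrongField.isVelocityField hU h
  | zero => exact IsVelocityField.zero
  | add ξ η _ _ h₁ h₂ => exact h₁.add hU h₂
  | smul a ξ _ h => exact h.smul a

theorem contDiffOn_of_mem_strongSpan {ξ : W → W} (h : ξ ∈ strongSpan G U) :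
    ContDiffOn ℝ ∞ ξ U := by
  induction h using Submodule.span_induction with
  | mem ξ h => exact IsStrongField.contDiffOn h
  | zero => exact contDiffOn_const
  | add ξ η _ _ h₁ h₂ => exact h₁.add h₂
  | smul a ξ _ h => exact h.const_smul a

/-- Bilinearity reduces the claim to strong fields. Equality is asked only on `U`, since outside `U`
the fields need not be differentiable and the bracket need not be additive. -/
theorem exists_lieBracket_mem_strongSpan [FiniteDimensional ℝ W] (hU : IsOpen U) {ξ η : W → W}
    (hξ : ξ ∈ strongSpan G U) (hη : η ∈ strongSpan G U) :
    ∃ ζ ∈ strongSpan G U, EqOn ζ (VectorField.lieBracket ℝ ξ η) U := by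
  have hd : ∀ {ξ : W → W}, ξ ∈ strongSpan G U → ∀ z ∈ U, DifferentiableAt ℝ ξ z :=
    fun h z hz => ((contDiffOn_of_mem_strongSpan h).contDiffAt
      (hU.mem_nhds hz)).differentiableAt (by simp)
  induction hξ, hη using Submodule.span_induction₂ with
  | mem_mem ξ η h₁ h₂ =>
    exact ⟨_, Submodule.subset_span (IsStrongField.lieBracket hU h₁ h₂), fun _ _ => rfl⟩
  | zero_left η hη =>
    exact ⟨0, zero_mem _, fun z _ => by simp [VectorField.lieBracket_eq]⟩
  | zero_right ξ hξ =>
    exact ⟨0, zero_mem _, fun z _ => by simp [VectorField.lieBracket_eq]⟩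
  | add_left ξ ξ' η h₁ h₂ h₃ ih₁ ih₂ =>
    obtain ⟨ζ₁, hζ₁, e₁⟩ := ih₁
    obtain ⟨ζ₂, hζ₂, e₂⟩ := ih₂
    refine ⟨ζ₁ + ζ₂, add_mem hζ₁ hζ₂, fun z hz => ?_⟩
    rw [VectorField.lieBracket_add_left (hd h₁ z hz) (hd h₂ z hz), Pi.add_apply, e₁ hz, e₂ hz]
  | add_right ξ η η' h₁ h₂ h₃ ih₁ ih₂ =>
    obtain ⟨ζ₁, hζ₁, e₁⟩ := ih₁
    obtain ⟨ζ₂, hζ₂, e₂⟩ := ih₂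
    refine ⟨ζ₁ + ζ₂, add_mem hζ₁ hζ₂, fun z hz => ?_⟩
    rw [VectorField.lieBracket_add_right (hd h₂ z hz) (hd h₃ z hz), Pi.add_apply, e₁ hz, e₂ hz]
  | smul_left a ξ η h₁ h₂ ih =>
    obtain ⟨ζ, hζ, e⟩ := ih
    refine ⟨a • ζ, Submodule.smul_mem _ a hζ, fun z hz => ?_⟩
    rw [VectorField.lieBracket_const_smul_left (hd h₁ z hz), Pi.smul_apply, e hz]
  | smul_right a ξ η h₁ h₂ ih =>
    obtain ⟨ζ, hζ, e⟩ := ih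
    refine ⟨a • ζ, Submodule.smul_mem _ a hζ, fun z hz => ?_⟩
    rw [VectorField.lieBracket_const_smul_right (hd h₂ z hz), Pi.smul_apply, e hz]

end VelocityFields

end FinslerHol

namespace FinslerHol

/-! ### The spray and the connection of a Finsler function in coordinates -/

section LocalFinsler

open scoped Topology

variable {n : ℕ}

local notation "E" => EuclideanSpace ℝ (Fin n)

/-- `L` is a Finsler function in the coordinate domain `D`. -/
structure IsFinslerOn (D : Set (EuclideanSpace ℝ (Fin n)))
    (L : EuclideanSpace ℝ (Fin n) → EuclideanSpace ℝ (Fin n) → ℝ) : Prop where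
  isOpen : IsOpen D
  smooth : ContDiffOn ℝ ∞
    (fun q : EuclideanSpace ℝ (Fin n) × EuclideanSpace ℝ (Fin n) => L q.1 q.2) (D ×ˢ {0}ᶜ)
  homogeneous : ∀ x ∈ D, ∀ y, ∀ a : ℝ, 0 < a → L x (a • y) = a * L x y
  posDef : ∀ x ∈ D, ∀ y u, y ≠ 0 → u ≠ 0 →
    0 < (1 / 2) * deriv (fun s : ℝ => deriv (fun t : ℝ => L x (y + s • u + t • u) ^ 2) 0) 0

/-- The energy `L ^ 2 / 2`. -/
def energy (L : EuclideanSpace ℝ (Fin n) → EuclideanSpace ℝ (Fin n) → ℝ)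
    (q : EuclideanSpace ℝ (Fin n) × EuclideanSpace ℝ (Fin n)) : ℝ := (1 / 2) * L q.1 q.2 ^ 2

/-- The second derivative of the energy. -/
def hess (L : EuclideanSpace ℝ (Fin n) → EuclideanSpace ℝ (Fin n) → ℝ)
    (q : EuclideanSpace ℝ (Fin n) × EuclideanSpace ℝ (Fin n)) :
    EuclideanSpace ℝ (Fin n) × EuclideanSpace ℝ (Fin n) →L[ℝ]
      EuclideanSpace ℝ (Fin n) × EuclideanSpace ℝ (Fin n) →L[ℝ] ℝ :=
  fderiv ℝ (fderiv ℝ (energy L)) q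

/-- The vector with components `G^i`. -/
def sprayVec (L : EuclideanSpace ℝ (Fin n) → EuclideanSpace ℝ (Fin n) → ℝ)
    (q : EuclideanSpace ℝ (Fin n) × EuclideanSpace ℝ (Fin n)) : EuclideanSpace ℝ (Fin n) :=
  WithLp.toLp 2 fun i => sprayCoeff L i q.1 q.2

theorem euclidean_sum (y : E) : ∑ i, y i • ei i = y := by
  ext j
  simp [Finset.sum_apply, Pi.single_apply]

namespace IsFinslerOn

variable {D : Set (EuclideanSpace ℝ (Fin n))}
  {L : EuclideanSpace ℝ (Fin n) → EuclideanSpace ℝ (Fin n) → ℝ} (hL : IsFinslerOn D L)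

include hL

theorem isOpen_slit : IsOpen (D ×ˢ ({0}ᶜ : Set E)) := hL.isOpen.prod isOpen_compl_singleton

theorem contDiffOn_energy : ContDiffOn ℝ ∞ (energy L) (D ×ˢ {0}ᶜ) :=
  contDiffOn_const.mul (hL.smooth.pow 2)

theorem contDiffOn_fderiv_energy : ContDiffOn ℝ ∞ (fderiv ℝ (energy L)) (D ×ˢ {0}ᶜ) :=
  hL.contDiffOn_energy.fderiv_of_isOpen hL.isOpen_slit (by simp)

theorem contDiffOn_hess : ContDiffOn ℝ ∞ (hess L) (D ×ˢ {0}ᶜ) :=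
  hL.contDiffOn_fderiv_energy.fderiv_of_isOpen hL.isOpen_slit (by simp)

theorem hasFDerivAt_energy {q : E × E} (hq : q ∈ D ×ˢ ({0}ᶜ : Set E)) :
    HasFDerivAt (energy L) (fderiv ℝ (energy L) q) q :=
  ((hL.contDiffOn_energy.contDiffAt (hL.isOpen_slit.mem_nhds hq)).differentiableAt
    (by simp)).hasFDerivAt

theorem hasFDerivAt_fderiv_energy {q : E × E} (hq : q ∈ D ×ˢ ({0}ᶜ : Set E)) :
    HasFDerivAt (fderiv ℝ (energy L)) (hess L q) q :=
  ((hL.contDiffOn_fderiv_energy.contDiffAt (hL.isOpen_slit.mem_nhds hq)).differentiableAt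
    (by simp)).hasFDerivAt

theorem hasFDerivAt_fderiv_energy_apply {q : E × E} (hq : q ∈ D ×ˢ ({0}ᶜ : Set E)) (w : E × E) :
    HasFDerivAt (fun q => fderiv ℝ (energy L) q w)
      ((ContinuousLinearMap.apply ℝ ℝ w) ∘L hess L q) q :=
  (ContinuousLinearMap.apply ℝ ℝ w).hasFDerivAt.comp q (hL.hasFDerivAt_fderiv_energy hq)

theorem hess_symm {q : E × E} (hq : q ∈ D ×ˢ ({0}ᶜ : Set E)) (w w' : E × E) :
    hess L q w w' = hess L q w' w :=
  ((hL.contDiffOn_energy.contDiffAt (hL.isOpen_slit.mem_nhds hq)).isSymmSndFDerivAt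
    (by rw [minSmoothness_of_isRCLikeNormedField]; exact (mod_cast le_top : ((2 : ℕ∞) : WithTop ℕ∞) ≤ ∞))).eq w w'

theorem hasFDerivAt_hess_apply {q : E × E} (hq : q ∈ D ×ˢ ({0}ᶜ : Set E)) (w w' : E × E) :
    HasFDerivAt (fun q => hess L q w w') (((ContinuousLinearMap.apply ℝ ℝ w') ∘L
      (ContinuousLinearMap.apply ℝ (E × E →L[ℝ] ℝ) w)) ∘L fderiv ℝ (hess L) q) q := by
  have h : HasFDerivAt (hess L) (fderiv ℝ (hess L) q) q :=
    ((hL.contDiffOn_hess.contDiffAt (hL.isOpen_slit.mem_nhds hq)).differentiableAt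
      (by simp)).hasFDerivAt
  exact HasFDerivAt.comp (f := hess L) (f' := fderiv ℝ (hess L) q) q
    (((ContinuousLinearMap.apply ℝ ℝ w') ∘L
      (ContinuousLinearMap.apply ℝ (E × E →L[ℝ] ℝ) w)).hasFDerivAt) h

/-- Bridge from the iterated one-variable derivatives in the definition of the metric to the second
Fréchet derivative; the factor is absorbed because `L ^ 2` is twice the energy. -/
theorem half_deriv_deriv {x y : E} (hx : x ∈ D) (hy : y ≠ 0) (u v : E) :
    (1 / 2) * deriv (fun s : ℝ => deriv (fun t : ℝ => L x (y + s • u + t • v) ^ 2) 0) 0 =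
      hess L (x, y) (0, u) (0, v) := by
  have hcont : Continuous fun s : ℝ => (x, y + s • u) := by fun_prop
  have hev : ∀ᶠ s : ℝ in 𝓝 0, (x, y + s • u) ∈ D ×ˢ ({0}ᶜ : Set E) :=
    hcont.continuousAt.eventually_mem (hL.isOpen_slit.mem_nhds (by simpa using ⟨hx, hy⟩))
  have h1 : ∀ᶠ s : ℝ in 𝓝 0, deriv (fun t : ℝ => L x (y + s • u + t • v) ^ 2) 0 =
      2 * fderiv ℝ (energy L) (x, y + s • u) (0, v) := by
    filter_upwards [hev] with s hs
    have h2 : HasDerivAt (fun t : ℝ => (x, y + s • u + t • v)) ((0 : E), v) 0 := by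
      have := (hasDerivAt_const (0 : ℝ) x).prodMk
        (((hasDerivAt_id' (0 : ℝ)).smul_const v).const_add (y + s • u))
      simpa using this
    have h3 : HasFDerivAt (energy L) (fderiv ℝ (energy L) (x, y + s • u))
        (x, y + s • u + (0 : ℝ) • v) := by
      simpa using hL.hasFDerivAt_energy hs
    have h4 := (h3.comp_hasDerivAt (0 : ℝ) h2).const_mul 2
    refine HasDerivAt.deriv (h4.congr_of_eventuallyEq (Filter.Eventually.of_forall fun t => ?_))
    simp [energy]
  rw [Filter.EventuallyEq.deriv_eq h1]
  have h5 : HasDerivAt (fun s : ℝ => (x, y + s • u)) ((0 : E), u) 0 := by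
    have := (hasDerivAt_const (0 : ℝ) x).prodMk
      (((hasDerivAt_id' (0 : ℝ)).smul_const u).const_add y)
    simpa using this
  have h6 : HasFDerivAt (fun q => fderiv ℝ (energy L) q (0, v))
      ((ContinuousLinearMap.apply ℝ ℝ ((0 : E), v)) ∘L hess L (x, y)) (x, y + (0 : ℝ) • u) := by
    simpa using hL.hasFDerivAt_fderiv_energy_apply (q := (x, y)) ⟨hx, hy⟩ (0, v)
  have h7 := (h6.comp_hasDerivAt (0 : ℝ) h5).const_mul 2
  rw [show (fun s : ℝ => 2 * fderiv ℝ (energy L) (x, y + s • u) (0, v)) = fun s : ℝ =>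
    2 * ((fun q => fderiv ℝ (energy L) q (0, v)) ∘ fun s : ℝ => (x, y + s • u)) s from rfl,
    h7.deriv]
  simp

theorem metricMatrix_eq {x y : E} (hx : x ∈ D) (hy : y ≠ 0) (i j : Fin n) :
    metricMatrix L x y i j = hess L (x, y) (0, ei i) (0, ei j) :=
  hL.half_deriv_deriv hx hy _ _

theorem hess_pos {x y u : E} (hx : x ∈ D) (hy : y ≠ 0) (hu : u ≠ 0) :
    0 < hess L (x, y) (0, u) (0, u) := by
  rw [← hL.half_deriv_deriv hx hy]
  exact hL.posDef x hx y u hy hu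

theorem energy_smul {x : E} (hx : x ∈ D) (y : E) {a : ℝ} (ha : 0 < a) :
    energy L (x, a • y) = a ^ 2 * energy L (x, y) := by
  simp only [energy, hL.homogeneous x hx y a ha]
  ring

theorem fderiv_energy_self {x y : E} (hx : x ∈ D) (hy : y ≠ 0) :
    fderiv ℝ (energy L) (x, y) (0, y) = 2 * energy L (x, y) := by
  have h1 : HasDerivAt (fun a : ℝ => (x, a • y)) ((0 : E), y) 1 := by
    simpa using (hasDerivAt_const (1 : ℝ) x).prodMk ((hasDerivAt_id' (1 : ℝ)).smul_const y)
  have h2 : HasFDerivAt (energy L) (fderiv ℝ (energy L) (x, y)) (x, (1 : ℝ) • y) := by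
    simpa using hL.hasFDerivAt_energy (q := (x, y)) ⟨hx, hy⟩
  have h3 := h2.comp_hasDerivAt (1 : ℝ) h1
  have h4 : HasDerivAt (fun a : ℝ => a ^ 2 * energy L (x, y)) (2 * energy L (x, y)) 1 := by
    simpa using (hasDerivAt_pow 2 (1 : ℝ)).mul_const (energy L (x, y))
  refine h3.unique (h4.congr_of_eventuallyEq ?_)
  filter_upwards [lt_mem_nhds (zero_lt_one (α := ℝ))] with a ha
  exact hL.energy_smul hx y ha

theorem fderiv_energy_self_eventually {q : E × E} (hq : q ∈ D ×ˢ ({0}ᶜ : Set E)) :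
    (fun q : E × E => fderiv ℝ (energy L) q (0, q.2)) =ᶠ[𝓝 q] fun q => 2 * energy L q :=
  Filter.eventuallyEq_of_mem (hL.isOpen_slit.mem_nhds hq) fun q hq =>
    hL.fderiv_energy_self (x := q.1) (y := q.2) hq.1 hq.2

/-- Derivative of Euler's identity `dE(0, y) = 2 E` in the direction `w`. -/
theorem hess_apply_self {q : E × E} (hq : q ∈ D ×ˢ ({0}ᶜ : Set E)) (w : E × E) :
    hess L q w (0, q.2) = 2 * fderiv ℝ (energy L) q w - fderiv ℝ (energy L) q (0, w.2) := by
  have h1 : HasFDerivAt (fun q : E × E => ((0 : E), q.2))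
      ((0 : E × E →L[ℝ] E).prod (ContinuousLinearMap.snd ℝ E E)) q :=
    (hasFDerivAt_const (0 : E) q).prodMk hasFDerivAt_snd
  have h2 := (hL.hasFDerivAt_fderiv_energy hq).clm_apply h1
  have h3 := ((hL.hasFDerivAt_energy hq).const_mul 2).congr_of_eventuallyEq
    (hL.fderiv_energy_self_eventually hq)
  have h4 := congrArg (fun T : E × E →L[ℝ] ℝ => T w) (h2.unique h3)
  simp at h4
  linarith

/-- Homogeneity gives `2 E = g(y, y)`, so positivity comes from the metric; no sign of `L` is
assumed. -/
theorem energy_pos {x y : E} (hx : x ∈ D) (hy : y ≠ 0) : 0 < energy L (x, y) := by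
  have h1 := hL.hess_apply_self (q := (x, y)) ⟨hx, hy⟩ (0, y)
  have h2 := hL.fderiv_energy_self hx hy
  have h3 := hL.hess_pos hx hy hy
  simp only at h1
  linarith

theorem hess_eq_sum {x y : E} (hx : x ∈ D) (hy : y ≠ 0) (u v : E) :
    hess L (x, y) (0, u) (0, v) = ∑ i, ∑ j, metricMatrix L x y i j * u i * v j := by
  have hu : ((0 : E), u) = ∑ i, u i • ((0 : E), ei i) := by
    conv_lhs => rw [← euclidean_sum u]
    ext <;> simp [Prod.fst_sum, Prod.snd_sum]
  have hv : ((0 : E), v) = ∑ i, v i • ((0 : E), ei i) := by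
    conv_lhs => rw [← euclidean_sum v]
    ext <;> simp [Prod.fst_sum, Prod.snd_sum]
  rw [hu, hv]
  simp only [map_sum, map_smul, _root_.sum_apply, _root_.smul_apply,
    smul_eq_mul, hL.metricMatrix_eq hx hy, Finset.mul_sum]
  rw [Finset.sum_comm]
  exact Finset.sum_congr rfl fun i _ => Finset.sum_congr rfl fun j _ => by ring

/-- A null vector of the matrix would have zero length in the positive definite metric. -/
theorem isUnit_det_metricMatrix {x y : E} (hx : x ∈ D) (hy : y ≠ 0) :
    IsUnit (metricMatrix L x y).det := by
  rw [isUnit_iff_ne_zero]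
  intro h
  obtain ⟨v, hv, hv0⟩ := Matrix.exists_vecMul_eq_zero_iff.2 h
  have hv' : (WithLp.toLp 2 v : E) ≠ 0 := fun h => hv (by
    funext i
    simpa using congrArg (fun w : E => w i) h)
  have h1 := hL.hess_pos hx hy hv'
  rw [hL.hess_eq_sum hx hy, Finset.sum_comm] at h1
  refine h1.ne' (Finset.sum_eq_zero fun j _ => ?_)
  have h2 := congrFun hv0 j
  rw [Matrix.vecMul, dotProduct] at h2
  rw [← Finset.sum_mul]
  have h3 : ∑ i, metricMatrix L x y i j * (WithLp.toLp 2 v : E) i = 0 := by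
    exact (Finset.sum_congr rfl fun i _ => mul_comm _ _).trans h2
  simp only [h3, zero_mul]

theorem dMetric_eq {x y : E} (hx : x ∈ D) (hy : y ≠ 0) (k i j : Fin n) :
    dMetric L k i j x y =
      fderiv ℝ (hess L) (x, y) (ei k, 0) (0, ei i) (0, ei j) := by
  have h2 : HasFDerivAt (fun x' : E => (x', y)) (ContinuousLinearMap.inl ℝ E E) x :=
    (hasFDerivAt_id x).prodMk (hasFDerivAt_const y x)
  have h3 := (hL.hasFDerivAt_hess_apply (q := (x, y)) ⟨hx, hy⟩ (0, ei i) (0, ei j)).comp x h2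
  have h4 : (fun x' => metricMatrix L x' y i j) =ᶠ[𝓝 x]
      fun x' => hess L (x', y) (0, ei i) (0, ei j) :=
    Filter.eventuallyEq_of_mem (hL.isOpen.mem_nhds hx) fun x' hx' => hL.metricMatrix_eq hx' hy i j
  rw [dMetric, (h3.congr_of_eventuallyEq h4).hasLineDerivAt (ei k) |>.lineDeriv]
  simp

/-- Derivative in `x` of the identity `Hess E ((0, v), (0, y)) = dE(0, v)`; contracting with `y`
lowers the order of differentiation by one. -/
theorem fderiv_hess_self {x y : E} (hx : x ∈ D) (hy : y ≠ 0) (a v : E) :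
    fderiv ℝ (hess L) (x, y) (a, 0) (0, v) (0, y) = hess L (x, y) (a, 0) (0, v) := by
  have h2 : HasFDerivAt (fun x' : E => (x', y)) (ContinuousLinearMap.inl ℝ E E) x :=
    (hasFDerivAt_id x).prodMk (hasFDerivAt_const y x)
  have h3 := (hL.hasFDerivAt_hess_apply (q := (x, y)) ⟨hx, hy⟩ (0, v) (0, y)).comp x h2
  have h4 := (hL.hasFDerivAt_fderiv_energy_apply (q := (x, y)) ⟨hx, hy⟩ (0, v)).comp x h2
  have h5 : (fun x' => hess L (x', y) (0, v) (0, y)) =ᶠ[𝓝 x]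
      fun x' => fderiv ℝ (energy L) (x', y) (0, v) :=
    Filter.eventuallyEq_of_mem (hL.isOpen.mem_nhds hx) fun x' hx' => by
      rw [hL.hess_apply_self (q := (x', y)) ⟨hx', hy⟩]
      ring
  have h6 := congrArg (fun T : E →L[ℝ] ℝ => T a) (h3.unique (h4.congr_of_eventuallyEq h5))
  simpa using h6

theorem fderiv_hess_self_self {x y : E} (hx : x ∈ D) (hy : y ≠ 0) (a : E) :
    fderiv ℝ (hess L) (x, y) (a, 0) (0, y) (0, y) = 2 * fderiv ℝ (energy L) (x, y) (a, 0) := by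
  rw [hL.fderiv_hess_self hx hy, hL.hess_apply_self (q := (x, y)) ⟨hx, hy⟩]
  simp only [Prod.mk_zero_zero, map_zero, sub_zero]

/-- The Christoffel-type sum contracts third derivatives of the energy with `y` twice. Homogeneity
reduces it to the right-hand side of the Euler-Lagrange equation. -/
theorem sum_dMetric {x y : E} (hx : x ∈ D) (hy : y ≠ 0) (l : Fin n) :
    ∑ j, ∑ k, (2 * dMetric L k j l x y - dMetric L l j k x y) * y j * y k =
      2 * (hess L (x, y) (y, 0) (0, ei l) - fderiv ℝ (energy L) (x, y) (ei l, 0)) := by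
  have hy1 : ((0 : E), y) = ∑ i, y i • ((0 : E), ei i) := by
    conv_lhs => rw [← euclidean_sum y]
    ext <;> simp [Prod.fst_sum, Prod.snd_sum]
  have hy2 : (y, (0 : E)) = ∑ i, y i • (ei i, (0 : E)) := by
    conv_lhs => rw [← euclidean_sum y]
    ext <;> simp [Prod.fst_sum, Prod.snd_sum]
  have hsymm : ∀ a u v : E, fderiv ℝ (hess L) (x, y) (a, 0) (0, u) (0, v) =
      fderiv ℝ (hess L) (x, y) (a, 0) (0, v) (0, u) := by
    intro a u v
    have hq : (x, y) ∈ D ×ˢ ({0}ᶜ : Set E) := ⟨hx, hy⟩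
    have h3 := (hL.hasFDerivAt_hess_apply hq (0, u) (0, v)).unique
      ((hL.hasFDerivAt_hess_apply hq (0, v) (0, u)).congr_of_eventuallyEq
        (Filter.eventuallyEq_of_mem (hL.isOpen_slit.mem_nhds hq) fun q hq =>
          hL.hess_symm hq _ _))
    simpa using congrArg (fun T : E × E →L[ℝ] ℝ => T (a, 0)) h3
  have e1 : ∑ j, ∑ k, dMetric L k j l x y * y j * y k = hess L (x, y) (y, 0) (0, ei l) := by
    rw [← hL.fderiv_hess_self hx hy, hsymm]
    conv_rhs => rw [hy1]
    rw [show fderiv ℝ (hess L) (x, y) (y, 0) = fderiv ℝ (hess L) (x, y) (∑ i, y i • (ei i, (0 : E)))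
      from congrArg _ hy2]
    simp only [map_sum, map_smul, _root_.sum_apply, _root_.smul_apply,
      smul_eq_mul, hL.dMetric_eq hx hy, Finset.mul_sum]
    exact Finset.sum_congr rfl fun j _ => Finset.sum_congr rfl fun k _ => by ring
  have e2 : ∑ j, ∑ k, dMetric L l j k x y * y j * y k =
      2 * fderiv ℝ (energy L) (x, y) (ei l, 0) := by
    rw [← hL.fderiv_hess_self_self hx hy]
    conv_rhs => rw [hy1]
    simp only [map_sum, map_smul, _root_.sum_apply, _root_.smul_apply,
      smul_eq_mul, hL.dMetric_eq hx hy, Finset.mul_sum]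
    rw [Finset.sum_comm]
    exact Finset.sum_congr rfl fun j _ => Finset.sum_congr rfl fun k _ => by ring
  rw [mul_sub, ← e2, ← e1]
  simp only [sub_mul, mul_assoc, Finset.sum_sub_distrib, Finset.mul_sum]

theorem sprayCoeff_eq {x y : E} (hx : x ∈ D) (hy : y ≠ 0) (i : Fin n) :
    sprayCoeff L i x y = (1 / 2) * ∑ l, (metricMatrix L x y)⁻¹ i l *
      (hess L (x, y) (y, 0) (0, ei l) - fderiv ℝ (energy L) (x, y) (ei l, 0)) := by
  rw [sprayCoeff, Finset.mul_sum, Finset.mul_sum]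
  refine Finset.sum_congr rfl fun l _ => ?_
  have h := hL.sum_dMetric hx hy l
  have h' : ∑ j, ∑ k, (metricMatrix L x y)⁻¹ i l *
      (2 * dMetric L k j l x y - dMetric L l j k x y) * y j * y k = (metricMatrix L x y)⁻¹ i l *
      ∑ j, ∑ k, (2 * dMetric L k j l x y - dMetric L l j k x y) * y j * y k := by
    simp only [Finset.mul_sum, mul_assoc]
  rw [h', h]
  ring

/-- The Euler-Lagrange equation characterizing the spray. -/
theorem hess_sprayVec {q : E × E} (hq : q ∈ D ×ˢ ({0}ᶜ : Set E)) (v : E) :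
    2 * hess L q (0, sprayVec L q) (0, v) =
      hess L q (q.2, 0) (0, v) - fderiv ℝ (energy L) q (v, 0) := by
  obtain ⟨x, y⟩ := q
  obtain ⟨hx, hy⟩ := hq
  have hinv : metricMatrix L x y * (metricMatrix L x y)⁻¹ = 1 :=
    Matrix.mul_nonsing_inv _ (hL.isUnit_det_metricMatrix hx hy)
  have hbasis : ∀ j, 2 * hess L (x, y) (0, sprayVec L (x, y)) (0, ei j) =
      hess L (x, y) (y, 0) (0, ei j) - fderiv ℝ (energy L) (x, y) (ei j, 0) := by
    intro j
    set b : Fin n → ℝ := fun l => hess L (x, y) (y, 0) (0, ei l) -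
      fderiv ℝ (energy L) (x, y) (ei l, 0) with hb
    rw [hL.hess_symm ⟨hx, hy⟩, hL.hess_eq_sum hx hy]
    have h1 : ∀ i k, metricMatrix L x y i k * (ei j : E) i * sprayVec L (x, y) k =
        (ei j : E) i * (metricMatrix L x y i k * sprayVec L (x, y) k) := fun i k => by ring
    simp only [h1, ← Finset.mul_sum]
    have h2 : ∀ f : Fin n → ℝ, ∑ i, (ei j : E) i * f i = f j := by
      intro f
      simp
    rw [h2]
    have h3 : ∀ k, sprayVec L (x, y) k = (1 / 2) * ((metricMatrix L x y)⁻¹.mulVec b) k := fun k =>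
      hL.sprayCoeff_eq hx hy k
    simp only [h3]
    have h4 : ∑ k, metricMatrix L x y j k * (1 / 2 * ((metricMatrix L x y)⁻¹.mulVec b) k) =
        (1 / 2) * ((metricMatrix L x y).mulVec ((metricMatrix L x y)⁻¹.mulVec b)) j := by
      rw [Matrix.mulVec, dotProduct, Finset.mul_sum]
      exact Finset.sum_congr rfl fun k _ => by ring
    rw [h4, Matrix.mulVec_mulVec, hinv, Matrix.one_mulVec]
    ring
  have hv1 : ((0 : E), v) = ∑ i, v i • ((0 : E), ei i) := by
    conv_lhs => rw [← euclidean_sum v]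
    ext <;> simp [Prod.fst_sum, Prod.snd_sum]
  have hv2 : (v, (0 : E)) = ∑ i, v i • (ei i, (0 : E)) := by
    conv_lhs => rw [← euclidean_sum v]
    ext <;> simp [Prod.fst_sum, Prod.snd_sum]
  rw [hv1, hv2]
  simp only [map_sum, map_smul, smul_eq_mul, Finset.mul_sum]
  rw [← Finset.sum_sub_distrib]
  refine Finset.sum_congr rfl fun j _ => ?_
  linear_combination (v j) * hbasis j

/-- The difference of two solutions is orthogonal to itself for the metric. This coordinate-free
description is what transforms well under changes of coordinates. -/
theorem sprayVec_unique {q : E × E} (hq : q ∈ D ×ˢ ({0}ᶜ : Set E)) {G : E}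
    (hG : ∀ v, 2 * hess L q (0, G) (0, v) =
      hess L q (q.2, 0) (0, v) - fderiv ℝ (energy L) q (v, 0)) : sprayVec L q = G := by
  by_contra hne
  have h1 := hL.hess_pos (x := q.1) (y := q.2) (u := sprayVec L q - G) hq.1 hq.2
    (sub_ne_zero.2 hne)
  have h2 := hL.hess_sprayVec hq (sprayVec L q - G)
  have h3 := hG (sprayVec L q - G)
  have h4 : ((0 : E), sprayVec L q - G) = (0, sprayVec L q) - (0, G) := by simp
  rw [show hess L (q.1, q.2) (0, sprayVec L q - G) = hess L q (0, sprayVec L q) - hess L q (0, G) by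
    rw [h4, map_sub], _root_.sub_apply] at h1
  linarith

end IsFinslerOn

end LocalFinsler

end FinslerHol

namespace FinslerHol

/-! ### Smoothness, conservation and naturality of the connection -/

section LocalConnection

open scoped Topology

variable {n : ℕ}

local notation "E" => EuclideanSpace ℝ (Fin n)

theorem contDiffOn_det {X ι : Type} [NormedAddCommGroup X] [NormedSpace ℝ X] [Fintype ι]
    [DecidableEq ι] {A : X → Matrix ι ι ℝ} {s : Set X}
    (hA : ∀ i j, ContDiffOn ℝ ∞ (fun x => A x i j) s) :
    ContDiffOn ℝ ∞ (fun x => (A x).det) s := by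
  simp only [Matrix.det_apply]
  exact ContDiffOn.sum fun σ _ => (contDiffOn_prod fun i _ => hA (σ i) i).const_smul _

/-- Cramer's rule: the entries are quotients of determinants. -/
theorem contDiffOn_matrix_inv {X ι : Type} [NormedAddCommGroup X] [NormedSpace ℝ X] [Fintype ι]
    [DecidableEq ι] {A : X → Matrix ι ι ℝ} {s : Set X}
    (hA : ∀ i j, ContDiffOn ℝ ∞ (fun x => A x i j) s) (hu : ∀ x ∈ s, IsUnit (A x).det) (i j : ι) :
    ContDiffOn ℝ ∞ (fun x => (A x)⁻¹ i j) s := by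
  have h : ∀ x, (A x)⁻¹ i j = (A x).det⁻¹ * ((A x).updateRow j (Pi.single i 1)).det := fun x => by
    rw [Matrix.inv_def, Matrix.smul_apply, Ring.inverse_eq_inv', Matrix.adjugate_apply, smul_eq_mul]
  simp only [h]
  refine ((contDiffOn_det hA).inv fun x hx => (hu x hx).ne_zero).mul (contDiffOn_det fun a b => ?_)
  by_cases ha : a = j
  · subst ha
    simpa using contDiffOn_const
  · simpa [Matrix.updateRow_ne ha] using hA a b

namespace IsFinslerOn

variable {D : Set (EuclideanSpace ℝ (Fin n))}
  {L : EuclideanSpace ℝ (Fin n) → EuclideanSpace ℝ (Fin n) → ℝ} (hL : IsFinslerOn D L)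

include hL

theorem contDiffOn_sprayVec : ContDiffOn ℝ ∞ (sprayVec L) (D ×ˢ {0}ᶜ) := by
  have hM : ∀ i j, ContDiffOn ℝ ∞ (fun q : E × E => metricMatrix L q.1 q.2 i j) (D ×ˢ {0}ᶜ) :=
    fun i j => ((hL.contDiffOn_hess.clm_apply contDiffOn_const).clm_apply
      (contDiffOn_const (c := ((0 : E), ei j)))).congr fun q hq =>
        hL.metricMatrix_eq hq.1 hq.2 i j
  rw [contDiffOn_euclidean]
  intro i
  have h1 : ContDiffOn ℝ ∞ (fun q : E × E => (1 / 2) * ∑ l, (metricMatrix L q.1 q.2)⁻¹ i l *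
      (hess L q (q.2, 0) (0, ei l) - fderiv ℝ (energy L) q (ei l, 0))) (D ×ˢ {0}ᶜ) := by
    refine contDiffOn_const.mul (ContDiffOn.sum fun l _ => ContDiffOn.mul ?_ (ContDiffOn.sub ?_ ?_))
    · exact contDiffOn_matrix_inv hM (fun q hq => hL.isUnit_det_metricMatrix hq.1 hq.2) i l
    · exact (hL.contDiffOn_hess.clm_apply (by fun_prop)).clm_apply contDiffOn_const
    · exact hL.contDiffOn_fderiv_energy.clm_apply contDiffOn_const
  exact h1.congr fun q hq => hL.sprayCoeff_eq hq.1 hq.2 i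

theorem hasFDerivAt_sprayVec {q : E × E} (hq : q ∈ D ×ˢ ({0}ᶜ : Set E)) :
    HasFDerivAt (sprayVec L) (fderiv ℝ (sprayVec L) q) q :=
  ((hL.contDiffOn_sprayVec.contDiffAt (hL.isOpen_slit.mem_nhds hq)).differentiableAt
    (by simp)).hasFDerivAt

theorem connVec_eq {x y : E} (hx : x ∈ D) (hy : y ≠ 0) (a : E) :
    connVec L x y a = fderiv ℝ (sprayVec L) (x, y) (0, a) := by
  have h2 : HasFDerivAt (fun y' : E => (x, y')) (ContinuousLinearMap.inr ℝ E E) y :=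
    (hasFDerivAt_const x y).prodMk (hasFDerivAt_id y)
  have h3 := (hL.hasFDerivAt_sprayVec (q := (x, y)) ⟨hx, hy⟩).comp y h2
  ext i
  have h4 : HasFDerivAt (fun y' => sprayCoeff L i x y') _ y :=
    (EuclideanSpace.proj i : E →L[ℝ] ℝ).hasFDerivAt.comp y h3
  simp only [connVec, connCoeff, (h4.hasLineDerivAt _).lineDeriv]
  conv_rhs => rw [← euclidean_sum a]
  have h5 : ((0 : E), ∑ j, a j • ei j) = ∑ j, a j • ((0 : E), (ei j : E)) := by
    ext <;> simp [Prod.fst_sum, Prod.snd_sum]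
  rw [h5, map_sum]
  simp only [map_smul]
  simp [mul_comm]

theorem contDiffOn_connVec : ContDiffOn ℝ ∞
    (fun p : (E × E) × E => connVec L p.1.1 p.1.2 p.2) ((D ×ˢ {0}ᶜ) ×ˢ univ) := by
  have h1 : ContDiffOn ℝ ∞ (fderiv ℝ (sprayVec L)) (D ×ˢ {0}ᶜ) :=
    hL.contDiffOn_sprayVec.fderiv_of_isOpen hL.isOpen_slit (by simp)
  have h2 : ContDiffOn ℝ ∞ (fun p : (E × E) × E => fderiv ℝ (sprayVec L) p.1)
      ((D ×ˢ {0}ᶜ) ×ˢ univ) := h1.comp contDiffOn_fst fun p hp => hp.1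
  exact (h2.clm_apply (g := fun p : (E × E) × E => ((0 : E), p.2)) (by fun_prop)).congr
    fun p hp => hL.connVec_eq hp.1.1 hp.1.2 p.2

/-- The energy is constant along horizontal directions. -/
theorem fderiv_energy_horizontal {x y : E} (hx : x ∈ D) (hy : y ≠ 0) (a : E) :
    fderiv ℝ (energy L) (x, y) (a, -connVec L x y a) = 0 := by
  have hq : (x, y) ∈ D ×ˢ ({0}ᶜ : Set E) := ⟨hx, hy⟩
  -- Euler-Lagrange tested with `v = y` says that the energy is constant along the spray.
  -- Differentiating this in the fibre direction `a` and subtracting Euler-Lagrange tested with `v =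
  -- a` leaves `dE(a, 0) = dE(0, N a)`, where `N a` is the fibre derivative of the spray.
  have e1 : (fun q : E × E => 2 * fderiv ℝ (energy L) q (0, sprayVec L q)) =ᶠ[𝓝 (x, y)]
      fun q => fderiv ℝ (energy L) q (q.2, 0) := by
    refine Filter.eventuallyEq_of_mem (hL.isOpen_slit.mem_nhds hq) fun q hq => ?_
    have h1 := hL.hess_sprayVec hq q.2
    rw [hL.hess_apply_self hq, hL.hess_apply_self hq] at h1
    simp only [Prod.mk_zero_zero, map_zero, sub_zero] at h1
    linarith
  have h1 : HasFDerivAt (fun q : E × E => ((0 : E), sprayVec L q))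
      ((0 : E × E →L[ℝ] E).prod (fderiv ℝ (sprayVec L) (x, y))) (x, y) :=
    (hasFDerivAt_const (0 : E) (x, y)).prodMk (hL.hasFDerivAt_sprayVec hq)
  have h2 : HasFDerivAt (fun q : E × E => (q.2, (0 : E)))
      ((ContinuousLinearMap.snd ℝ E E).prod (0 : E × E →L[ℝ] E)) (x, y) :=
    hasFDerivAt_snd.prodMk (hasFDerivAt_const (0 : E) (x, y))
  have h3 := ((hL.hasFDerivAt_fderiv_energy hq).clm_apply h1).const_mul 2
  have h4 := (hL.hasFDerivAt_fderiv_energy hq).clm_apply h2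
  have h5 := congrArg (fun T : E × E →L[ℝ] ℝ => T (0, a))
    (h3.unique (h4.congr_of_eventuallyEq e1))
  simp only [_root_.smul_apply, _root_.add_apply, ContinuousLinearMap.comp_apply,
    ContinuousLinearMap.flip_apply, ContinuousLinearMap.prod_apply, _root_.zero_apply,
    ContinuousLinearMap.coe_snd', smul_eq_mul] at h5
  have h6 := hL.hess_sprayVec hq a
  rw [hL.hess_symm hq (0, sprayVec L (x, y)), hL.hess_symm hq ((x, y).2, 0)] at h6
  rw [hL.connVec_eq hx hy]
  have h7 : (a, -fderiv ℝ (sprayVec L) (x, y) (0, a)) =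
      (a, (0 : E)) - ((0 : E), fderiv ℝ (sprayVec L) (x, y) (0, a)) := by simp
  rw [h7, map_sub]
  simp only at h6 h5 ⊢
  linarith

theorem connVec_add {x y : E} (hx : x ∈ D) (hy : y ≠ 0) (a b : E) :
    connVec L x y (a + b) = connVec L x y a + connVec L x y b := by
  rw [hL.connVec_eq hx hy, hL.connVec_eq hx hy, hL.connVec_eq hx hy, ← map_add]
  simp

theorem fderiv_horizontal {x y : E} (hx : x ∈ D) (hy : y ≠ 0) (a : E) :
    fderiv ℝ (fun q : E × E => L q.1 q.2) (x, y) (a, -connVec L x y a) = 0 := by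
  have hq : (x, y) ∈ D ×ˢ ({0}ᶜ : Set E) := ⟨hx, hy⟩
  have h1 : HasFDerivAt (fun q : E × E => L q.1 q.2)
      (fderiv ℝ (fun q : E × E => L q.1 q.2) (x, y)) (x, y) :=
    ((hL.smooth.contDiffAt (hL.isOpen_slit.mem_nhds hq)).differentiableAt (by simp)).hasFDerivAt
  have h2 : HasFDerivAt (energy L) _ (x, y) := (h1.pow 2).const_mul (1 / 2)
  -- The energy has differential `L dL`, and `L` does not vanish because the energy is positive.
  have h3 := hL.fderiv_energy_horizontal hx hy a
  rw [h2.fderiv] at h3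
  have h4 : L x y ≠ 0 := fun h => (hL.energy_pos hx hy).ne' (by simp [energy, h])
  simpa [h4] using h3

end IsFinslerOn

/-- The map of tangent bundles induced by `ψ`. -/
def tangentLift (ψ : EuclideanSpace ℝ (Fin n) → EuclideanSpace ℝ (Fin n))
    (q : EuclideanSpace ℝ (Fin n) × EuclideanSpace ℝ (Fin n)) :
    EuclideanSpace ℝ (Fin n) × EuclideanSpace ℝ (Fin n) := (ψ q.1, fderiv ℝ ψ q.1 q.2)

/-- The derivative of `tangentLift`. -/
def tangentLiftDeriv (ψ : EuclideanSpace ℝ (Fin n) → EuclideanSpace ℝ (Fin n))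
    (q : EuclideanSpace ℝ (Fin n) × EuclideanSpace ℝ (Fin n)) :
    EuclideanSpace ℝ (Fin n) × EuclideanSpace ℝ (Fin n) →L[ℝ]
      EuclideanSpace ℝ (Fin n) × EuclideanSpace ℝ (Fin n) :=
  ((fderiv ℝ ψ q.1) ∘L ContinuousLinearMap.fst ℝ _ _).prod
    (((fderiv ℝ (fderiv ℝ ψ) q.1).flip q.2) ∘L ContinuousLinearMap.fst ℝ _ _ +
      (fderiv ℝ ψ q.1) ∘L ContinuousLinearMap.snd ℝ _ _)

theorem tangentLiftDeriv_apply (ψ : E → E) (q w : E × E) : tangentLiftDeriv ψ q w =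
    (fderiv ℝ ψ q.1 w.1, fderiv ℝ (fderiv ℝ ψ) q.1 w.1 q.2 + fderiv ℝ ψ q.1 w.2) := rfl

section Naturality

variable {D : Set (EuclideanSpace ℝ (Fin n))} {ψ : EuclideanSpace ℝ (Fin n) → EuclideanSpace ℝ (Fin n)}

theorem hasFDerivAt_fderiv_of_contDiffOn (hD : IsOpen D) (hψ : ContDiffOn ℝ ∞ ψ D) {x : E}
    (hx : x ∈ D) : HasFDerivAt (fderiv ℝ ψ) (fderiv ℝ (fderiv ℝ ψ) x) x :=
  (((hψ.fderiv_of_isOpen hD (m := ∞) (by simp)).contDiffAt (hD.mem_nhds hx)).differentiableAt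
    (by simp)).hasFDerivAt

theorem hasFDerivAt_tangentLift (hD : IsOpen D) (hψ : ContDiffOn ℝ ∞ ψ D) {q : E × E}
    (hq : q.1 ∈ D) : HasFDerivAt (tangentLift ψ) (tangentLiftDeriv ψ q) q := by
  have h1 : HasFDerivAt ψ (fderiv ℝ ψ q.1) q.1 :=
    ((hψ.contDiffAt (hD.mem_nhds hq)).differentiableAt (by simp)).hasFDerivAt
  have h2 := (hasFDerivAt_fderiv_of_contDiffOn hD hψ hq).comp q hasFDerivAt_fst
  have h3 := (h1.comp q hasFDerivAt_fst).prodMk (h2.clm_apply hasFDerivAt_snd)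
  refine h3.congr_fderiv ?_
  ext w <;> simp [tangentLiftDeriv]

theorem contDiffOn_tangentLift (hD : IsOpen D) (hψ : ContDiffOn ℝ ∞ ψ D) :
    ContDiffOn ℝ ∞ (tangentLift ψ) (D ×ˢ univ) := by
  have h1 : ContDiffOn ℝ ∞ (fun q : E × E => ψ q.1) (D ×ˢ univ) :=
    hψ.comp contDiffOn_fst fun q hq => hq.1
  have h2 : ContDiffOn ℝ ∞ (fun q : E × E => fderiv ℝ ψ q.1) (D ×ˢ univ) :=
    (hψ.fderiv_of_isOpen hD (by simp)).comp contDiffOn_fst fun q hq => hq.1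
  exact h1.prodMk (h2.clm_apply contDiffOn_snd)

variable {L : EuclideanSpace ℝ (Fin n) → EuclideanSpace ℝ (Fin n) → ℝ}

/-- The Finsler function `L` in the coordinates given by `ψ`. -/
def pullbackFinsler (ψ : EuclideanSpace ℝ (Fin n) → EuclideanSpace ℝ (Fin n))
    (L : EuclideanSpace ℝ (Fin n) → EuclideanSpace ℝ (Fin n) → ℝ)
    (x y : EuclideanSpace ℝ (Fin n)) : ℝ := L (ψ x) (fderiv ℝ ψ x y)

variable (hL : IsFinslerOn univ L) (hD : IsOpen D) (hψ : ContDiffOn ℝ ∞ ψ D)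
  (hinj : ∀ x ∈ D, Function.Injective (fderiv ℝ ψ x))
  (hsurj : ∀ x ∈ D, Function.Surjective (fderiv ℝ ψ x))

include hL hD hψ hinj

omit hL hD hψ in
theorem mapsTo_tangentLift {q : E × E} (hq : q ∈ D ×ˢ ({0}ᶜ : Set E)) :
    tangentLift ψ q ∈ (univ : Set E) ×ˢ ({0}ᶜ : Set E) :=
  ⟨mem_univ _, fun h => hq.2 (hinj q.1 hq.1 (by simpa [tangentLift] using h))⟩

theorem isFinslerOn_pullback : IsFinslerOn D (pullbackFinsler ψ L) where
  isOpen := hD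
  smooth := hL.smooth.comp ((contDiffOn_tangentLift hD hψ).mono (prod_mono_right (subset_univ _)))
    fun q hq => mapsTo_tangentLift hinj hq
  homogeneous x _ y a ha := by
    simp only [pullbackFinsler, map_smul]
    exact hL.homogeneous _ (mem_univ _) _ a ha
  posDef x hx y u hy hu := by
    simp only [pullbackFinsler, map_add, map_smul]
    refine hL.posDef _ (mem_univ _) _ _ ?_ ?_
    · exact fun h => hy (hinj x hx (by simpa using h))
    · exact fun h => hu (hinj x hx (by simpa using h))

theorem fderiv_energy_pullback {q : E × E} (hq : q ∈ D ×ˢ ({0}ᶜ : Set E)) (w : E × E) :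
    fderiv ℝ (energy (pullbackFinsler ψ L)) q w =
      fderiv ℝ (energy L) (tangentLift ψ q) (tangentLiftDeriv ψ q w) := by
  have h : HasFDerivAt (energy (pullbackFinsler ψ L)) _ q :=
    (hL.hasFDerivAt_energy (mapsTo_tangentLift hinj hq)).comp q
      (hasFDerivAt_tangentLift hD hψ hq.1)
  rw [h.fderiv]
  rfl

theorem hess_pullback {q : E × E} (hq : q ∈ D ×ˢ ({0}ᶜ : Set E)) (w : E × E) (v : E) :
    hess (pullbackFinsler ψ L) q w (0, v) =
      hess L (tangentLift ψ q) (tangentLiftDeriv ψ q w) (0, fderiv ℝ ψ q.1 v) +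
      fderiv ℝ (energy L) (tangentLift ψ q) (0, fderiv ℝ (fderiv ℝ ψ) q.1 w.1 v) := by
  have hL' := isFinslerOn_pullback hL hD hψ hinj
  have h1 := hL'.hasFDerivAt_fderiv_energy_apply hq (0, v)
  have e1 : (fun q : E × E => fderiv ℝ (energy (pullbackFinsler ψ L)) q (0, v)) =ᶠ[𝓝 q]
      fun q => fderiv ℝ (energy L) (tangentLift ψ q) (0, fderiv ℝ ψ q.1 v) := by
    refine Filter.eventuallyEq_of_mem (hL'.isOpen_slit.mem_nhds hq) fun q hq => ?_
    rw [fderiv_energy_pullback hL hD hψ hinj hq, tangentLiftDeriv_apply]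
    simp
  have h2 : HasFDerivAt (fun q : E × E => fderiv ℝ ψ q.1 v) _ q :=
    (((hasFDerivAt_fderiv_of_contDiffOn hD hψ hq.1).comp q hasFDerivAt_fst).clm_apply
      (hasFDerivAt_const v q))
  have h3 : HasFDerivAt (fun q : E × E => fderiv ℝ (energy L) (tangentLift ψ q)) _ q :=
    (hL.hasFDerivAt_fderiv_energy (mapsTo_tangentLift hinj hq)).comp q
      (hasFDerivAt_tangentLift hD hψ hq.1)
  have h4 := h3.clm_apply ((hasFDerivAt_const (0 : E) q).prodMk h2)
  have h5 := congrArg (fun T : E × E →L[ℝ] ℝ => T w) (h1.unique (h4.congr_of_eventuallyEq e1))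
  simp at h5
  rw [h5]
  ring

include hsurj

/-- The right-hand side satisfies the Euler-Lagrange equation of `L`: in the equation of the pulled
back function the second derivatives of `ψ` enter through the Hessian and the differential of the
energy, and collect into the quadratic correction. Surjectivity of the differential makes every test
vector available. -/
theorem sprayVec_tangentLift {q : E × E} (hq : q ∈ D ×ˢ ({0}ᶜ : Set E)) :
    sprayVec L (tangentLift ψ q) = fderiv ℝ ψ q.1 (sprayVec (pullbackFinsler ψ L) q) -
      (1 / 2 : ℝ) • fderiv ℝ (fderiv ℝ ψ) q.1 q.2 q.2 := by
  have hL' := isFinslerOn_pullback hL hD hψ hinj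
  refine hL.sprayVec_unique (mapsTo_tangentLift hinj hq) fun v => ?_
  obtain ⟨v, rfl⟩ := hsurj q.1 hq.1 v
  have h1 := hL'.hess_sprayVec hq v
  rw [hess_pullback hL hD hψ hinj hq, hess_pullback hL hD hψ hinj hq,
    fderiv_energy_pullback hL hD hψ hinj hq] at h1
  have hsymm : fderiv ℝ (fderiv ℝ ψ) q.1 v q.2 = fderiv ℝ (fderiv ℝ ψ) q.1 q.2 v :=
    ((hψ.contDiffAt (hD.mem_nhds hq.1)).isSymmSndFDerivAt
      (by rw [minSmoothness_of_isRCLikeNormedField];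
          exact (mod_cast le_top : ((2 : ℕ∞) : WithTop ℕ∞) ≤ ∞))).eq _ _
  simp only [tangentLiftDeriv_apply, map_zero, _root_.zero_apply, zero_add, add_zero,
    Prod.mk_zero_zero, hsymm] at h1
  set Q := tangentLift ψ q with hQ
  have hQ2 : Q.2 = fderiv ℝ ψ q.1 q.2 := rfl
  have d1 : ((0 : E), fderiv ℝ ψ q.1 (sprayVec (pullbackFinsler ψ L) q) -
      (1 / 2 : ℝ) • fderiv ℝ (fderiv ℝ ψ) q.1 q.2 q.2) =
      ((0 : E), fderiv ℝ ψ q.1 (sprayVec (pullbackFinsler ψ L) q)) -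
      (1 / 2 : ℝ) • ((0 : E), fderiv ℝ (fderiv ℝ ψ) q.1 q.2 q.2) := by simp
  have d2 : (fderiv ℝ ψ q.1 q.2, fderiv ℝ (fderiv ℝ ψ) q.1 q.2 q.2) =
      (Q.2, (0 : E)) + ((0 : E), fderiv ℝ (fderiv ℝ ψ) q.1 q.2 q.2) := by simp [hQ2]
  have d3 : (fderiv ℝ ψ q.1 v, fderiv ℝ (fderiv ℝ ψ) q.1 q.2 v) =
      (fderiv ℝ ψ q.1 v, (0 : E)) + ((0 : E), fderiv ℝ (fderiv ℝ ψ) q.1 q.2 v) := by simp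
  rw [d2, d3, map_add, map_add, _root_.add_apply] at h1
  rw [d1, map_sub, map_smul, _root_.sub_apply, _root_.smul_apply, smul_eq_mul]
  linarith

/-- The horizontal lift is natural with respect to changes of coordinates. -/
theorem tangentLiftDeriv_horizontal {x y : E} (hx : x ∈ D) (hy : y ≠ 0) (a : E) :
    tangentLiftDeriv ψ (x, y) (a, -connVec (pullbackFinsler ψ L) x y a) =
      (fderiv ℝ ψ x a, -connVec L (ψ x) (fderiv ℝ ψ x y) (fderiv ℝ ψ x a)) := by
  have hL' := isFinslerOn_pullback hL hD hψ hinj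
  have hq : (x, y) ∈ D ×ˢ ({0}ᶜ : Set E) := ⟨hx, hy⟩
  have hy' : fderiv ℝ ψ x y ≠ 0 := (mapsTo_tangentLift hinj hq).2
  rw [tangentLiftDeriv_apply, hL.connVec_eq (mem_univ _) hy', hL'.connVec_eq hx hy]
  have h1 : HasFDerivAt (fun q => sprayVec L (tangentLift ψ q)) _ (x, y) :=
    (hL.hasFDerivAt_sprayVec (mapsTo_tangentLift hinj hq)).comp (x, y)
      (hasFDerivAt_tangentLift hD hψ hx)
  have h2 := (hL'.hasFDerivAt_sprayVec hq).comp y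
    ((hasFDerivAt_const x y).prodMk (hasFDerivAt_id (𝕜 := ℝ) y))
  have h3 := h1.comp y ((hasFDerivAt_const x y).prodMk (hasFDerivAt_id (𝕜 := ℝ) y))
  have h4 := ((fderiv ℝ ψ x).hasFDerivAt.comp y h2).sub
    ((((fderiv ℝ (fderiv ℝ ψ) x).hasFDerivAt (x := y)).clm_apply
      (hasFDerivAt_id (𝕜 := ℝ) y)).const_smul (1 / 2 : ℝ))
  have e1 : ((fun q => sprayVec L (tangentLift ψ q)) ∘ fun y' : E => (x, id y')) =ᶠ[𝓝 y] _ :=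
    Filter.eventuallyEq_of_mem (isOpen_compl_singleton.mem_nhds hy) fun y' hy' =>
      sprayVec_tangentLift hL hD hψ hinj hsurj (q := (x, y')) ⟨hx, hy'⟩
  -- Fibre derivative of the transformation law of the spray. The term `(1/2) ψ''(y, y)` contributes
  -- `ψ''(a, y)` by symmetry, which is the inhomogeneous term of `tangentLiftDeriv`.
  have h5 := congrArg (fun T : E →L[ℝ] E => T a) (h3.unique (h4.congr_of_eventuallyEq e1))
  have hsymm : fderiv ℝ (fderiv ℝ ψ) x y a = fderiv ℝ (fderiv ℝ ψ) x a y :=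
    ((hψ.contDiffAt (hD.mem_nhds hx)).isSymmSndFDerivAt
      (by rw [minSmoothness_of_isRCLikeNormedField];
          exact (mod_cast le_top : ((2 : ℕ∞) : WithTop ℕ∞) ≤ ∞))).eq _ _
  have h6 : fderiv ℝ (sprayVec L) (tangentLift ψ (x, y)) (0, fderiv ℝ ψ x a) =
      fderiv ℝ ψ x (fderiv ℝ (sprayVec (pullbackFinsler ψ L)) (x, y) (0, a)) -
        fderiv ℝ (fderiv ℝ ψ) x a y := by
    simp [tangentLiftDeriv_apply, hsymm] at h5
    rw [h5, ← two_smul ℝ, smul_smul]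
    norm_num
  change _ = (_, -fderiv ℝ (sprayVec L) (tangentLift ψ (x, y)) _)
  rw [h6]
  simp
  abel

end Naturality

end LocalConnection

end FinslerHol

namespace FinslerHol

/-! ### Parallel transport along segments -/

section Transport

open scoped Topology NNReal

variable {n : ℕ}

local notation "E" => EuclideanSpace ℝ (Fin n)

/-- For an integral curve that might reach the zero section, the energy is known to be stationary
only while it is positive. The set `m = m 0` is closed, and from each of its points `m` stays
positive, hence constant, a little further to the right. -/
theorem eq_of_hasDerivAt_zero_of_pos {m : ℝ → ℝ} (hc : ContinuousOn m (Icc 0 1))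
    (hd : ∀ t ∈ Icc (0 : ℝ) 1, 0 < m t → HasDerivAt m 0 t) (h0 : 0 < m 0) :
    ∀ t ∈ Icc (0 : ℝ) 1, m t = m 0 := by
  have hcl : IsClosed ({t | m t = m 0} ∩ Icc (0 : ℝ) 1) := by
    rw [inter_comm]
    exact hc.preimage_isClosed_of_isClosed isClosed_Icc (isClosed_singleton (x := m 0))
  refine fun t ht => hcl.Icc_subset_of_forall_mem_nhdsWithin rfl ?_ ht
  rintro x ⟨hx : m x = m 0, hx0, hx1⟩
  have hcx : ContinuousAt m x := (hd x ⟨hx0, hx1.le⟩ (hx ▸ h0)).continuousAt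
  have hpos : ∀ᶠ t in 𝓝 x, 0 < m t := hcx.eventually (lt_mem_nhds (hx ▸ h0))
  obtain ⟨δ, hδ, hball⟩ := Metric.eventually_nhds_iff.1 hpos
  set b := min 1 (x + δ / 2) with hb
  have hxb : x < b := lt_min hx1 (by linarith)
  refine Filter.mem_of_superset (Ioc_mem_nhdsGT hxb) fun t ht => ?_
  have hd' : ∀ r ∈ Icc x b, HasDerivAt m 0 r := fun r hr => by
    refine hd r ⟨hx0.trans hr.1, hr.2.trans (min_le_left _ _)⟩ (hball ?_)
    have : r ≤ x + δ / 2 := hr.2.trans (min_le_right _ _)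
    rw [Real.dist_eq, abs_of_nonneg (by linarith [hr.1])]
    linarith
  have := constant_of_has_deriv_right_zero (fun r hr => (hd' r hr).continuousAt.continuousWithinAt)
    (fun r hr => (hd' r ⟨hr.1, hr.2.le⟩).hasDerivWithinAt) t ⟨ht.1.le, ht.2⟩
  exact this.trans hx

/-- The curve `Y` is parallel along the segment `t ↦ x + t u`. -/
def IsTransport (L : EuclideanSpace ℝ (Fin n) → EuclideanSpace ℝ (Fin n) → ℝ)
    (x u : EuclideanSpace ℝ (Fin n)) (Y : ℝ → EuclideanSpace ℝ (Fin n)) : Prop :=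
  ∀ t ∈ Icc (0 : ℝ) 1, Y t ≠ 0 ∧ HasDerivAt Y (-connVec L (x + t • u) (Y t) u) t

/-- The vector field on `{((x, y), u)}` whose integral curves are parallel along segments. -/
def transportField (L : EuclideanSpace ℝ (Fin n) → EuclideanSpace ℝ (Fin n) → ℝ)
    (p : (EuclideanSpace ℝ (Fin n) × EuclideanSpace ℝ (Fin n)) × EuclideanSpace ℝ (Fin n)) :
    (EuclideanSpace ℝ (Fin n) × EuclideanSpace ℝ (Fin n)) × EuclideanSpace ℝ (Fin n) :=
  ((p.2, -connVec L p.1.1 p.1.2 p.2), 0)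

/-- A compact region on which parallel transport stays. -/
def transportRegion (L : EuclideanSpace ℝ (Fin n) → EuclideanSpace ℝ (Fin n) → ℝ) (R : ℝ) :
    Set ((EuclideanSpace ℝ (Fin n) × EuclideanSpace ℝ (Fin n)) × EuclideanSpace ℝ (Fin n)) :=
  {p | ‖p.1.1‖ ≤ R ∧ ‖p.2‖ ≤ R ∧ R⁻¹ ≤ energy L p.1 ∧ energy L p.1 ≤ R}

variable {L : EuclideanSpace ℝ (Fin n) → EuclideanSpace ℝ (Fin n) → ℝ}
  (hL : IsFinslerOn univ L) (hc : Continuous fun q : EuclideanSpace ℝ (Fin n) ×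
    EuclideanSpace ℝ (Fin n) => L q.1 q.2)

include hL

theorem finsler_zero (x : E) : L x 0 = 0 := by
  have := hL.homogeneous x (mem_univ _) 0 2 two_pos
  rw [smul_zero] at this
  linarith

theorem energy_pos_iff {q : E × E} : 0 < energy L q ↔ q.2 ≠ 0 := by
  refine ⟨fun h h0 => ?_, fun h => hL.energy_pos (x := q.1) (y := q.2) (mem_univ _) h⟩
  rw [energy, h0, finsler_zero hL] at h
  simp at h

theorem hasDerivAt_energy_zero {γ : ℝ → E × E} {t c : ℝ} {u : E} (h : (γ t).2 ≠ 0)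
    (hγ : HasDerivAt γ (c • (u, -connVec L (γ t).1 (γ t).2 u)) t) :
    HasDerivAt (fun s => energy L (γ s)) 0 t := by
  have h1 := (hL.hasFDerivAt_energy (q := γ t) ⟨mem_univ _, h⟩).comp_hasDerivAt t hγ
  refine h1.congr_deriv ?_
  rw [map_smul, show γ t = ((γ t).1, (γ t).2) from rfl,
    hL.fderiv_energy_horizontal (mem_univ _) h, smul_zero]

theorem contDiffOn_transportField : ContDiffOn ℝ ∞ (transportField L)
    ((univ ×ˢ ({0}ᶜ : Set E)) ×ˢ (univ : Set E)) :=
  (contDiffOn_snd.prodMk hL.contDiffOn_connVec.neg).prodMk contDiffOn_const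

theorem IsTransport.energy_eq {x u : E} {Y : ℝ → E} (h : IsTransport L x u Y) {t : ℝ}
    (ht : t ∈ Icc (0 : ℝ) 1) : energy L (x + t • u, Y t) = energy L (x, Y 0) := by
  have hd : ∀ t ∈ Icc (0 : ℝ) 1, HasDerivAt (fun s => energy L (x + s • u, Y s)) 0 t := by
    intro t ht
    refine hasDerivAt_energy_zero hL (γ := fun s => (x + s • u, Y s)) (c := 1) (u := u)
      (h t ht).1 ?_
    have := (((hasDerivAt_id' t).smul_const u).const_add x).prodMk (h t ht).2
    simpa using this
  have := constant_of_has_deriv_right_zero (fun r hr => (hd r hr).continuousAt.continuousWithinAt)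
    (fun r hr => (hd r ⟨hr.1, hr.2.le⟩).hasDerivWithinAt) t ht
  simpa using this

theorem IsTransport.finsler_eq {x u : E} {Y : ℝ → E} (h : IsTransport L x u Y) {t : ℝ}
    (ht : t ∈ Icc (0 : ℝ) 1) : L (x + t • u) (Y t) = L x (Y 0) := by
  have hd : ∀ t ∈ Icc (0 : ℝ) 1, HasDerivAt (fun s => L (x + s • u) (Y s)) 0 t := by
    intro t ht
    have h1 : HasDerivAt (fun s => (x + s • u, Y s)) (u, -connVec L (x + t • u) (Y t) u) t := by
      simpa using (((hasDerivAt_id' t).smul_const u).const_add x).prodMk (h t ht).2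
    have h2 : HasFDerivAt (fun q : E × E => L q.1 q.2) _ (x + t • u, Y t) :=
      ((hL.smooth.contDiffAt (hL.isOpen_slit.mem_nhds (⟨mem_univ _, (h t ht).1⟩ :
        (x + t • u, Y t) ∈ univ ×ˢ ({0}ᶜ : Set E)))).differentiableAt
        (by simp)).hasFDerivAt
    refine (h2.comp_hasDerivAt t h1).congr_deriv ?_
    exact hL.fderiv_horizontal (mem_univ _) (h t ht).1 u
  have := constant_of_has_deriv_right_zero (fun r hr => (hd r hr).continuousAt.continuousWithinAt)
    (fun r hr => (hd r ⟨hr.1, hr.2.le⟩).hasDerivWithinAt) t ht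
  simpa using this

theorem transportRegion_subset {R : ℝ} (hR : 0 < R) :
    transportRegion L R ⊆ (univ ×ˢ ({0}ᶜ : Set E)) ×ˢ (univ : Set E) := fun _ hp =>
  ⟨⟨mem_univ _, (energy_pos_iff hL).1 ((inv_pos.2 hR).trans_le hp.2.2.1)⟩, mem_univ _⟩

include hc

omit hL in
theorem continuous_energy : Continuous (energy L) := by
  unfold energy
  exact continuous_const.mul (hc.pow 2)

/-- The fibre coordinate is bounded by homogeneity: if `m > 0` bounds the energy below on unit
vectors over the ball, then `‖y‖ ^ 2 * m ≤ energy ≤ R`. -/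
theorem isCompact_transportRegion (R : ℝ) : IsCompact (transportRegion L R) := by
  have he := continuous_energy hc
  have hcl : IsClosed (transportRegion L R) := by
    refine IsClosed.inter ?_ (IsClosed.inter ?_ (IsClosed.inter ?_ ?_))
    · exact isClosed_le (f := fun p : (E × E) × E => ‖p.1.1‖) (by fun_prop) continuous_const
    · exact isClosed_le (f := fun p : (E × E) × E => ‖p.2‖) (by fun_prop) continuous_const
    · exact isClosed_le continuous_const (he.comp continuous_fst)
    · exact isClosed_le (he.comp continuous_fst) continuous_const
  have hcomp : IsCompact (Metric.closedBall (0 : E) R ×ˢ Metric.sphere (0 : E) 1) :=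
    (isCompact_closedBall _ _).prod (isCompact_sphere _ _)
  obtain ⟨m, hm, hmin⟩ := hcomp.exists_forall_le' he.continuousOn (a := 0) fun q hq =>
    (energy_pos_iff hL).2 fun h => by
      have := hq.2
      simp [h] at this
  have hbd : ∀ p ∈ transportRegion L R, ‖p.1.2‖ ≤ √(R / m) := by
    rintro ⟨⟨x, y⟩, u⟩ ⟨hx, -, -, hR⟩
    simp only at hx hR ⊢
    by_cases hy : y = 0
    · simp [hy]
    have hy' : 0 < ‖y‖ := norm_pos_iff.2 hy
    have h1 := hmin (x, ‖y‖⁻¹ • y) ⟨by simpa using hx, by simp [norm_smul, hy'.ne']⟩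
    have h2 := hL.energy_smul (mem_univ x) (‖y‖⁻¹ • y) hy'
    rw [smul_smul, mul_inv_cancel₀ hy'.ne', one_smul] at h2
    apply Real.le_sqrt_of_sq_le
    rw [le_div_iff₀ hm]
    calc ‖y‖ ^ 2 * m ≤ ‖y‖ ^ 2 * energy L (x, ‖y‖⁻¹ • y) := by gcongr
      _ ≤ R := by rw [← h2]; exact hR
  refine IsCompact.of_isClosed_subset (((isCompact_closedBall (0 : E) R).prod
    (isCompact_closedBall (0 : E) (√(R / m)))).prod (isCompact_closedBall (0 : E) R)) hcl
    fun p hp => ⟨⟨?_, ?_⟩, ?_⟩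
  · simpa using hp.1
  · simpa using hbd p hp
  · simpa using hp.2.1

theorem exists_cutoff_transportField {R : ℝ} (hR : 0 < R) :
    ∃ (χ : (E × E) × E → ℝ) (K : ℝ≥0),
      ContDiff ℝ ∞ (fun p => χ p • transportField L p) ∧
      LipschitzWith K (fun p => χ p • transportField L p) ∧
      (∀ p ∈ transportRegion L R, χ p = 1) ∧ ∀ p, χ p ∈ Icc (0 : ℝ) 1 := by
  have hO : IsOpen ((univ ×ˢ ({0}ᶜ : Set E)) ×ˢ (univ : Set E)) :=
    hL.isOpen_slit.prod isOpen_univ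
  obtain ⟨χ, hχ, hcs, hsupp, hone, hχI⟩ := exists_cutoff (isCompact_transportRegion hL hc R) hO
    (transportRegion_subset hL hR)
  have hsm := contDiff_cutoff_smul hO hχ hsupp (contDiffOn_transportField hL)
  obtain ⟨K, hK⟩ := hsm.lipschitzWith_of_hasCompactSupport hcs.smul_right (by simp)
  exact ⟨χ, K, hsm, hK, fun p hp => hone.self_of_nhdsSet p hp, hχI⟩

/-- Initial data whose transport stays in `transportRegion`. -/
def transportDomain (L : EuclideanSpace ℝ (Fin n) → EuclideanSpace ℝ (Fin n) → ℝ) (R : ℝ) :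
    Set ((EuclideanSpace ℝ (Fin n) × EuclideanSpace ℝ (Fin n)) × EuclideanSpace ℝ (Fin n)) :=
  {p | ‖p.1.1‖ + ‖p.2‖ < R ∧ R⁻¹ < energy L p.1 ∧ energy L p.1 < R}

omit hL in
theorem isOpen_transportDomain (R : ℝ) : IsOpen (transportDomain L R) := by
  have he := continuous_energy hc
  refine IsOpen.inter ?_ (IsOpen.inter ?_ ?_)
  · exact isOpen_lt (f := fun p : (E × E) × E => ‖p.1.1‖ + ‖p.2‖) (by fun_prop) continuous_const
  · exact isOpen_lt continuous_const (he.comp continuous_fst)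
  · exact isOpen_lt (he.comp continuous_fst) continuous_const

omit hL hc in
theorem mem_transportRegion {R : ℝ} {p : (E × E) × E} (hp : p ∈ transportDomain L R) {x y : E}
    (hx : ‖x - p.1.1‖ ≤ ‖p.2‖) (he : energy L (x, y) = energy L p.1) :
    ((x, y), p.2) ∈ transportRegion L R := by
  refine ⟨?_, ?_, ?_, ?_⟩
  · have := norm_le_norm_add_norm_sub' x p.1.1
    have := hp.1
    simp only
    linarith [norm_sub_rev x p.1.1]
  · have := hp.1
    have := norm_nonneg p.1.1
    simp only
    linarith
  · exact hp.2.1.le.trans he.ge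
  · exact he.le.trans hp.2.2.le

omit hc in
theorem exists_mem_transportDomain {p : (E × E) × E} (hp : p.1.2 ≠ 0) :
    ∃ R, 0 < R ∧ p ∈ transportDomain L R := by
  have he := (energy_pos_iff hL (q := p.1)).2 hp
  set R := ‖p.1.1‖ + ‖p.2‖ + energy L p.1 + (energy L p.1)⁻¹ + 1 with hR
  have h1 := norm_nonneg p.1.1
  have h2 := norm_nonneg p.2
  have h3 := inv_pos.2 he
  refine ⟨R, by positivity, ?_, ?_, ?_⟩
  · simp only [hR]; linarith
  · rw [inv_lt_comm₀ (by positivity) he]; simp only [hR]; linarith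
  · simp only [hR]; linarith

/-- Parallel transport on `transportDomain` is the time-one map of a smooth Lipschitz field. -/
theorem exists_transport_flow {R : ℝ} (hR : 0 < R) :
    ∃ f : (E × E) × E → E, ContDiff ℝ ∞ f ∧ ∀ p ∈ transportDomain L R,
      ∃ Y : ℝ → E, IsTransport L p.1.1 p.2 Y ∧ Y 0 = p.1.2 ∧ Y 1 = f p := by
  obtain ⟨χ, K, hsm, hK, hone, hχI⟩ := exists_cutoff_transportField hL hc hR
  obtain ⟨γ, hγ0, hγd, hγs⟩ := exists_flow hsm hK
  refine ⟨fun p => (γ p 1).1.2, contDiff_snd.comp (contDiff_fst.comp hγs), fun p hp => ?_⟩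
  have hpos : p.1.2 ≠ 0 := (energy_pos_iff hL).1 ((inv_pos.2 hR).trans hp.2.1)
  have hd2 : ∀ t ∈ Icc (0 : ℝ) 1, HasDerivAt (fun t => (γ p t).2) 0 t := fun t ht => by
    have := (ContinuousLinearMap.snd ℝ (E × E) E).hasFDerivAt.comp_hasDerivAt t (hγd p t ht)
    exact this.congr_deriv (by simp [transportField])
  have hu : ∀ t ∈ Icc (0 : ℝ) 1, (γ p t).2 = p.2 := fun t ht => by
    have := constant_of_has_deriv_right_zero
      (fun r hr => (hd2 r hr).continuousAt.continuousWithinAt)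
      (fun r hr => (hd2 r ⟨hr.1, hr.2.le⟩).hasDerivWithinAt) t ht
    rw [this, hγ0]
  have hd1 : ∀ t ∈ Icc (0 : ℝ) 1, HasDerivAt (fun t => (γ p t).1)
      (χ (γ p t) • (p.2, -connVec L (γ p t).1.1 (γ p t).1.2 p.2)) t := fun t ht => by
    have := (ContinuousLinearMap.fst ℝ (E × E) E).hasFDerivAt.comp_hasDerivAt t (hγd p t ht)
    refine this.congr_deriv ?_
    simp [transportField, hu t ht]
  -- The cut-off field is a multiple of a horizontal one, so it still preserves the energy; the same
  -- holds before it is known that the cutoff equals `1` along the curve.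
  have he : ∀ t ∈ Icc (0 : ℝ) 1, energy L (γ p t).1 = energy L p.1 := by
    have := eq_of_hasDerivAt_zero_of_pos (m := fun t => energy L (γ p t).1)
      (fun t ht => ((continuous_energy hc).continuousAt.comp
        (hd1 t ht).continuousAt).continuousWithinAt)
      (fun t ht hm => hasDerivAt_energy_zero hL ((energy_pos_iff hL).1 hm) (hd1 t ht))
      (by simpa [hγ0] using (energy_pos_iff hL).2 hpos)
    simpa [hγ0] using this
  have hd11 : ∀ t ∈ Icc (0 : ℝ) 1, HasDerivAt (fun t => (γ p t).1.1) (χ (γ p t) • p.2) t :=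
    fun t ht => by
      have := (ContinuousLinearMap.fst ℝ E E).hasFDerivAt.comp_hasDerivAt t (hd1 t ht)
      exact this.congr_deriv (by simp)
  -- The cutoff lies between `0` and `1`, so the base point moves with speed at most `‖u‖`.
  have hx : ∀ t ∈ Icc (0 : ℝ) 1, ‖(γ p t).1.1 - p.1.1‖ ≤ ‖p.2‖ := fun t ht => by
    have := norm_image_sub_le_of_norm_deriv_le_segment' (C := ‖p.2‖)
      (fun r hr => (hd11 r hr).hasDerivWithinAt) (fun r hr => by
        rw [norm_smul, Real.norm_eq_abs, abs_of_nonneg (hχI _).1]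
        exact mul_le_of_le_one_left (norm_nonneg _) (hχI _).2) t ht
    rw [hγ0] at this
    refine this.trans ?_
    rw [sub_zero]
    exact mul_le_of_le_one_right (norm_nonneg _) ht.2
  -- The two bounds keep the curve in the region where the cutoff is `1`; it therefore solves the
  -- original equation.
  have hχ1 : ∀ t ∈ Icc (0 : ℝ) 1, χ (γ p t) = 1 := fun t ht => by
    have := mem_transportRegion hp (hx t ht) (y := (γ p t).1.2) (he t ht)
    refine hone _ ?_
    convert this using 1
    rw [← hu t ht]
  have hx' : ∀ t ∈ Icc (0 : ℝ) 1, (γ p t).1.1 = p.1.1 + t • p.2 := fun t ht => by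
    have hd3 : ∀ t ∈ Icc (0 : ℝ) 1, HasDerivAt (fun t => (γ p t).1.1 - t • p.2) 0 t :=
      fun t ht => by
        have := (hd11 t ht).fun_sub ((hasDerivAt_id' t).smul_const p.2)
        simpa [hχ1 t ht] using this
    have := constant_of_has_deriv_right_zero
      (fun r hr => (hd3 r hr).continuousAt.continuousWithinAt)
      (fun r hr => (hd3 r ⟨hr.1, hr.2.le⟩).hasDerivWithinAt) t ht
    rw [hγ0, zero_smul, sub_zero] at this
    rw [← this]
    abel
  refine ⟨fun t => (γ p t).1.2, fun t ht => ⟨?_, ?_⟩, by simp [hγ0], rfl⟩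
  · exact (energy_pos_iff hL).1 (by rw [he t ht]; exact (energy_pos_iff hL).2 hpos)
  · have := (ContinuousLinearMap.snd ℝ E E).hasFDerivAt.comp_hasDerivAt t (hd1 t ht)
    refine this.congr_deriv ?_
    simp [hχ1 t ht, hx' t ht]

/-- Both transports keep the common initial energy, so both stay in one compact region and solve the
same globally Lipschitz cut-off equation. -/
theorem IsTransport.unique {x u : E} {Y Y' : ℝ → E} (h : IsTransport L x u Y)
    (h' : IsTransport L x u Y') (h0 : Y 0 = Y' 0) {t : ℝ} (ht : t ∈ Icc (0 : ℝ) 1) :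
    Y t = Y' t := by
  obtain ⟨R, hR, hp⟩ := exists_mem_transportDomain hL (p := ((x, Y 0), u))
    (h 0 (by simp)).1
  obtain ⟨χ, K, -, hK, hone, -⟩ := exists_cutoff_transportField hL hc hR
  have key : ∀ Z : ℝ → E, IsTransport L x u Z → Z 0 = Y 0 → ∀ t ∈ Icc (0 : ℝ) 1,
      HasDerivAt (fun s => ((x + s • u, Z s), u))
        (χ ((x + t • u, Z t), u) • transportField L ((x + t • u, Z t), u)) t := by
    intro Z hZ hZ0 t ht
    have hmem := mem_transportRegion hp (x := x + t • u) (y := Z t)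
      (by
        simp only [add_sub_cancel_left, norm_smul, Real.norm_eq_abs, abs_of_nonneg ht.1]
        exact mul_le_of_le_one_left (norm_nonneg _) ht.2)
      (by rw [hZ.energy_eq hL ht, hZ0])
    rw [hone _ hmem, one_smul]
    have := ((((hasDerivAt_id' t).smul_const u).const_add x).prodMk (hZ t ht).2).prodMk
      (hasDerivAt_const t u)
    simpa [transportField] using this
  have hE := ODE_solution_unique_of_mem_Icc_right
    (v := fun _ p => χ p • transportField L p) (s := fun _ => univ) (K := K) (a := 0) (b := 1)
    (f := fun s => ((x + s • u, Y s), u)) (g := fun s => ((x + s • u, Y' s), u))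
    (fun _ _ => hK.lipschitzOnWith)
    (fun t ht => (key Y h rfl t ht).continuousAt.continuousWithinAt)
    (fun t ht => (key Y h rfl t ⟨ht.1, ht.2.le⟩).hasDerivWithinAt) (fun _ _ => mem_univ _)
    (fun t ht => (key Y' h' h0.symm t ht).continuousAt.continuousWithinAt)
    (fun t ht => (key Y' h' h0.symm t ⟨ht.1, ht.2.le⟩).hasDerivWithinAt) (fun _ _ => mem_univ _)
    (by simp [h0]) ht
  simpa using hE

theorem exists_isTransport {x y u : E} (hy : y ≠ 0) :
    ∃ Y : ℝ → E, IsTransport L x u Y ∧ Y 0 = y := by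
  obtain ⟨R, hR, hp⟩ := exists_mem_transportDomain hL (p := ((x, y), u)) hy
  obtain ⟨f, -, hf⟩ := exists_transport_flow hL hc hR
  obtain ⟨Y, hY, hY0, -⟩ := hf _ hp
  exact ⟨Y, hY, hY0⟩

omit hL hc

open Classical in
/-- Parallel transport of `y` along the segment from `x` to `x + u`. -/
def transport (L : EuclideanSpace ℝ (Fin n) → EuclideanSpace ℝ (Fin n) → ℝ)
    (x y u : EuclideanSpace ℝ (Fin n)) : EuclideanSpace ℝ (Fin n) :=
  if h : ∃ Y : ℝ → EuclideanSpace ℝ (Fin n), IsTransport L x u Y ∧ Y 0 = y then h.choose 1 else 0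

/-- No transport starts at the zero vector, so the default value applies. Thanks to it, transport
along `-u` undoes transport along `u` on zero vectors too, and segment transports are permutations
of the whole space. -/
theorem transport_zero (x u : E) : transport L x 0 u = 0 := by
  rw [transport, dif_neg]
  rintro ⟨Y, hY, hY0⟩
  exact (hY 0 (by simp)).1 hY0

include hL hc

theorem IsTransport.apply_one {x u : E} {Y : ℝ → E} (h : IsTransport L x u Y) :
    transport L x (Y 0) u = Y 1 := by
  have hex : ∃ Z : ℝ → E, IsTransport L x u Z ∧ Z 0 = Y 0 := ⟨Y, h, rfl⟩
  rw [transport, dif_pos hex]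
  exact hex.choose_spec.1.unique hL hc h hex.choose_spec.2 (by simp)

theorem contDiffOn_transport : ContDiffOn ℝ ∞
    (fun p : (E × E) × E => transport L p.1.1 p.1.2 p.2) ((univ ×ˢ {0}ᶜ) ×ˢ univ) := by
  rintro p ⟨⟨-, hp⟩, -⟩
  obtain ⟨R, hR, hpR⟩ := exists_mem_transportDomain hL hp
  obtain ⟨f, hfs, hf⟩ := exists_transport_flow hL hc hR
  refine (hfs.contDiffAt.congr_of_eventuallyEq (Filter.eventuallyEq_of_mem
    ((isOpen_transportDomain hc R).mem_nhds hpR) fun q hq => ?_)).contDiffWithinAt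
  obtain ⟨Y, hY, hY0, hY1⟩ := hf q hq
  rw [← hY0, hY.apply_one hL hc, hY1]

theorem transport_ne_zero {x y u : E} (hy : y ≠ 0) : transport L x y u ≠ 0 := by
  obtain ⟨Y, hY, rfl⟩ := exists_isTransport hL hc hy (x := x) (u := u)
  rw [hY.apply_one hL hc]
  exact (hY 1 (by simp)).1

theorem finsler_transport (x y u : E) : L (x + u) (transport L x y u) = L x y := by
  by_cases hy : y = 0
  · rw [hy, transport_zero, finsler_zero hL, finsler_zero hL]
  obtain ⟨Y, hY, rfl⟩ := exists_isTransport hL hc hy (x := x) (u := u)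
  rw [hY.apply_one hL hc]
  simpa using hY.finsler_eq hL (t := 1) (by simp)

omit hL hc in
theorem IsTransport.reverse {x u : E} {Y : ℝ → E} (h : IsTransport L x u Y)
    (hlin : ∀ x y, y ≠ 0 → connVec L x y (-u) = -connVec L x y u) :
    IsTransport L (x + u) (-u) (fun t => Y (1 - t)) := by
  intro t ht
  have ht' : 1 - t ∈ Icc (0 : ℝ) 1 := ⟨by linarith [ht.2], by linarith [ht.1]⟩
  refine ⟨(h _ ht').1, ?_⟩
  have h1 : HasDerivAt (fun t : ℝ => 1 - t) (-1) t := by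
    simpa using (hasDerivAt_id' t).const_sub 1
  refine ((h _ ht').2.scomp t h1).congr_deriv ?_
  rw [hlin _ _ (h _ ht').1, show x + u + t • -u = x + (1 - t) • u by
    rw [smul_neg, sub_smul, one_smul]; abel]
  simp

omit hc in
theorem connVec_smul {x y : E} (hy : y ≠ 0) (c : ℝ) (u : E) :
    connVec L x y (c • u) = c • connVec L x y u := by
  rw [hL.connVec_eq (mem_univ _) hy, hL.connVec_eq (mem_univ _) hy, ← map_smul]
  simp

theorem transport_neg (x y u : E) : transport L (x + u) (transport L x y u) (-u) = y := by
  by_cases hy : y = 0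
  · rw [hy, transport_zero, transport_zero]
  obtain ⟨Y, hY, rfl⟩ := exists_isTransport hL hc hy (x := x) (u := u)
  have h := hY.reverse fun x y hy => by simpa using connVec_smul hL hy (-1) u
  rw [hY.apply_one hL hc]
  simpa using h.apply_one hL hc

theorem IsTransport.apply {x u : E} {Y : ℝ → E} (h : IsTransport L x u Y) {s : ℝ}
    (hs : s ∈ Icc (0 : ℝ) 1) : transport L x (Y 0) (s • u) = Y s := by
  have h' : IsTransport L x (s • u) (fun t => Y (t * s)) := by
    intro t ht
    have hts : t * s ∈ Icc (0 : ℝ) 1 := ⟨mul_nonneg ht.1 hs.1, mul_le_one₀ ht.2 hs.1 hs.2⟩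
    refine ⟨(h _ hts).1, ?_⟩
    have h1 : HasDerivAt (fun t : ℝ => t * s) s t := by
      simpa using (hasDerivAt_id' t).mul_const s
    refine ((h _ hts).2.scomp t h1).congr_deriv ?_
    rw [connVec_smul hL (h _ hts).1, smul_smul, smul_neg]
  simpa using h'.apply_one hL hc

theorem transport_zero_vec (x y : E) : transport L x y 0 = y := by
  by_cases hy : y = 0
  · rw [hy, transport_zero]
  obtain ⟨Y, hY, rfl⟩ := exists_isTransport hL hc hy (x := x) (u := 0)
  simpa using hY.apply hL hc (s := 0) (by simp)

theorem hasDerivAt_transport {x y : E} (hy : y ≠ 0) (u : E) :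
    HasDerivAt (fun s : ℝ => transport L x y (s • u)) (-connVec L x y u) 0 := by
  have hO : IsOpen ((univ ×ˢ ({0}ᶜ : Set E)) ×ˢ (univ : Set E)) :=
    hL.isOpen_slit.prod isOpen_univ
  have hd : DifferentiableAt ℝ (fun s : ℝ => transport L x y (s • u)) 0 := by
    have h1 := (contDiffOn_transport hL hc).contDiffAt
      (hO.mem_nhds (⟨⟨mem_univ x, hy⟩, mem_univ ((0 : ℝ) • u)⟩ :
        ((x, y), (0 : ℝ) • u) ∈ (univ ×ˢ ({0}ᶜ : Set E)) ×ˢ (univ : Set E)))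
    have h2 : DifferentiableAt ℝ (fun s : ℝ => ((x, y), s • u)) 0 := by fun_prop
    exact DifferentiableAt.comp (0 : ℝ) (h1.differentiableAt (by simp)) h2
  obtain ⟨Y, hY, hY0⟩ := exists_isTransport hL hc hy (x := x) (u := u)
  have h1 : HasDerivWithinAt Y (-connVec L x y u) (Icc 0 1) 0 := by
    simpa [hY0] using ((hY 0 (by simp)).2).hasDerivWithinAt
  have h2 : HasDerivWithinAt Y (deriv (fun s : ℝ => transport L x y (s • u)) 0) (Icc 0 1) 0 :=
    hd.hasDerivAt.hasDerivWithinAt.congr (fun s hs => by rw [← hY0, hY.apply hL hc hs])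
      (by rw [← hY0, hY.apply hL hc (by simp)])
  -- The derivative exists by joint smoothness; the curve `Y` determines it from the right, and that
  -- suffices.
  have h3 := (uniqueDiffOn_Icc zero_lt_one (0 : ℝ) (by simp)).eq_deriv _ h1 h2
  rw [h3]
  exact hd.hasDerivAt

end Transport

end FinslerHol

namespace FinslerHol

/-! ### Parallel transport around parallelograms -/

section Loops

variable {n : ℕ}

local notation "E" => EuclideanSpace ℝ (Fin n)

/-- Parallel transport of `(x, y)` along the segment from `x` to `x + s π a`, where `a` is carried
along as a parameter. -/
def segShift (L : EuclideanSpace ℝ (Fin n) → EuclideanSpace ℝ (Fin n) → ℝ)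
    (π : EuclideanSpace ℝ (Fin n) × EuclideanSpace ℝ (Fin n) →L[ℝ] EuclideanSpace ℝ (Fin n))
    (s : ℝ) (p : (EuclideanSpace ℝ (Fin n) × EuclideanSpace ℝ (Fin n)) ×
      (EuclideanSpace ℝ (Fin n) × EuclideanSpace ℝ (Fin n))) :
    (EuclideanSpace ℝ (Fin n) × EuclideanSpace ℝ (Fin n)) ×
      (EuclideanSpace ℝ (Fin n) × EuclideanSpace ℝ (Fin n)) :=
  ((p.1.1 + s • π p.2, transport L p.1.1 p.1.2 (s • π p.2)), p.2)

/-- The vertical component of the bracket of the horizontal lifts of the constant fields `u`, `w`. -/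
def curv (L : EuclideanSpace ℝ (Fin n) → EuclideanSpace ℝ (Fin n) → ℝ)
    (q : EuclideanSpace ℝ (Fin n) × EuclideanSpace ℝ (Fin n)) (u w : EuclideanSpace ℝ (Fin n)) :
    EuclideanSpace ℝ (Fin n) :=
  fderiv ℝ (fun q => connVec L q.1 q.2 u) q (w, -connVec L q.1 q.2 w) -
    fderiv ℝ (fun q => connVec L q.1 q.2 w) q (u, -connVec L q.1 q.2 u)

/-- The permutation induced by `σ` on a graph that is invariant under `σ`. -/
@[simps] def graphPerm {W V : Type*} (σ : Equiv.Perm (W × V)) (χ : W → V)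
    (h : ∀ z, (σ (z, χ z)).2 = χ (σ (z, χ z)).1)
    (h' : ∀ z, (σ.symm (z, χ z)).2 = χ (σ.symm (z, χ z)).1) : Equiv.Perm W where
  toFun z := (σ (z, χ z)).1
  invFun z := (σ.symm (z, χ z)).1
  left_inv z := by
    change (σ.symm ((σ (z, χ z)).1, χ (σ (z, χ z)).1)).1 = z
    rw [← h z, Prod.mk.eta, σ.symm_apply_apply]
  right_inv z := by
    change (σ ((σ.symm (z, χ z)).1, χ (σ.symm (z, χ z)).1)).1 = z
    rw [← h' z, Prod.mk.eta, σ.apply_symm_apply]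

variable {L : EuclideanSpace ℝ (Fin n) → EuclideanSpace ℝ (Fin n) → ℝ}
  (hL : IsFinslerOn univ L) (hc : Continuous fun q : EuclideanSpace ℝ (Fin n) ×
    EuclideanSpace ℝ (Fin n) => L q.1 q.2)

/-- `segShift` as a permutation. -/
@[simps] def segPerm
    (π : EuclideanSpace ℝ (Fin n) × EuclideanSpace ℝ (Fin n) →L[ℝ] EuclideanSpace ℝ (Fin n))
    (s : ℝ) : Equiv.Perm ((EuclideanSpace ℝ (Fin n) × EuclideanSpace ℝ (Fin n)) ×
      (EuclideanSpace ℝ (Fin n) × EuclideanSpace ℝ (Fin n))) where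
  toFun := segShift L π s
  invFun := segShift L π (-s)
  left_inv p := by simp [segShift, transport_neg hL hc]
  right_inv p := by
    have := transport_neg hL hc p.1.1 p.1.2 ((-s) • π p.2)
    simp only [neg_smul, neg_neg] at this
    simp [segShift, this]

include hL hc in
theorem contDiffOn_segShift (π : E × E →L[ℝ] E) : ContDiffOn ℝ ∞
    (fun q : ℝ × ((E × E) × (E × E)) => segShift L π q.1 q.2)
    (univ ×ˢ ((univ ×ˢ {0}ᶜ) ×ˢ univ)) := by
  have h1 : ContDiffOn ℝ ∞ (fun q : ℝ × ((E × E) × (E × E)) =>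
      transport L q.2.1.1 q.2.1.2 (q.1 • π q.2.2)) (univ ×ˢ ((univ ×ˢ {0}ᶜ) ×ˢ univ)) :=
    (contDiffOn_transport hL hc).comp
      (f := fun q : ℝ × ((E × E) × (E × E)) => (q.2.1, q.1 • π q.2.2)) (by fun_prop)
      fun q hq => ⟨hq.2.1, mem_univ _⟩
  exact ContDiffOn.prodMk (ContDiffOn.prodMk (by fun_prop) h1) (by fun_prop)

include hL hc in
theorem hasDerivAt_segShift (π : E × E →L[ℝ] E) {p : (E × E) × (E × E)} (hp : p.1.2 ≠ 0) :
    HasDerivAt (fun s => segShift L π s p) ((π p.2, -connVec L p.1.1 p.1.2 (π p.2)), 0) 0 := by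
  refine HasDerivAt.prodMk (HasDerivAt.prodMk ?_ (hasDerivAt_transport hL hc hp _))
    (hasDerivAt_const _ _)
  simpa using ((hasDerivAt_id' (0 : ℝ)).smul_const (π p.2)).const_add p.1.1

theorem isFamilyOfOrder_segPerm (π : E × E →L[ℝ] E) :
    IsFamilyOfOrder ((univ ×ˢ {0}ᶜ) ×ˢ univ) 1 (segPerm hL hc π)
      (paramQuotient fun q : ℝ × ((E × E) × (E × E)) => segShift L π q.1 q.2 - q.2) := by
  have hU : IsOpen ((univ ×ˢ ({0}ᶜ : Set E)) ×ˢ (univ : Set (E × E))) :=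
    hL.isOpen_slit.prod isOpen_univ
  have h0 : ∀ p : (E × E) × (E × E), segShift L π 0 p - p = 0 := fun p => by
    simp [segShift, transport_zero_vec hL hc]
  have hs := contDiffOn_segShift hL hc π
  refine ⟨fun t z hz => ⟨⟨mem_univ _, transport_ne_zero hL hc hz.1.2⟩, mem_univ _⟩,
    fun t z hz => ⟨⟨mem_univ _, transport_ne_zero hL hc hz.1.2⟩, mem_univ _⟩, hs, ?_, ?_,
    fun t z hz => ?_⟩
  · exact ContDiffOn.comp_param hs (a := fun q : ℝ × ((E × E) × (E × E)) => -q.1) (by fun_prop)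
      (by fun_prop) fun q hq => hq.2
  · exact contDiffOn_paramQuotient (isOpen_univ.prod hU) (hs.sub contDiffOn_snd) fun p _ => h0 p
  · have := smul_paramQuotient
      (f := fun q : ℝ × ((E × E) × (E × E)) => segShift L π q.1 q.2 - q.2) (q := (t, z))
      (by rintro rfl; exact h0 z)
    simp only at this
    rw [pow_one, this]
    simp

include hL hc in
theorem paramQuotient_segShift (π : E × E →L[ℝ] E) {p : (E × E) × (E × E)} (hp : p.1.2 ≠ 0) :
    paramQuotient (fun q : ℝ × ((E × E) × (E × E)) => segShift L π q.1 q.2 - q.2) (0, p) =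
      ((π p.2, -connVec L p.1.1 p.1.2 (π p.2)), 0) := by
  rw [paramQuotient_zero]
  exact ((hasDerivAt_segShift hL hc π hp).sub_const p).deriv

include hL in
-- The shifts do not move the parameters, so only directions `(a, 0)` occur in the bracket. In these
-- the base component `π p.2` is constant, which is why the bracket is vertical.
theorem fderiv_horizontal_param (π : E × E →L[ℝ] E) {p : (E × E) × (E × E)} (hp : p.1.2 ≠ 0)
    (a : E × E) :
    fderiv ℝ (fun p : (E × E) × (E × E) =>
      (((π p.2, -connVec L p.1.1 p.1.2 (π p.2)), 0) : (E × E) × (E × E))) p (a, 0) =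
      ((0, -fderiv ℝ (fun q => connVec L q.1 q.2 (π p.2)) p.1 a), 0) := by
  have hU : IsOpen ((univ ×ˢ ({0}ᶜ : Set E)) ×ˢ (univ : Set E)) :=
    hL.isOpen_slit.prod isOpen_univ
  have h1 : HasFDerivAt (fun q : (E × E) × E => connVec L q.1.1 q.1.2 q.2) _ (p.1, π p.2) :=
    ((hL.contDiffOn_connVec.contDiffAt (hU.mem_nhds (⟨⟨mem_univ _, hp⟩, mem_univ _⟩ :
      (p.1, π p.2) ∈ (univ ×ˢ ({0}ᶜ : Set E)) ×ˢ (univ : Set E)))).differentiableAt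
      (by simp)).hasFDerivAt
  have h2 : HasFDerivAt (fun p : (E × E) × (E × E) => (p.1, π p.2))
      ((ContinuousLinearMap.fst ℝ (E × E) (E × E)).prod
        (π ∘L ContinuousLinearMap.snd ℝ (E × E) (E × E))) p :=
    hasFDerivAt_fst.prodMk (π.hasFDerivAt.comp p hasFDerivAt_snd)
  have h3 : HasFDerivAt (fun q : E × E => connVec L q.1 q.2 (π p.2)) _ p.1 :=
    HasFDerivAt.comp (g := fun q : (E × E) × E => connVec L q.1.1 q.1.2 q.2)
      (f := fun q : E × E => (q, π p.2)) p.1 h1 ((hasFDerivAt_id p.1).prodMk (hasFDerivAt_const (π p.2) p.1))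
  have h4 := (h1.comp p h2).neg
  have h5 : HasFDerivAt (fun p : (E × E) × (E × E) => π p.2)
      (π ∘L ContinuousLinearMap.snd ℝ (E × E) (E × E)) p :=
    π.hasFDerivAt.comp p hasFDerivAt_snd
  have h6 := (h5.prodMk h4).prodMk (hasFDerivAt_const (0 : E × E) p)
  rw [h3.fderiv]
  refine (congrArg (fun T => T (a, (0 : E × E))) h6.fderiv).trans ?_
  simp

/-- The commutator of the two shifts. -/
def segLoop (s t : ℝ) : Equiv.Perm ((EuclideanSpace ℝ (Fin n) × EuclideanSpace ℝ (Fin n)) ×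
    (EuclideanSpace ℝ (Fin n) × EuclideanSpace ℝ (Fin n))) :=
  (segPerm hL hc (.snd ℝ _ _) t)⁻¹ * (segPerm hL hc (.fst ℝ _ _) s)⁻¹ *
    segPerm hL hc (.snd ℝ _ _) t * segPerm hL hc (.fst ℝ _ _) s

theorem segLoop_apply (s t : ℝ) (x y u w : E) : segLoop hL hc s t ((x, y), (u, w)) =
    ((x, transport L (x + t • w) (transport L (x + s • u + t • w)
      (transport L (x + s • u) (transport L x y (s • u)) (t • w)) (-(s • u))) (-(t • w))),
      (u, w)) := by
  have h : segLoop hL hc s t ((x, y), (u, w)) = segShift L (.snd ℝ _ _) (-t)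
    (segShift L (.fst ℝ _ _) (-s) (segShift L (.snd ℝ _ _) t
      (segShift L (.fst ℝ _ _) s ((x, y), (u, w))))) := rfl
  have e1 : x + s • u + t • w + -(s • u) = x + t • w := by abel
  rw [h]
  simp [segShift, e1]

theorem segLoop_symm_apply (s t : ℝ) (x y u w : E) : (segLoop hL hc s t).symm ((x, y), (u, w)) =
    ((x, transport L (x + s • u) (transport L (x + t • w + s • u)
      (transport L (x + t • w) (transport L x y (t • w)) (s • u)) (-(t • w))) (-(s • u))),
      (u, w)) := by
  have h : (segLoop hL hc s t).symm ((x, y), (u, w)) = segShift L (.fst ℝ _ _) (-s)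
    (segShift L (.snd ℝ _ _) (-t) (segShift L (.fst ℝ _ _) s
      (segShift L (.snd ℝ _ _) t ((x, y), (u, w))))) := rfl
  have e1 : x + t • w + s • u + -(t • w) = x + s • u := by abel
  rw [h]
  simp [segShift, e1]

/-- Parallel transport of `(x, y)` around the parallelogram at `x` with sides `s X x` and `t Y x`. -/
def loopPerm (X Y : EuclideanSpace ℝ (Fin n) → EuclideanSpace ℝ (Fin n)) (s t : ℝ) :
    Equiv.Perm (EuclideanSpace ℝ (Fin n) × EuclideanSpace ℝ (Fin n)) :=
  graphPerm (segLoop hL hc s t) (fun z => (X z.1, Y z.1))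
    (fun z => by rw [← Prod.mk.eta (p := z), segLoop_apply])
    (fun z => by rw [← Prod.mk.eta (p := z), segLoop_symm_apply])

theorem loopPerm_apply (X Y : E → E) (s t : ℝ) (z : E × E) :
    loopPerm hL hc X Y s t z = (z.1,
      transport L (z.1 + t • Y z.1)
        (transport L (z.1 + s • X z.1 + t • Y z.1)
          (transport L (z.1 + s • X z.1) (transport L z.1 z.2 (s • X z.1)) (t • Y z.1))
          (-(s • X z.1)))
        (-(t • Y z.1))) := by
  rw [loopPerm, graphPerm_apply, ← Prod.mk.eta (p := z), segLoop_apply]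

/-- The inverse of a commutator is the commutator in the opposite order: the parallelogram run
backwards starts with the other side. Smoothness of inverses thus needs no separate proof. -/
theorem loopPerm_symm (X Y : E → E) (s t : ℝ) :
    (loopPerm hL hc X Y s t).symm = loopPerm hL hc Y X t s := by
  refine Equiv.ext fun z => ?_
  rw [loopPerm_apply, loopPerm, graphPerm_symm_apply, ← Prod.mk.eta (p := z), segLoop_symm_apply]

theorem finsler_loopPerm (X Y : E → E) (s t : ℝ) (z : E × E) :
    L (loopPerm hL hc X Y s t z).1 (loopPerm hL hc X Y s t z).2 = L z.1 z.2 := by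
  have h : ∀ {x y u x' : E} {c : ℝ}, x + u = x' → L x y = c → L x' (transport L x y u) = c := by
    rintro x y u _ c rfl hx
    rw [finsler_transport hL hc, hx]
  rw [loopPerm_apply]
  exact h (by abel) (h (by abel) (h rfl (h rfl rfl)))

theorem loopPerm_ne_zero (X Y : E → E) (s t : ℝ) {z : E × E} (hz : z.2 ≠ 0) :
    (loopPerm hL hc X Y s t z).2 ≠ 0 := by
  rw [loopPerm_apply]
  exact transport_ne_zero hL hc (transport_ne_zero hL hc (transport_ne_zero hL hc
    (transport_ne_zero hL hc hz)))

/-- The commutator expansion is taken with free parameters `(u, w)` and only then restricted to the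
graph of `(X, Y)`. Derivatives of `X` and `Y` therefore never enter, and the leading coefficient is
tensorial. -/
theorem exists_coeff_loopPerm {X Y : E → E} (hX : ContDiff ℝ ∞ X) (hY : ContDiff ℝ ∞ Y) :
    ∃ K : (ℝ × ℝ) × (E × E) → E × E, ContDiffOn ℝ ∞ K (univ ×ˢ (univ ×ˢ {0}ᶜ)) ∧
      (∀ s t, ∀ z ∈ (univ : Set E) ×ˢ ({0}ᶜ : Set E),
        loopPerm hL hc X Y s t z = z + (s * t) • K ((s, t), z)) ∧
      ∀ z ∈ (univ : Set E) ×ˢ ({0}ᶜ : Set E), K ((0, 0), z) = (0, curv L z (X z.1) (Y z.1)) := by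
  have hU : IsOpen ((univ ×ˢ ({0}ᶜ : Set E)) ×ˢ (univ : Set (E × E))) :=
    hL.isOpen_slit.prod isOpen_univ
  obtain ⟨K, hK, hKe, hK0⟩ := (isFamilyOfOrder_segPerm hL hc (.fst ℝ _ _)).exists_commutator hU
    one_ne_zero one_ne_zero (isFamilyOfOrder_segPerm hL hc (.snd ℝ _ _))
  refine ⟨fun q => (K (q.1, (q.2, (X q.2.1, Y q.2.1)))).1, ?_, fun s t z hz => ?_, fun z hz => ?_⟩
  · exact (hK.comp (f := fun q : (ℝ × ℝ) × (E × E) => (q.1, (q.2, (X q.2.1, Y q.2.1))))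
      (by fun_prop) fun q hq => ⟨mem_univ _, hq.2, mem_univ _⟩).fst
  · have := congrArg Prod.fst (hKe s t (z, (X z.1, Y z.1)) ⟨hz, mem_univ _⟩)
    rw [pow_one, pow_one] at this
    exact this
  · simp only
    have hp : ((z, (X z.1, Y z.1)) : (E × E) × (E × E)) ∈
      (univ ×ˢ ({0}ᶜ : Set E)) ×ˢ (univ : Set (E × E)) := ⟨hz, mem_univ _⟩
    have he : ∀ π : E × E →L[ℝ] E, (fun z : (E × E) × (E × E) => paramQuotient
        (fun q : ℝ × ((E × E) × (E × E)) => segShift L π q.1 q.2 - q.2) (0, z))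
        =ᶠ[nhds (z, (X z.1, Y z.1))]
        fun p => ((π p.2, -connVec L p.1.1 p.1.2 (π p.2)), 0) := fun π =>
      Filter.eventuallyEq_of_mem (hU.mem_nhds hp) fun p hp =>
        paramQuotient_segShift hL hc π hp.1.2
    rw [hK0 _ hp, (he _).lieBracket_vectorField_eq (he _), VectorField.lieBracket_eq]
    refine (congrArg Prod.fst (congrArg₂ (· - ·)
      (fderiv_horizontal_param hL (.snd ℝ E E) (p := (z, (X z.1, Y z.1))) hz.2 _)
      (fderiv_horizontal_param hL (.fst ℝ E E) (p := (z, (X z.1, Y z.1))) hz.2 _))).trans ?_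
    simp [curv]
    abel

theorem contDiffOn_loopPerm {X Y : E → E} (hX : ContDiff ℝ ∞ X) (hY : ContDiff ℝ ∞ Y) :
    ContDiffOn ℝ ∞ (fun q : (ℝ × ℝ) × (E × E) => loopPerm hL hc X Y q.1.1 q.1.2 q.2)
      (univ ×ˢ (univ ×ˢ {0}ᶜ)) := by
  obtain ⟨K, hK, hKe, -⟩ := exists_coeff_loopPerm hL hc hX hY
  refine ContDiffOn.congr (f := fun q : (ℝ × ℝ) × (E × E) => q.2 + (q.1.1 * q.1.2) • K q)
    (contDiffOn_snd.add (ContDiffOn.smul (f := fun q => q.1.1 * q.1.2) (by fun_prop) hK)) fun q hq => ?_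
  exact hKe _ _ _ hq.2

theorem isStrongField_curv {X Y : E → E} (hX : ContDiff ℝ ∞ X) (hY : ContDiff ℝ ∞ Y)
    {G : Subgroup (Equiv.Perm (E × E))} (hG : ∀ s t, loopPerm hL hc X Y s t ∈ G) :
    IsStrongField G (univ ×ˢ {0}ᶜ) fun z => (0, curv L z (X z.1) (Y z.1)) := by
  obtain ⟨K, hK, hKe, hK0⟩ := exists_coeff_loopPerm hL hc hX hY
  -- The factor `s * t` becomes `t * t ^ 2`, of odd order `3`.
  refine ⟨3, fun t => loopPerm hL hc X Y t (t ^ 2), fun q => K ((q.1, q.1 ^ 2), q.2), by decide,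
    fun t => hG _ _, ⟨fun t z hz => ⟨mem_univ _, loopPerm_ne_zero hL hc X Y _ _ hz.2⟩,
      fun t z hz => ⟨mem_univ _, ?_⟩, ?_, ?_, ?_, fun t z hz => ?_⟩, fun z hz => ?_⟩
  · rw [loopPerm_symm]
    exact loopPerm_ne_zero hL hc Y X _ _ hz.2
  · exact (contDiffOn_loopPerm hL hc hX hY).comp
      (f := fun q : ℝ × (E × E) => ((q.1, q.1 ^ 2), q.2)) (by fun_prop)
      fun q hq => ⟨mem_univ _, hq.2⟩
  · simp only [loopPerm_symm]
    exact (contDiffOn_loopPerm hL hc hY hX).comp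
      (f := fun q : ℝ × (E × E) => ((q.1 ^ 2, q.1), q.2)) (by fun_prop)
      fun q hq => ⟨mem_univ _, hq.2⟩
  · exact hK.comp (f := fun q : ℝ × (E × E) => ((q.1, q.1 ^ 2), q.2)) (by fun_prop)
      fun q hq => ⟨mem_univ _, hq.2⟩
  · rw [hKe _ _ _ hz, pow_succ' t 2]
  · simpa using hK0 z hz

end Loops

end FinslerHol

namespace FinslerHol

/-! ### Global coordinates on the tangent bundle and the preferred charts -/

section Manifold

variable {n : ℕ} {M : Type*} [TopologicalSpace M] [ChartedSpace (EuclideanSpace ℝ (Fin n)) M]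
  [IsManifold (𝓡 n) ∞ M]

local notation "E" => EuclideanSpace ℝ (Fin n)

theorem contMDiff_mk_tangentBundle : ContMDiff 𝓘(ℝ, E × E) (𝓡 n).tangent ∞
    (fun q : E × E => (⟨q.1, q.2⟩ : TangentBundle (𝓡 n) E)) := by
  intro q
  rw [Bundle.contMDiffAt_totalSpace]
  refine ⟨contDiff_fst.contMDiff q, ?_⟩
  simpa using contDiff_snd.contMDiff q

/-- The coordinates of `TM` induced by a global coordinate system of `M`. -/
def tangentCoords (φ : M ≃ₘ⟮𝓡 n, 𝓡 n⟯ EuclideanSpace ℝ (Fin n)) :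
    TangentBundle (𝓡 n) M ≃ₘ⟮(𝓡 n).tangent, 𝓘(ℝ, EuclideanSpace ℝ (Fin n) ×
      EuclideanSpace ℝ (Fin n))⟯ (EuclideanSpace ℝ (Fin n) × EuclideanSpace ℝ (Fin n)) where
  toFun z := (φ z.proj, mfderiv (𝓡 n) (𝓡 n) φ z.proj z.2)
  invFun q := ⟨φ.symm q.1, mfderiv (𝓡 n) (𝓡 n) φ.symm q.1 q.2⟩
  left_inv z := by
    change tangentMap (𝓡 n) (𝓡 n) φ.symm (tangentMap (𝓡 n) (𝓡 n) φ z) = z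
    have h : φ.symm ∘ φ = id := funext φ.symm_apply_apply
    rw [← tangentMap_comp_at z (φ.symm.mdifferentiable (by simp) _)
      (φ.mdifferentiable (by simp) _), h, tangentMap_id, id]
  right_inv q := by
    refine Prod.ext (φ.apply_symm_apply _) ?_
    change mfderiv (𝓡 n) (𝓡 n) φ (φ.symm q.1) (mfderiv (𝓡 n) (𝓡 n) φ.symm q.1 q.2) = q.2
    have h := mfderiv_comp q.1 (φ.mdifferentiable (by simp) _) (φ.symm.mdifferentiable (by simp) q.1)
    have h2 : φ ∘ φ.symm = id := funext φ.apply_symm_apply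
    rw [h2, mfderiv_id] at h
    exact (congrArg (fun T : E →L[ℝ] E => T q.2) h).symm
  contMDiff_toFun := by
    refine ContMDiff.prodMk_space (φ.contMDiff.comp (Bundle.contMDiff_proj _)) ?_
    exact (contMDiff_snd_tangentBundle_modelSpace E (𝓡 n)).comp
      (φ.contMDiff.contMDiff_tangentMap (m := ∞) (by simp))
  contMDiff_invFun :=
    (φ.symm.contMDiff.contMDiff_tangentMap (m := ∞) (by simp)).comp contMDiff_mk_tangentBundle

theorem tangentCoords_apply (φ : M ≃ₘ⟮𝓡 n, 𝓡 n⟯ E) (z : TangentBundle (𝓡 n) M) :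
    tangentCoords φ z = (φ z.proj, mfderiv (𝓡 n) (𝓡 n) φ z.proj z.2) := rfl

/-- The transition map from the preferred chart at `p` to the global coordinates. -/
def transitionMap (φ : M ≃ₘ⟮𝓡 n, 𝓡 n⟯ EuclideanSpace ℝ (Fin n)) (p : M) :
    EuclideanSpace ℝ (Fin n) → EuclideanSpace ℝ (Fin n) := φ ∘ (extChartAt (𝓡 n) p).symm

variable (φ : M ≃ₘ⟮𝓡 n, 𝓡 n⟯ EuclideanSpace ℝ (Fin n))

theorem contDiffOn_transitionMap (p : M) :
    ContDiffOn ℝ ∞ (transitionMap φ p) (extChartAt (𝓡 n) p).target :=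
  (φ.contMDiff.comp_contMDiffOn (contMDiffOn_extChartAt_symm p)).contDiffOn

theorem injective_fderiv_transitionMap (p : M) {x : E} (hx : x ∈ (extChartAt (𝓡 n) p).target) :
    Function.Injective (fderiv ℝ (transitionMap φ p) x) := by
  have hD := isOpen_extChartAt_target (I := 𝓡 n) p
  have h1 := ((contDiffOn_transitionMap φ p).contDiffAt (hD.mem_nhds hx)).differentiableAt (by simp)
  have hs : (extChartAt (𝓡 n) p).symm x ∈ (chartAt E p).source := by
    simpa using (extChartAt (𝓡 n) p).map_target hx
  have h2 : DifferentiableAt ℝ (extChartAt (𝓡 n) p ∘ φ.symm) (transitionMap φ p x) := by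
    rw [← mdifferentiableAt_iff_differentiableAt]
    refine MDifferentiableAt.comp (I' := 𝓡 n) _ ?_ (φ.symm.mdifferentiable (by simp) _)
    refine mdifferentiableAt_extChartAt ?_
    simpa [transitionMap] using hs
  have h3 : (extChartAt (𝓡 n) p ∘ φ.symm) ∘ transitionMap φ p =ᶠ[nhds x] id :=
    Filter.eventuallyEq_of_mem (hD.mem_nhds hx) fun x' hx' => by
      simpa [transitionMap] using (extChartAt (𝓡 n) p).right_inv hx'
  have h4 := (h2.hasFDerivAt.comp x h1.hasFDerivAt).unique ((hasFDerivAt_id x).congr_of_eventuallyEq h3)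
  intro u v huv
  have := congrArg (fderiv ℝ (extChartAt (𝓡 n) p ∘ φ.symm) (transitionMap φ p x)) huv
  rw [← ContinuousLinearMap.comp_apply, ← ContinuousLinearMap.comp_apply, h4] at this
  simpa using this

theorem surjective_fderiv_transitionMap (p : M) {x : E} (hx : x ∈ (extChartAt (𝓡 n) p).target) :
    Function.Surjective (fderiv ℝ (transitionMap φ p) x) :=
  LinearMap.injective_iff_surjective.1 (injective_fderiv_transitionMap φ p hx)

theorem extChartAt_tangent_apply (z w : TangentBundle (𝓡 n) M)
    (hw : w.proj ∈ (extChartAt (𝓡 n) z.proj).source) :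
    extChartAt (𝓡 n).tangent z w = (extChartAt (𝓡 n) z.proj w.proj,
      mfderiv (𝓡 n) 𝓘(ℝ, E) (extChartAt (𝓡 n) z.proj) w.proj w.2) := by
  rw [extChartAt_source] at hw
  have h1 := congrArg (fun T : TangentSpace (𝓡 n) w.proj →L[ℝ] E => T w.2)
    (TangentBundle.continuousLinearMapAt_trivializationAt (I := 𝓡 n) hw)
  have h2 : (trivializationAt E (TangentSpace (𝓡 n)) z.proj).continuousLinearMapAt ℝ w.proj w.2 =
      (trivializationAt E (TangentSpace (𝓡 n)) z.proj w).2 := by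
    rw [Bundle.Trivialization.continuousLinearMapAt_apply,
      Bundle.Trivialization.coe_linearMapAt_of_mem _ hw]
  rw [FiberBundle.extChartAt]
  exact Prod.ext rfl (h2.symm.trans h1)

/-- The chart of `TM` at `z` and the global coordinates differ by the tangent map of the transition
map on `M`; this is how naturality in coordinates is applied on the manifold. -/
theorem tangentCoords_eq_tangentLift (z w : TangentBundle (𝓡 n) M)
    (hw : w.proj ∈ (extChartAt (𝓡 n) z.proj).source) :
    tangentCoords φ w = tangentLift (transitionMap φ z.proj) (extChartAt (𝓡 n).tangent z w) := by
  have hx := (extChartAt (𝓡 n) z.proj).map_source hw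
  have hD := isOpen_extChartAt_target (I := 𝓡 n) z.proj
  have h1 := ((contDiffOn_transitionMap φ z.proj).contDiffAt (hD.mem_nhds hx)).differentiableAt
    (by simp)
  have h2 : φ =ᶠ[nhds w.proj] transitionMap φ z.proj ∘ extChartAt (𝓡 n) z.proj :=
    Filter.eventuallyEq_of_mem (extChartAt_source_mem_nhds' hw) fun q hq => by
      rw [transitionMap, Function.comp_apply, Function.comp_apply,
        (extChartAt (𝓡 n) z.proj).left_inv hq]
  have h3 : mfderiv (𝓡 n) (𝓡 n) φ w.proj = (fderiv ℝ (transitionMap φ z.proj)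
      (extChartAt (𝓡 n) z.proj w.proj)) ∘L mfderiv (𝓡 n) 𝓘(ℝ, E) (extChartAt (𝓡 n) z.proj) w.proj := by
    rw [h2.mfderiv_eq, ← mfderiv_eq_fderiv]
    exact mfderiv_comp _ h1.mdifferentiableAt (mdifferentiableAt_extChartAt (by simpa using hw))
  rw [extChartAt_tangent_apply z w hw, tangentCoords_apply, h3, h2.self_of_nhds]
  rfl

theorem tangentCoords_extChartAt_symm (z : TangentBundle (𝓡 n) M) {q : E × E}
    (hq : q.1 ∈ (extChartAt (𝓡 n) z.proj).target) :
    tangentCoords φ ((extChartAt (𝓡 n).tangent z).symm q) =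
      tangentLift (transitionMap φ z.proj) q := by
  have ht : q ∈ (extChartAt (𝓡 n).tangent z).target := by
    rw [FiberBundle.extChartAt_target]
    exact ⟨⟨hq, by simpa using (extChartAt (𝓡 n) z.proj).map_target hq⟩, mem_univ _⟩
  have hs := (extChartAt (𝓡 n).tangent z).map_target ht
  have hs' : ((extChartAt (𝓡 n).tangent z).symm q).proj ∈ (extChartAt (𝓡 n) z.proj).source := by
    rw [extChartAt_source] at hs ⊢
    exact (TangentBundle.mem_chart_source_iff _ _).1 hs
  rw [tangentCoords_eq_tangentLift φ z _ hs', (extChartAt (𝓡 n).tangent z).right_inv ht]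

end Manifold

end FinslerHol

namespace FinslerHol

/-! ### The Finsler function in global coordinates -/

section GlobalCoordinates

open scoped Topology

variable {n : ℕ}

local notation "E" => EuclideanSpace ℝ (Fin n)

/-- The inverse chart is meaningful only over its target, so Finsler functions can be compared only
there; the connection is local in the base, so this is enough. -/
theorem connVec_congr {D : Set E} (hD : IsOpen D) {L L' : E → E → ℝ}
    (h : ∀ x ∈ D, L x = L' x) {x : E} (hx : x ∈ D) (y a : E) :
    connVec L x y a = connVec L' x y a := by
  have h1 : ∀ x ∈ D, ∀ y, metricMatrix L x y = metricMatrix L' x y := fun x hx y => by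
    simp only [metricMatrix, h x hx]
  have h2 : ∀ k i j y, dMetric L k i j x y = dMetric L' k i j x y := fun k i j y =>
    Filter.EventuallyEq.lineDeriv_eq (Filter.eventuallyEq_of_mem (hD.mem_nhds hx) fun x' hx' => by
      simp only [h1 x' hx' y])
  have h3 : ∀ i y, sprayCoeff L i x y = sprayCoeff L' i x y := fun i y => by
    simp only [sprayCoeff, h1 x hx, h2]
  simp only [connVec, connCoeff, h3]

variable {M : Type*} [TopologicalSpace M] [ChartedSpace (EuclideanSpace ℝ (Fin n)) M]
  [IsManifold (𝓡 n) ∞ M] (φ : M ≃ₘ⟮𝓡 n, 𝓡 n⟯ EuclideanSpace ℝ (Fin n))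
  {F : TangentBundle (𝓡 n) M → ℝ}

/-- The Finsler function `F` in the global coordinates `φ`. -/
def globalFinsler (F : TangentBundle (𝓡 n) M → ℝ) (x y : EuclideanSpace ℝ (Fin n)) : ℝ :=
  F ((tangentCoords φ).symm (x, y))

theorem globalFinsler_tangentCoords (z : TangentBundle (𝓡 n) M) :
    globalFinsler φ F (tangentCoords φ z).1 (tangentCoords φ z).2 = F z := by
  rw [globalFinsler, Prod.mk.eta, Diffeomorph.symm_apply_apply]

/-- The derivative of `φ`. -/
def baseDeriv (p : M) : EuclideanSpace ℝ (Fin n) ≃L[ℝ] EuclideanSpace ℝ (Fin n) :=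
  φ.mfderivToContinuousLinearEquiv (by simp) p

/-- The derivative of `φ.symm`. -/
def baseDerivSymm (x : EuclideanSpace ℝ (Fin n)) :
    EuclideanSpace ℝ (Fin n) ≃L[ℝ] EuclideanSpace ℝ (Fin n) :=
  φ.symm.mfderivToContinuousLinearEquiv (by simp) x

theorem tangentCoords_eq (z : TangentBundle (𝓡 n) M) :
    tangentCoords φ z = (φ z.proj, baseDeriv φ z.proj z.2) := rfl

theorem tangentCoords_symm_apply (q : E × E) :
    (tangentCoords φ).symm q = ⟨φ.symm q.1, baseDerivSymm φ q.1 q.2⟩ := rfl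

theorem tangentCoords_snd_ne_zero {z : TangentBundle (𝓡 n) M} :
    (tangentCoords φ z).2 ≠ 0 ↔ z.2 ≠ 0 :=
  not_congr ((baseDeriv φ z.proj).map_eq_zero_iff)

theorem isFinslerOn_globalFinsler (hF : IsFinsler F) : IsFinslerOn univ (globalFinsler φ F) where
  isOpen := isOpen_univ
  smooth := by
    have h : ContMDiffOn 𝓘(ℝ, E × E) 𝓘(ℝ, ℝ) ∞ (F ∘ (tangentCoords φ).symm) (univ ×ˢ {0}ᶜ) :=
      hF.smooth.comp (tangentCoords φ).symm.contMDiff.contMDiffOn fun q hq => by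
        refine (tangentCoords_snd_ne_zero φ).1 ?_
        rw [Diffeomorph.apply_symm_apply]
        exact hq.2
    exact h.contDiffOn
  homogeneous x _ y a ha := by
    rw [globalFinsler, globalFinsler, tangentCoords_symm_apply, tangentCoords_symm_apply]
    simp only [map_smul]
    exact hF.homogeneous (φ.symm x) (baseDerivSymm φ x y) a ha
  posDef x _ y u hy hu := by
    have hne : ∀ y : E, y ≠ 0 → baseDerivSymm φ x y ≠ 0 := fun y =>
      mt ((baseDerivSymm φ x).map_eq_zero_iff).1
    refine (hF.posDef (φ.symm x) _ _ (hne y hy) (hne u hu)).trans_eq ?_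
    simp only [globalFinsler, tangentCoords_symm_apply, map_add, map_smul]
    rfl

theorem continuous_globalFinsler (hF : IsFinsler F) :
    Continuous fun q : E × E => globalFinsler φ F q.1 q.2 :=
  hF.continuous.comp (tangentCoords φ).symm.continuous

/-- The derivative of `tangentCoords`. -/
def tangentCoordsDeriv (z : TangentBundle (𝓡 n) M) :
    (EuclideanSpace ℝ (Fin n) × EuclideanSpace ℝ (Fin n)) ≃L[ℝ]
      (EuclideanSpace ℝ (Fin n) × EuclideanSpace ℝ (Fin n)) :=
  (tangentCoords φ).mfderivToContinuousLinearEquiv (by simp) z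

theorem extChartAt_tangent_self (z : TangentBundle (𝓡 n) M) :
    extChartAt (𝓡 n).tangent z z = (extChartAt (𝓡 n) z.proj z.proj, z.2) := by
  rw [extChartAt_tangent_apply z z (mem_extChartAt_source _), mfderiv_extChartAt_self]
  rfl

theorem tangentCoordsDeriv_apply (z : TangentBundle (𝓡 n) M) (w : E × E) :
    tangentCoordsDeriv φ z w =
      tangentLiftDeriv (transitionMap φ z.proj) (extChartAt (𝓡 n).tangent z z) w := by
  have hx : (extChartAt (𝓡 n).tangent z z).1 ∈ (extChartAt (𝓡 n) z.proj).target := by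
    rw [extChartAt_tangent_self]
    exact mem_extChartAt_target _
  have h1 := hasFDerivAt_tangentLift (isOpen_extChartAt_target (I := 𝓡 n) z.proj)
    (contDiffOn_transitionMap φ z.proj) hx
  have h2 : tangentCoords φ =ᶠ[𝓝 z]
      tangentLift (transitionMap φ z.proj) ∘ extChartAt (𝓡 n).tangent z :=
    Filter.eventuallyEq_of_mem (extChartAt_source_mem_nhds (I := (𝓡 n).tangent) z) fun w hw =>
      tangentCoords_eq_tangentLift φ z w (by
        rw [extChartAt_source] at hw ⊢
        exact (TangentBundle.mem_chart_source_iff _ _).1 hw)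
  have h3 := (h1.hasMFDerivAt.comp z
    (mdifferentiableAt_extChartAt (I := (𝓡 n).tangent) (mem_chart_source _ z)).hasMFDerivAt)
  rw [mfderiv_extChartAt_self] at h3
  have h4 := (h3.congr_of_eventuallyEq h2).mfderiv
  exact congrArg (fun T : E × E →L[ℝ] E × E => T w) h4

theorem baseDeriv_apply (p : M) (a : E) : baseDeriv φ p a =
    fderiv ℝ (transitionMap φ p) (extChartAt (𝓡 n) p p) a := by
  have h := congrArg Prod.snd (tangentCoords_eq_tangentLift φ ⟨p, a⟩ ⟨p, a⟩ (mem_extChartAt_source _))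
  rw [extChartAt_tangent_self] at h
  exact h

theorem tangentCoordsDeriv_fst (z : TangentBundle (𝓡 n) M) (w : E × E) :
    (tangentCoordsDeriv φ z w).1 = baseDeriv φ z.proj w.1 := by
  rw [baseDeriv_apply, tangentCoordsDeriv_apply, tangentLiftDeriv_apply,
    extChartAt_tangent_self]

theorem connAt_eq_pullback (z : TangentBundle (𝓡 n) M) (a : E) : connAt F z a =
    connVec (pullbackFinsler (transitionMap φ z.proj) (globalFinsler φ F))
      (extChartAt (𝓡 n) z.proj z.proj) z.2 a := by
  rw [connAt, extChartAt_tangent_self]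
  refine connVec_congr (isOpen_extChartAt_target (I := 𝓡 n) z.proj) (fun x hx => ?_)
    (mem_extChartAt_target _) _ _
  funext y
  have h := tangentCoords_extChartAt_symm φ z (q := (x, y)) hx
  rw [pullbackFinsler, ← globalFinsler_tangentCoords φ (F := F), h]
  rfl

theorem tangentCoordsDeriv_horLift (hF : IsFinsler F) {z : TangentBundle (𝓡 n) M} (hz : z.2 ≠ 0)
    (a : E) : tangentCoordsDeriv φ z (a, -connAt F z a) =
      (baseDeriv φ z.proj a, -connVec (globalFinsler φ F) (tangentCoords φ z).1
        (tangentCoords φ z).2 (baseDeriv φ z.proj a)) := by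
  have hD := isOpen_extChartAt_target (I := 𝓡 n) z.proj
  have hx := mem_extChartAt_target (I := 𝓡 n) z.proj
  have h3 : ∀ y : E, y ≠ 0 → tangentLiftDeriv (transitionMap φ z.proj)
      (extChartAt (𝓡 n) z.proj z.proj, y) (a, -connVec (pullbackFinsler (transitionMap φ z.proj)
        (globalFinsler φ F)) (extChartAt (𝓡 n) z.proj z.proj) y a) =
      (baseDeriv φ z.proj a, -connVec (globalFinsler φ F) (φ z.proj) (baseDeriv φ z.proj y)
        (baseDeriv φ z.proj a)) := fun y hy => by
    rw [tangentLiftDeriv_horizontal (isFinslerOn_globalFinsler φ hF) hD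
      (contDiffOn_transitionMap φ z.proj) (fun x hx => injective_fderiv_transitionMap φ z.proj hx)
      (fun x hx => surjective_fderiv_transitionMap φ z.proj hx) hx hy a]
    rw [← baseDeriv_apply, ← baseDeriv_apply, transitionMap, Function.comp_apply,
      extChartAt_to_inv]
  rw [tangentCoordsDeriv_apply, connAt_eq_pullback φ, extChartAt_tangent_self]
  exact h3 z.2 hz

/-- The vertical projection is the vector minus the horizontal lift of its base part, so its
naturality follows from that of the lift. -/
theorem tangentCoordsDeriv_vertProj (hF : IsFinsler F) {z : TangentBundle (𝓡 n) M} (hz : z.2 ≠ 0)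
    (w : E × E) : tangentCoordsDeriv φ z (0, w.2 + connAt F z w.1) =
      (0, (tangentCoordsDeriv φ z w).2 + connVec (globalFinsler φ F) (tangentCoords φ z).1
        (tangentCoords φ z).2 (tangentCoordsDeriv φ z w).1) := by
  have h1 : ((0, w.2 + connAt F z w.1) : E × E) = w - (w.1, -connAt F z w.1) := by
    ext1 <;> simp
  rw [h1, map_sub, tangentCoordsDeriv_horLift φ hF hz, ← tangentCoordsDeriv_fst]
  ext1 <;> simp

end GlobalCoordinates

end FinslerHol

namespace FinslerHol

/-! ### Brackets of vector fields on a subset -/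

section Brackets

open scoped Topology

variable {B H N : Type*} [NormedAddCommGroup B] [NormedSpace ℝ B] [TopologicalSpace H]
  {I : ModelWithCorners ℝ B H} [TopologicalSpace N] [ChartedSpace H N]

/-- Derivatives within a set are unique on its tangent cone. A level set such as `IM` has no unique
differentiability in the ambient space, so `fderivWithin` is controlled only in these directions. -/
theorem fderivWithin_eq_fderiv_of_mem_tangentCone {f : B → B} {s : Set B} {x v : B}
    (hf : DifferentiableAt ℝ f x) (hv : v ∈ tangentConeAt ℝ s x) :
    fderivWithin ℝ f s x v = fderiv ℝ f x v :=
  hf.differentiableWithinAt.hasFDerivWithinAt.unique_on hf.hasFDerivAt.hasFDerivWithinAt hv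

/-- The differential of the preferred chart at its centre is the identity, under the identification
of the tangent space with the model space. -/
theorem mpullbackWithin_extChartAt_symm_self [IsManifold I 1 N] (V : ∀ x : N, TangentSpace I x)
    (z : N) :
    (VectorField.mpullbackWithin 𝓘(ℝ, B) I (extChartAt I z).symm V (range I)
      (extChartAt I z z) : B) = (V z : B) := by
  have h : ∀ (T : B →L[ℝ] B) (v w : B), T = .id ℝ B → v = w → T.inverse v = w := by
    rintro _ _ _ rfl rfl
    rw [ContinuousLinearMap.inverse_id]
    rfl
  exact h _ _ _ mfderivWithin_range_extChartAt_symm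
    (congrArg (fun p => (V p : B)) (extChartAt_to_inv z))

theorem lieBracketWithin_eq_lieBracket_of_mem_tangentCone {V W : B → B} {s : Set B} {x : B}
    (hV : DifferentiableAt ℝ V x) (hW : DifferentiableAt ℝ W x) (hV' : V x ∈ tangentConeAt ℝ s x)
    (hW' : W x ∈ tangentConeAt ℝ s x) :
    VectorField.lieBracketWithin ℝ V W s x = VectorField.lieBracket ℝ V W x := by
  simp only [VectorField.lieBracketWithin, VectorField.lieBracket]
  rw [fderivWithin_eq_fderiv_of_mem_tangentCone hV hW',
    fderivWithin_eq_fderiv_of_mem_tangentCone hW hV']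

theorem mlieBracketWithin_eq_mlieBracket_of_mem_tangentCone [I.Boundaryless] [CompleteSpace B]
    [IsManifold I 2 N] {V W : ∀ x : N, TangentSpace I x} {S : Set N} {z : N}
    (hV : MDifferentiableAt I I.tangent (fun x => (⟨x, V x⟩ : TangentBundle I N)) z)
    (hW : MDifferentiableAt I I.tangent (fun x => (⟨x, W x⟩ : TangentBundle I N)) z)
    (hV' : (V z : B) ∈
      tangentConeAt ℝ ((extChartAt I z).symm ⁻¹' S ∩ range I) (extChartAt I z z))
    (hW' : (W z : B) ∈
      tangentConeAt ℝ ((extChartAt I z).symm ⁻¹' S ∩ range I) (extChartAt I z z)) :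
    VectorField.mlieBracketWithin I V W S z = VectorField.mlieBracket I V W z := by
  have : IsManifold I 1 N := IsManifold.of_le (n := 2) (by norm_num)
  have hd : ∀ {V : ∀ x : N, TangentSpace I x},
      MDifferentiableAt I I.tangent (fun x => (⟨x, V x⟩ : TangentBundle I N)) z →
      DifferentiableAt ℝ (VectorField.mpullbackWithin 𝓘(ℝ, B) I (extChartAt I z).symm V (range I))
        (extChartAt I z z) := fun h => by
    have := (mdifferentiableWithinAt_univ.2
      h).differentiableWithinAt_mpullbackWithin_vectorField
    rw [I.range_eq_univ] at this ⊢
    rw [preimage_univ, univ_inter] at this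
    exact differentiableWithinAt_univ.1 this
  rw [← VectorField.mlieBracketWithin_univ, VectorField.mlieBracketWithin_apply,
    VectorField.mlieBracketWithin_apply, lieBracketWithin_eq_lieBracket_of_mem_tangentCone
      (hd hV) (hd hW) (by rwa [mpullbackWithin_extChartAt_symm_self])
      (by rwa [mpullbackWithin_extChartAt_symm_self]), preimage_univ, univ_inter]
  congr 2
  rw [I.range_eq_univ]
  exact (congrFun (VectorField.lieBracketWithin_univ (𝕜 := ℝ) (E := B)) _).symm

end Brackets

/-! ### Vector fields on the tangent bundle and their coordinate expressions -/

section Related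

open scoped Topology

variable {n : ℕ} {M : Type*} [TopologicalSpace M] [ChartedSpace (EuclideanSpace ℝ (Fin n)) M]
  [IsManifold (𝓡 n) ∞ M]

local notation "E" => EuclideanSpace ℝ (Fin n)

variable (φ : M ≃ₘ⟮𝓡 n, 𝓡 n⟯ EuclideanSpace ℝ (Fin n))

/-- The vector field on `TM` with coordinate expression `ξ`. -/
def fieldOfCoords (ξ : EuclideanSpace ℝ (Fin n) × EuclideanSpace ℝ (Fin n) →
    EuclideanSpace ℝ (Fin n) × EuclideanSpace ℝ (Fin n)) (z : TangentBundle (𝓡 n) M) :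
    TangentSpace (𝓡 n).tangent z :=
  (tangentCoordsDeriv φ z).symm (ξ (tangentCoords φ z))

theorem fieldOfCoords_eq_mpullback (ξ : E × E → E × E) : fieldOfCoords φ ξ =
    VectorField.mpullback (𝓡 n).tangent 𝓘(ℝ, E × E) (tangentCoords φ) ξ := by
  funext z
  exact (congrArg (fun T : (E × E) →L[ℝ] (E × E) => T (ξ (tangentCoords φ z)))
    (ContinuousLinearMap.inverse_equiv (tangentCoordsDeriv φ z))).symm

theorem isInvertible_mfderiv_tangentCoords (z : TangentBundle (𝓡 n) M) :
    (mfderiv (𝓡 n).tangent 𝓘(ℝ, E × E) (tangentCoords φ) z).IsInvertible :=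
  ⟨(tangentCoords φ).mfderivToContinuousLinearEquiv (by simp) z, rfl⟩

theorem contMDiffAt_fieldOfCoords {ξ : E × E → E × E} {z : TangentBundle (𝓡 n) M}
    (hξ : ContDiffAt ℝ ∞ ξ (tangentCoords φ z)) : ContMDiffAt (𝓡 n).tangent (𝓡 n).tangent.tangent ∞
    (fun w => (⟨w, fieldOfCoords φ ξ w⟩ : TangentBundle (𝓡 n).tangent (TangentBundle (𝓡 n) M))) z := by
  rw [fieldOfCoords_eq_mpullback]
  exact ContMDiffAt.mpullback_vectorField_preimage (n := ∞)
    (contMDiffAt_vectorSpace_iff_contDiffAt.2 hξ) ((tangentCoords φ).contMDiff z)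
    (isInvertible_mfderiv_tangentCoords φ z) (by simp)

theorem tangentCoordsDeriv_mlieBracket {ξ η : E × E → E × E} {z : TangentBundle (𝓡 n) M}
    (hξ : ContDiffAt ℝ ∞ ξ (tangentCoords φ z)) (hη : ContDiffAt ℝ ∞ η (tangentCoords φ z)) :
    tangentCoordsDeriv φ z (VectorField.mlieBracket (𝓡 n).tangent (fieldOfCoords φ ξ)
      (fieldOfCoords φ η) z) = VectorField.lieBracket ℝ ξ η (tangentCoords φ z) := by
  have hm : IsManifold (𝓡 n).tangent (minSmoothness ℝ 2) (TangentBundle (𝓡 n) M) := by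
    rw [minSmoothness_of_isRCLikeNormedField]; infer_instance
  have hm' : IsManifold 𝓘(ℝ, E × E) (minSmoothness ℝ 2) (E × E) := inferInstance
  have h := VectorField.mpullback_mlieBracket (n := ∞) (x₀ := z)
    ((contMDiffAt_vectorSpace_iff_contDiffAt.2 hξ).mdifferentiableAt (by simp))
    ((contMDiffAt_vectorSpace_iff_contDiffAt.2 hη).mdifferentiableAt (by simp))
    ((tangentCoords φ).contMDiff z) (by
      rw [minSmoothness_of_isRCLikeNormedField]
      exact (mod_cast le_top : ((2 : ℕ∞) : WithTop ℕ∞) ≤ ∞))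
  rw [← fieldOfCoords_eq_mpullback, ← fieldOfCoords_eq_mpullback] at h
  have h1 : VectorField.mlieBracket 𝓘(ℝ, E × E) ξ η = VectorField.lieBracket ℝ ξ η :=
    (VectorField.mlieBracketWithin_eq_lieBracketWithin (s := univ)).trans
      VectorField.lieBracketWithin_univ
  have h2 := congrFun (fieldOfCoords_eq_mpullback φ (VectorField.lieBracket ℝ ξ η)) z
  rw [← h, h1, ← h2]
  exact (tangentCoordsDeriv φ z).apply_symm_apply _

/-- The coordinate expressions give smooth ambient extensions. Since both fields are tangent to `S`
at the point, the bracket along `S` is the ambient bracket, which is natural under diffeomorphisms.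
-/
theorem tangentCoordsDeriv_bracketOn {S : Set (TangentBundle (𝓡 n) M)}
    {ξ η : FieldOn (𝓡 n).tangent S} {ξ' η' : E × E → E × E} (z : S)
    (hξ : ∀ w : S, tangentCoordsDeriv φ w (ξ w) = ξ' (tangentCoords φ w))
    (hη : ∀ w : S, tangentCoordsDeriv φ w (η w) = η' (tangentCoords φ w))
    (hξ' : ContDiffAt ℝ ∞ ξ' (tangentCoords φ z)) (hη' : ContDiffAt ℝ ∞ η' (tangentCoords φ z))
    (hξt : (ξ z : E × E) ∈ tangentConeAt ℝ ((extChartAt (𝓡 n).tangent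
      (z : TangentBundle (𝓡 n) M)).symm ⁻¹' S ∩ range (𝓡 n).tangent)
        (extChartAt (𝓡 n).tangent (z : TangentBundle (𝓡 n) M) z))
    (hηt : (η z : E × E) ∈ tangentConeAt ℝ ((extChartAt (𝓡 n).tangent
      (z : TangentBundle (𝓡 n) M)).symm ⁻¹' S ∩ range (𝓡 n).tangent)
        (extChartAt (𝓡 n).tangent (z : TangentBundle (𝓡 n) M) z)) :
    tangentCoordsDeriv φ z (bracketOn (𝓡 n).tangent ξ η z) =
      VectorField.lieBracket ℝ ξ' η' (tangentCoords φ z) := by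
  have he : ∀ {ξ : FieldOn (𝓡 n).tangent S} {ξ' : E × E → E × E},
      (∀ w : S, tangentCoordsDeriv φ w (ξ w) = ξ' (tangentCoords φ w)) → ∀ w : S,
      (ξ w : E × E) = fieldOfCoords φ ξ' w := fun h w => by
    rw [fieldOfCoords, ← h]
    exact ((tangentCoordsDeriv φ w).symm_apply_apply _).symm
  have he' : ∀ {ξ : FieldOn (𝓡 n).tangent S} {ξ' : E × E → E × E},
      (∀ w : S, tangentCoordsDeriv φ w (ξ w) = ξ' (tangentCoords φ w)) →
      EqOn (extendField (𝓡 n).tangent ξ) (fieldOfCoords φ ξ') S := fun h w hw => by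
    rw [extendField, dif_pos hw]
    exact he h ⟨w, hw⟩
  rw [← tangentCoordsDeriv_mlieBracket φ hξ' hη', bracketOn,
    VectorField.mlieBracketWithin_congr' (he' hξ) (he' hη) z.2,
    mlieBracketWithin_eq_mlieBracket_of_mem_tangentCone
      ((contMDiffAt_fieldOfCoords φ hξ').mdifferentiableAt (by simp))
      ((contMDiffAt_fieldOfCoords φ hη').mdifferentiableAt (by simp))
      (by rwa [he hξ] at hξt) (by rwa [he hη] at hηt)]

end Related

end FinslerHol

namespace FinslerHol

/-! ### The curvature vector field in global coordinates -/

section CurvatureCoordinates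

open scoped Topology

variable {n : ℕ}

local notation "E" => EuclideanSpace ℝ (Fin n)

/-- The horizontal lift of the vector field `X` in coordinates. -/
def horField (L : EuclideanSpace ℝ (Fin n) → EuclideanSpace ℝ (Fin n) → ℝ)
    (X : EuclideanSpace ℝ (Fin n) → EuclideanSpace ℝ (Fin n))
    (q : EuclideanSpace ℝ (Fin n) × EuclideanSpace ℝ (Fin n)) :
    EuclideanSpace ℝ (Fin n) × EuclideanSpace ℝ (Fin n) :=
  (X q.1, -connVec L q.1 q.2 (X q.1))

section

variable {L : EuclideanSpace ℝ (Fin n) → EuclideanSpace ℝ (Fin n) → ℝ}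
  (hL : IsFinslerOn univ L)

include hL

theorem contDiffOn_horField {X : E → E} (hX : ContDiff ℝ ∞ X) :
    ContDiffOn ℝ ∞ (horField L X) (univ ×ˢ {0}ᶜ) := by
  have h1 : ContDiffOn ℝ ∞ (fun q : E × E => connVec L q.1 q.2 (X q.1)) (univ ×ˢ {0}ᶜ) :=
    hL.contDiffOn_connVec.comp (f := fun q : E × E => (q, X q.1)) (by fun_prop)
      fun q hq => ⟨hq, mem_univ _⟩
  exact ContDiffOn.prodMk (by fun_prop) h1.neg

theorem hasFDerivAt_connVec {X : E → E} (hX : ContDiff ℝ ∞ X) {q : E × E} (hq : q.2 ≠ 0) :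
    HasFDerivAt (fun q : E × E => connVec L q.1 q.2 (X q.1))
      (((fderiv ℝ (fderiv ℝ (sprayVec L)) q).flip (0, X q.1)) +
        fderiv ℝ (sprayVec L) q ∘L ContinuousLinearMap.inr ℝ E E ∘L fderiv ℝ X q.1 ∘L
          ContinuousLinearMap.fst ℝ E E) q := by
  have hq' : q ∈ (univ : Set E) ×ˢ ({0}ᶜ : Set E) := ⟨mem_univ _, hq⟩
  have h1 : HasFDerivAt (fderiv ℝ (sprayVec L)) (fderiv ℝ (fderiv ℝ (sprayVec L)) q) q :=
    (((hL.contDiffOn_sprayVec.fderiv_of_isOpen hL.isOpen_slit (m := ∞) (by simp)).contDiffAt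
      (hL.isOpen_slit.mem_nhds hq')).differentiableAt (by simp)).hasFDerivAt
  have h2 : HasFDerivAt (fun q : E × E => X q.1)
      (fderiv ℝ X q.1 ∘L ContinuousLinearMap.fst ℝ E E) q :=
    ((hX.differentiable (by simp)) q.1).hasFDerivAt.comp q hasFDerivAt_fst
  have h3 := (h1.clm_apply ((hasFDerivAt_const (0 : E) q).prodMk h2)).congr_of_eventuallyEq
    (Filter.eventuallyEq_of_mem (hL.isOpen_slit.mem_nhds hq') fun q hq =>
      hL.connVec_eq (x := q.1) (y := q.2) hq.1 hq.2 (X q.1))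
  refine h3.congr_fderiv ?_
  ext v <;> simp [add_comm]

theorem fderiv_horField {X : E → E} (hX : ContDiff ℝ ∞ X) {q : E × E} (hq : q.2 ≠ 0) (w : E × E) :
    fderiv ℝ (horField L X) q w = (fderiv ℝ X q.1 w.1,
      -(fderiv ℝ (fun q' : E × E => connVec L q'.1 q'.2 (X q.1)) q w +
        connVec L q.1 q.2 (fderiv ℝ X q.1 w.1))) := by
  have h1 : HasFDerivAt (fun q : E × E => X q.1)
      (fderiv ℝ X q.1 ∘L ContinuousLinearMap.fst ℝ E E) q :=
    ((hX.differentiable (by simp)) q.1).hasFDerivAt.comp q hasFDerivAt_fst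
  have h2 : HasFDerivAt (horField L X) _ q := h1.prodMk (hasFDerivAt_connVec hL hX hq).neg
  have h3 := hasFDerivAt_connVec hL (contDiff_const (c := X q.1)) hq
  rw [h2.fderiv, h3.fderiv, hL.connVec_eq (mem_univ _) hq]
  simp

/-- The vertical part of the bracket of two horizontal lifts. -/
theorem lieBracket_horField {X Y : E → E} (hX : ContDiff ℝ ∞ X) (hY : ContDiff ℝ ∞ Y) {q : E × E}
    (hq : q.2 ≠ 0) : (VectorField.lieBracket ℝ (horField L X) (horField L Y) q).2 +
      connVec L q.1 q.2 (VectorField.lieBracket ℝ (horField L X) (horField L Y) q).1 =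
      curv L q (X q.1) (Y q.1) := by
  rw [VectorField.lieBracket_eq]
  simp only [fderiv_horField hL hX hq, fderiv_horField hL hY hq]
  -- The derivatives of `X` and `Y` enter the fibre component through the connection applied to the
  -- base bracket; the vertical projection cancels exactly these terms.
  have h : ∀ a b : E, connVec L q.1 q.2 (a - b) = connVec L q.1 q.2 a - connVec L q.1 q.2 b :=
    fun a b => by
      rw [eq_sub_iff_add_eq, ← hL.connVec_add (mem_univ _) hq, sub_add_cancel]
  rw [Prod.fst_sub, Prod.snd_sub]
  simp only [h, curv, horField]
  abel

end

variable {M : Type*} [TopologicalSpace M] [ChartedSpace (EuclideanSpace ℝ (Fin n)) M]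
  [IsManifold (𝓡 n) ∞ M] (φ : M ≃ₘ⟮𝓡 n, 𝓡 n⟯ EuclideanSpace ℝ (Fin n))
  {F : TangentBundle (𝓡 n) M → ℝ}

/-- The coordinate expression of a vector field on `M`. -/
def baseField (X : ∀ p : M, TangentSpace (𝓡 n) p) (x : EuclideanSpace ℝ (Fin n)) :
    EuclideanSpace ℝ (Fin n) := baseDeriv φ (φ.symm x) (X (φ.symm x))

omit [IsManifold (𝓡 n) ∞ M] in
theorem baseField_apply (X : ∀ p : M, TangentSpace (𝓡 n) p) (p : M) :
    baseField φ X (φ p) = baseDeriv φ p (X p) := by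
  have h : ∀ q, q = p → baseDeriv φ q (X q) = baseDeriv φ p (X p) := by rintro _ rfl; rfl
  exact h _ (φ.symm_apply_apply p)

theorem contDiff_baseField {X : ∀ p : M, TangentSpace (𝓡 n) p} (hX : IsSmoothVectorField X) :
    ContDiff ℝ ∞ (baseField φ X) := by
  have h : ContMDiff (𝓡 n) 𝓘(ℝ, E × E) ∞
      (fun x : E => tangentCoords φ ⟨φ.symm x, X (φ.symm x)⟩) :=
    (tangentCoords φ).contMDiff.comp (hX.comp φ.symm.contMDiff)
  exact contDiff_snd.comp h.contDiff

theorem snd_ne_zero_of_finsler_eq_one (hF : IsFinsler F) {z : TangentBundle (𝓡 n) M}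
    (hz : F z = 1) : z.2 ≠ 0 := by
  intro h
  have h1 := hF.homogeneous z.proj z.2 2 two_pos
  rw [h, smul_zero, ← h] at h1
  change F z = 2 * F z at h1
  linarith

theorem eventuallyEq_horLift (hF : IsFinsler F) (X : ∀ p : M, TangentSpace (𝓡 n) p)
    {z : TangentBundle (𝓡 n) M} (hz : z.2 ≠ 0) :
    (fun w : TangentBundle (𝓡 n) M => horLift F w (X w.proj)) =ᶠ[𝓝 z]
      fieldOfCoords φ (horField (globalFinsler φ F) (baseField φ X)) := by
  have hO : IsOpen {w : TangentBundle (𝓡 n) M | w.2 ≠ 0} := by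
    have h : {w : TangentBundle (𝓡 n) M | w.2 ≠ 0} =
        tangentCoords φ ⁻¹' ((univ : Set E) ×ˢ ({0}ᶜ : Set E)) := by
      ext w
      simp only [mem_ofPred_eq, ← tangentCoords_snd_ne_zero φ (z := w)]
      simp
    rw [h]
    exact (isOpen_univ.prod isOpen_compl_singleton).preimage (tangentCoords φ).continuous
  refine Filter.eventuallyEq_of_mem (hO.mem_nhds hz) fun w hw => ?_
  refine ((tangentCoordsDeriv φ w).symm_apply_eq.2 ?_).symm
  refine Eq.trans ?_ (tangentCoordsDeriv_horLift φ hF hw (X w.proj)).symm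
  rw [horField, tangentCoords_eq, baseField_apply]

theorem tangentCoordsDeriv_curvatureField (hF : IsFinsler F) {X Y : ∀ p : M, TangentSpace (𝓡 n) p}
    (hX : IsSmoothVectorField X) (hY : IsSmoothVectorField Y) (z : indicatrixBundle F) :
    tangentCoordsDeriv φ z (curvatureField F X Y z) =
      (0, curv (globalFinsler φ F) (tangentCoords φ z)
        (baseField φ X (tangentCoords φ z).1) (baseField φ Y (tangentCoords φ z).1)) := by
  have hz := snd_ne_zero_of_finsler_eq_one hF z.2
  have hL := isFinslerOn_globalFinsler φ hF
  have hz' : tangentCoords φ z ∈ (univ : Set E) ×ˢ ({0}ᶜ : Set E) :=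
    ⟨mem_univ _, (tangentCoords_snd_ne_zero φ).2 hz⟩
  have hs : ∀ {X : ∀ p : M, TangentSpace (𝓡 n) p}, IsSmoothVectorField X →
      ContDiffAt ℝ ∞ (horField (globalFinsler φ F) (baseField φ X)) (tangentCoords φ z) :=
    fun h => (contDiffOn_horField hL (contDiff_baseField φ h)).contDiffAt
      (hL.isOpen_slit.mem_nhds hz')
  refine (tangentCoordsDeriv_vertProj φ hF hz _).trans ?_
  rw [(eventuallyEq_horLift φ hF X hz).mlieBracket_vectorField_eq (eventuallyEq_horLift φ hF Y hz),
    tangentCoordsDeriv_mlieBracket φ (hs hX) (hs hY),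
    lieBracket_horField hL (contDiff_baseField φ hX) (contDiff_baseField φ hY) hz'.2]

end CurvatureCoordinates

end FinslerHol

namespace FinslerHol

/-! ### Parallel translation in global coordinates -/

section ParallelTranslation

open scoped Topology

variable {n : ℕ} {M : Type*} [TopologicalSpace M] [ChartedSpace (EuclideanSpace ℝ (Fin n)) M]
  [IsManifold (𝓡 n) ∞ M] (φ : M ≃ₘ⟮𝓡 n, 𝓡 n⟯ EuclideanSpace ℝ (Fin n))
  {F : TangentBundle (𝓡 n) M → ℝ}

local notation "E" => EuclideanSpace ℝ (Fin n)

theorem contDiffAt_extChartAt_tangentCoords_symm (z : TangentBundle (𝓡 n) M) :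
    ContDiffAt ℝ ∞ (fun q : E × E => extChartAt (𝓡 n).tangent z ((tangentCoords φ).symm q))
      (tangentCoords φ z) := by
  have h1 : ContMDiffAt (𝓡 n).tangent 𝓘(ℝ, E × E) ∞ (extChartAt (𝓡 n).tangent z)
      ((tangentCoords φ).symm (tangentCoords φ z)) := by
    rw [Diffeomorph.symm_apply_apply]
    exact contMDiffAt_extChartAt
  exact (ContMDiffAt.comp (tangentCoords φ z) h1
    ((tangentCoords φ).symm.contMDiff (tangentCoords φ z))).contDiffAt

/-- Composed with the global coordinates this map is the chart at `z`, whose differential at `z` is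
the identity. Velocities read in that chart are thus computed from global coordinates. -/
theorem hasFDerivAt_extChartAt_tangentCoords_symm (z : TangentBundle (𝓡 n) M) :
    HasFDerivAt (fun q : E × E => extChartAt (𝓡 n).tangent z ((tangentCoords φ).symm q))
      ((tangentCoordsDeriv φ z).symm : (E × E) →L[ℝ] (E × E)) (tangentCoords φ z) := by
  have h1 := ((contDiffAt_extChartAt_tangentCoords_symm φ z).differentiableAt
    (by simp)).hasFDerivAt
  refine h1.congr_fderiv ?_
  have h2 : HasMFDerivAt (𝓡 n).tangent 𝓘(ℝ, E × E) (tangentCoords φ) z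
      (tangentCoordsDeriv φ z : (E × E) →L[ℝ] (E × E)) :=
    ((tangentCoords φ).mdifferentiable (by simp) z).hasMFDerivAt
  have h3 := (h1.hasMFDerivAt.comp z h2).mfderiv
  have h4 : (fun q : E × E => extChartAt (𝓡 n).tangent z ((tangentCoords φ).symm q)) ∘
      tangentCoords φ = extChartAt (𝓡 n).tangent z := by
    funext w
    simp only [Function.comp_apply, Diffeomorph.symm_apply_apply]
  rw [h4, mfderiv_extChartAt_self] at h3
  refine ContinuousLinearMap.ext fun w => ?_
  have h5 := congrArg (fun T : (E × E) →L[ℝ] (E × E) => T ((tangentCoordsDeriv φ z).symm w)) h3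
  refine Eq.trans ?_ h5.symm
  exact congrArg _ ((tangentCoordsDeriv φ z).apply_symm_apply w).symm

theorem isParallelField_of_isTransport (hF : IsFinsler F) {x u : E} {Y : ℝ → E}
    (hY : IsTransport (globalFinsler φ F) x u Y) :
    IsParallelField F (fun r => φ.symm (x + r • u))
      (fun r => (tangentCoords φ).symm (x + r • u, Y r)) where
  smooth_curve := by
    have h : ContDiff ℝ ∞ fun r : ℝ => x + r • u := by fun_prop
    exact (φ.symm.contMDiff.comp h.contMDiff).contMDiffOn
  continuousOn := (tangentCoords φ).symm.continuous.comp_continuousOn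
    (ContinuousOn.prodMk (by fun_prop) fun t ht => (hY t ht).2.continuousAt.continuousWithinAt)
  proj_eq t _ := rfl
  horizontal t ht := by
    set z := (tangentCoords φ).symm (x + t • u, Y t) with hz
    have hz' : tangentCoords φ z = (x + t • u, Y t) := (tangentCoords φ).apply_symm_apply _
    have hne : z.2 ≠ 0 := (tangentCoords_snd_ne_zero φ).1 (by rw [hz']; exact (hY t ht).1)
    refine ⟨(baseDeriv φ z.proj).symm u, ?_⟩
    have h1 : HasDerivAt (fun s => (x + s • u, Y s))
        (u, -connVec (globalFinsler φ F) (x + t • u) (Y t) u) t := by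
      simpa using (((hasDerivAt_id' t).smul_const u).const_add x).prodMk (hY t ht).2
    have h2 := hasFDerivAt_extChartAt_tangentCoords_symm φ z
    rw [hz'] at h2
    refine ((h2.comp_hasDerivAt t h1).congr_deriv ?_).hasDerivWithinAt
    refine ((tangentCoordsDeriv φ z).symm_apply_eq.2 ?_)
    refine Eq.trans ?_ (tangentCoordsDeriv_horLift φ hF hne ((baseDeriv φ z.proj).symm u)).symm
    rw [ContinuousLinearEquiv.apply_symm_apply, hz']

theorem exists_isParallelField (hF : IsFinsler F) {x y : E} (hy : y ≠ 0) (u : E) {c : ℝ → M}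
    (hc : ∀ r, c r = φ.symm (x + r • u)) :
    ∃ V, IsParallelField F c V ∧ V 0 = (tangentCoords φ).symm (x, y) ∧
      V 1 = (tangentCoords φ).symm (x + u, transport (globalFinsler φ F) x y u) := by
  obtain rfl : c = fun r => φ.symm (x + r • u) := funext hc
  have hL := isFinslerOn_globalFinsler φ hF
  have hc := continuous_globalFinsler φ hF
  obtain ⟨Y, hY, rfl⟩ := exists_isTransport hL hc hy (x := x) (u := u)
  refine ⟨_, isParallelField_of_isTransport φ hF hY, ?_, ?_⟩
  · simp
  · simp [hY.apply_one hL hc]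

theorem parallelTranslates_parallelogram (hF : IsFinsler F) {x y : E} (hy : y ≠ 0) {p : M}
    (hp : φ p = x) (u w : E) :
    ParallelTranslates F (parallelogram φ p u w) ((tangentCoords φ).symm (x, y))
      ((tangentCoords φ).symm (x, transport (globalFinsler φ F) (x + w)
        (transport (globalFinsler φ F) (x + u + w) (transport (globalFinsler φ F) (x + u)
          (transport (globalFinsler φ F) x y u) w) (-u)) (-w))) := by
  subst hp
  have hL := isFinslerOn_globalFinsler φ hF
  have hc := continuous_globalFinsler φ hF
  have h1 := transport_ne_zero hL hc hy (x := φ p) (u := u)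
  have h2 := transport_ne_zero hL hc h1 (x := φ p + u) (u := w)
  have h3 := transport_ne_zero hL hc h2 (x := φ p + u + w) (u := -u)
  obtain ⟨V₁, hV₁, hV₁0, hV₁1⟩ := exists_isParallelField φ hF hy u (x := φ p)
    (c := fun r => φ.symm (φ p + r • u)) fun r => rfl
  obtain ⟨V₂, hV₂, hV₂0, hV₂1⟩ := exists_isParallelField φ hF h1 w (x := φ p + u)
    (c := fun r => φ.symm (φ p + u + r • w)) fun r => rfl
  obtain ⟨V₃, hV₃, hV₃0, hV₃1⟩ := exists_isParallelField φ hF h2 (-u) (x := φ p + u + w)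
    (c := fun r => φ.symm (φ p + (1 - r) • u + w)) fun r => by
      congr 1
      rw [sub_smul, one_smul, smul_neg]
      abel
  obtain ⟨V₄, hV₄, hV₄0, hV₄1⟩ := exists_isParallelField φ hF h3 (-w) (x := φ p + w)
    (c := fun r => φ.symm (φ p + (1 - r) • w)) fun r => by
      congr 1
      rw [sub_smul, one_smul, smul_neg]
      abel
  have e1 : φ p + u + w + -u = φ p + w := by abel
  have e2 : φ p + w + -w = φ p := by abel
  rw [e1] at hV₃1
  rw [e2] at hV₄1
  exact ⟨V₁, hV₁, hV₁0, V₂, hV₂, hV₂0.trans hV₁1.symm, V₃, hV₃, hV₃0.trans hV₂1.symm,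
    V₄, hV₄, hV₄0.trans hV₃1.symm, hV₄1⟩

omit [IsManifold (𝓡 n) ∞ M] in
theorem isPiecewiseSmoothPath_parallelogram (p : M) (u w : E) :
    IsPiecewiseSmoothPath (n := n) (parallelogram φ p u w) p p := by
  have h : ∀ {f : ℝ → E}, ContDiff ℝ ∞ f →
      ContMDiffOn 𝓘(ℝ, ℝ) (𝓡 n) ∞ (fun r => φ.symm (f r)) (Icc 0 1) := fun hf =>
    (φ.symm.contMDiff.comp hf.contMDiff).contMDiffOn
  refine ⟨h (by fun_prop), by simp, h (by fun_prop), by simp, h (by fun_prop), by simp,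
    h (by fun_prop), by simp, ?_⟩
  simp [IsPiecewiseSmoothPath]

end ParallelTranslation

end FinslerHol

namespace FinslerHol

/-! ### Diffeomorphisms given in global coordinates -/

section InducedPerm

variable {n : ℕ} {M : Type*} [TopologicalSpace M] [ChartedSpace (EuclideanSpace ℝ (Fin n)) M]
  [IsManifold (𝓡 n) ∞ M] (φ : M ≃ₘ⟮𝓡 n, 𝓡 n⟯ EuclideanSpace ℝ (Fin n))
  {F : TangentBundle (𝓡 n) M → ℝ} {S : Set (TangentBundle (𝓡 n) M)}

local notation "E" => EuclideanSpace ℝ (Fin n)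

theorem contMDiffOn_extendMap {U : Set (E × E)} (hS : ∀ z : S, tangentCoords φ z ∈ U) {f : S → S}
    {g : E × E → E × E} (hg : ContDiffOn ℝ ∞ g U)
    (h : ∀ z : S, tangentCoords φ (f z) = g (tangentCoords φ z)) :
    ContMDiffOn (𝓡 n).tangent (𝓡 n).tangent ∞ (extendMap f) S := by
  refine ContMDiffOn.congr (f := fun z => (tangentCoords φ).symm (g (tangentCoords φ z)))
    ((tangentCoords φ).symm.contMDiff.comp_contMDiffOn (hg.contMDiffOn.comp
      (tangentCoords φ).contMDiff.contMDiffOn fun z hz => hS ⟨z, hz⟩)) fun z hz => ?_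
  rw [extendMap_of_mem _ hz, ← h ⟨z, hz⟩, Diffeomorph.symm_apply_apply]

theorem contMDiffOn_extendMap_param {A : Type*} [NormedAddCommGroup A] [NormedSpace ℝ A]
    {m : WithTop ℕ∞} (hm : m ≤ ∞) {T : Set A} {U : Set (E × E)}
    (hS : ∀ z : S, tangentCoords φ z ∈ U) {f : A → S → S} {g : A → E × E → E × E}
    (hg : ContDiffOn ℝ m (fun q : A × (E × E) => g q.1 q.2) (T ×ˢ U))
    (h : ∀ a ∈ T, ∀ z : S, tangentCoords φ (f a z) = g a (tangentCoords φ z)) :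
    ContMDiffOn (𝓘(ℝ, A).prod (𝓡 n).tangent) (𝓡 n).tangent m
      (fun q : A × TangentBundle (𝓡 n) M => extendMap (f q.1) q.2) (T ×ˢ S) := by
  have h1 : ContMDiff (𝓘(ℝ, A).prod (𝓡 n).tangent) 𝓘(ℝ, A × (E × E)) m
      (fun q : A × TangentBundle (𝓡 n) M => (q.1, tangentCoords φ q.2)) :=
    ContMDiff.prodMk_space contMDiff_fst
      (((tangentCoords φ).contMDiff.of_le hm).comp contMDiff_snd)
  refine ContMDiffOn.congr (f := fun q : A × TangentBundle (𝓡 n) M =>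
    (tangentCoords φ).symm (g q.1 (tangentCoords φ q.2)))
    (((tangentCoords φ).symm.contMDiff.of_le hm).comp_contMDiffOn (hg.contMDiffOn.comp
      h1.contMDiffOn fun q hq => ⟨hq.1, hS ⟨q.2, hq.2⟩⟩)) fun q hq => ?_
  rw [extendMap_of_mem _ hq.2, ← h q.1 hq.1 ⟨q.2, hq.2⟩, Diffeomorph.symm_apply_apply]

/-- The permutation of `S` with coordinate expression `σ`. -/
def inducedPerm (σ : Equiv.Perm (EuclideanSpace ℝ (Fin n) × EuclideanSpace ℝ (Fin n)))
    (h : ∀ z, (tangentCoords φ).symm (σ (tangentCoords φ z)) ∈ S ↔ z ∈ S) : Equiv.Perm S :=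
  ((tangentCoords φ).toEquiv.symm.permCongr σ).subtypePerm h

variable {φ}

theorem inducedPerm_apply {σ : Equiv.Perm (E × E)}
    (h : ∀ z, (tangentCoords φ).symm (σ (tangentCoords φ z)) ∈ S ↔ z ∈ S) (z : S) :
    (inducedPerm φ σ h z : TangentBundle (𝓡 n) M) =
      (tangentCoords φ).symm (σ (tangentCoords φ z)) := rfl

theorem tangentCoords_inducedPerm {σ : Equiv.Perm (E × E)}
    (h : ∀ z, (tangentCoords φ).symm (σ (tangentCoords φ z)) ∈ S ↔ z ∈ S) (z : S) :
    tangentCoords φ (inducedPerm φ σ h z) = σ (tangentCoords φ z) := by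
  rw [inducedPerm_apply, Diffeomorph.apply_symm_apply]

theorem tangentCoords_inducedPerm_symm {σ : Equiv.Perm (E × E)}
    (h : ∀ z, (tangentCoords φ).symm (σ (tangentCoords φ z)) ∈ S ↔ z ∈ S) (z : S) :
    tangentCoords φ ((inducedPerm φ σ h).symm z) = σ.symm (tangentCoords φ z) := by
  rw [Equiv.eq_symm_apply, ← tangentCoords_inducedPerm h, Equiv.apply_symm_apply]

theorem inducedPerm_mem_diffGroup {σ : Equiv.Perm (E × E)}
    (h : ∀ z, (tangentCoords φ).symm (σ (tangentCoords φ z)) ∈ S ↔ z ∈ S) {U : Set (E × E)}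
    (hS : ∀ z : S, tangentCoords φ z ∈ U) (hσ : ContDiffOn ℝ ∞ σ U)
    (hσ' : ContDiffOn ℝ ∞ σ.symm U) :
    inducedPerm φ σ h ∈ diffGroup (𝓡 n).tangent S :=
  ⟨contMDiffOn_extendMap φ hS hσ (tangentCoords_inducedPerm h),
    contMDiffOn_extendMap φ hS hσ' (tangentCoords_inducedPerm_symm h)⟩

end InducedPerm

/-! ### The holonomy of parallelograms -/

section LoopHolonomy

variable {n : ℕ} {M : Type*} [TopologicalSpace M] [ChartedSpace (EuclideanSpace ℝ (Fin n)) M]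
  [IsManifold (𝓡 n) ∞ M] (φ : M ≃ₘ⟮𝓡 n, 𝓡 n⟯ EuclideanSpace ℝ (Fin n))
  {F : TangentBundle (𝓡 n) M → ℝ} (hF : IsFinsler F)

local notation "E" => EuclideanSpace ℝ (Fin n)

/-- Parallel translation around parallelograms, in global coordinates. -/
def coordLoop (X Y : EuclideanSpace ℝ (Fin n) → EuclideanSpace ℝ (Fin n)) (s t : ℝ) :
    Equiv.Perm (EuclideanSpace ℝ (Fin n) × EuclideanSpace ℝ (Fin n)) :=
  loopPerm (isFinslerOn_globalFinsler φ hF) (continuous_globalFinsler φ hF) X Y s t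

theorem finsler_coordLoop (X Y : E → E) (s t : ℝ) (z : TangentBundle (𝓡 n) M) :
    F ((tangentCoords φ).symm (coordLoop φ hF X Y s t (tangentCoords φ z))) = F z :=
  (finsler_loopPerm (isFinslerOn_globalFinsler φ hF) (continuous_globalFinsler φ hF) X Y s t
    (tangentCoords φ z)).trans (globalFinsler_tangentCoords φ z)

theorem proj_coordLoop (X Y : E → E) (s t : ℝ) (z : TangentBundle (𝓡 n) M) :
    ((tangentCoords φ).symm (coordLoop φ hF X Y s t (tangentCoords φ z))).proj = z.proj := by
  rw [coordLoop, loopPerm_apply]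
  exact φ.symm_apply_apply z.proj

theorem coordLoop_mem_indicatrixBundle (X Y : E → E) (s t : ℝ) (z : TangentBundle (𝓡 n) M) :
    (tangentCoords φ).symm (coordLoop φ hF X Y s t (tangentCoords φ z)) ∈ indicatrixBundle F ↔
      z ∈ indicatrixBundle F := by
  rw [indicatrixBundle, mem_ofPred_eq, mem_ofPred_eq, finsler_coordLoop φ hF]

theorem coordLoop_mem_indicatrix (X Y : E → E) (s t : ℝ) (p : M) (z : TangentBundle (𝓡 n) M) :
    (tangentCoords φ).symm (coordLoop φ hF X Y s t (tangentCoords φ z)) ∈ indicatrix F p ↔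
      z ∈ indicatrix F p := by
  rw [indicatrix, mem_ofPred_eq, mem_ofPred_eq, finsler_coordLoop φ hF, proj_coordLoop]

include hF in
theorem tangentCoords_mem_slit {z : TangentBundle (𝓡 n) M} (hz : F z = 1) :
    tangentCoords φ z ∈ (univ : Set E) ×ˢ ({0}ᶜ : Set E) :=
  ⟨mem_univ _, (tangentCoords_snd_ne_zero φ).2 (snd_ne_zero_of_finsler_eq_one hF hz)⟩

theorem parallelTranslates_coordLoop (X Y : E → E) (s t : ℝ) {z : TangentBundle (𝓡 n) M}
    (hz : F z = 1) :
    ParallelTranslates F (parallelogram φ z.proj (s • X (φ z.proj)) (t • Y (φ z.proj))) z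
      ((tangentCoords φ).symm (coordLoop φ hF X Y s t (tangentCoords φ z))) := by
  have h := parallelTranslates_parallelogram φ hF (tangentCoords_mem_slit φ hF hz).2
    (p := z.proj) rfl (s • X (φ z.proj)) (t • Y (φ z.proj))
  have h1 : (tangentCoords φ).symm (φ z.proj, (tangentCoords φ z).2) = z :=
    (tangentCoords φ).symm_apply_apply z
  rw [h1] at h
  rw [coordLoop, loopPerm_apply]
  exact h

variable {X Y : EuclideanSpace ℝ (Fin n) → EuclideanSpace ℝ (Fin n)} (hX : ContDiff ℝ ∞ X) (hY : ContDiff ℝ ∞ Y)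

include hX hY

theorem contDiffOn_coordLoop (s t : ℝ) :
    ContDiffOn ℝ ∞ (coordLoop φ hF X Y s t) (univ ×ˢ {0}ᶜ) :=
  (contDiffOn_loopPerm (isFinslerOn_globalFinsler φ hF) (continuous_globalFinsler φ hF) hX hY).comp
    (f := fun z : E × E => ((s, t), z)) (by fun_prop) fun _ hz => ⟨mem_univ _, hz⟩

theorem contDiffOn_coordLoop_symm (s t : ℝ) :
    ContDiffOn ℝ ∞ (coordLoop φ hF X Y s t).symm (univ ×ˢ {0}ᶜ) := by
  rw [coordLoop, loopPerm_symm]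
  exact contDiffOn_coordLoop φ hF hY hX t s

theorem inducedPerm_coordLoop_mem_holonomyGroup (s t : ℝ) (p : M) :
    inducedPerm φ (coordLoop φ hF X Y s t) (coordLoop_mem_indicatrix φ hF X Y s t p) ∈
      holonomyGroup F p := by
  refine Subgroup.subset_closure ⟨inducedPerm_mem_diffGroup _
    (fun z => tangentCoords_mem_slit φ hF z.2.2) (contDiffOn_coordLoop φ hF hX hY s t)
    (contDiffOn_coordLoop_symm φ hF hX hY s t), parallelogram φ p (s • X (φ p)) (t • Y (φ p)),
    isPiecewiseSmoothPath_parallelogram φ p _ _, ?_⟩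
  rintro ⟨z, rfl, hz⟩
  exact parallelTranslates_coordLoop φ hF X Y s t hz

theorem inducedPerm_coordLoop_mem_fibredHolonomyGroup (s t : ℝ) :
    inducedPerm φ (coordLoop φ hF X Y s t) (coordLoop_mem_indicatrixBundle φ hF X Y s t) ∈
      fibredHolonomyGroup F :=
  ⟨inducedPerm_mem_diffGroup _
    (fun z => tangentCoords_mem_slit φ hF z.2) (contDiffOn_coordLoop φ hF hX hY s t)
    (contDiffOn_coordLoop_symm φ hF hX hY s t),
    fun p => ⟨_, inducedPerm_coordLoop_mem_holonomyGroup φ hF hX hY s t p, fun _ => rfl⟩⟩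

end LoopHolonomy

end FinslerHol

namespace FinslerHol

/-! ### Tangent vector fields in global coordinates -/

section TangentFields

open scoped Topology

variable {n : ℕ} {M : Type*} [TopologicalSpace M] [ChartedSpace (EuclideanSpace ℝ (Fin n)) M]
  [IsManifold (𝓡 n) ∞ M] (φ : M ≃ₘ⟮𝓡 n, 𝓡 n⟯ EuclideanSpace ℝ (Fin n))
  {S : Set (TangentBundle (𝓡 n) M)}

local notation "E" => EuclideanSpace ℝ (Fin n)

/-- The permutations of the coordinate space that induce elements of `G`. -/
def coordGroup (G : Subgroup (Equiv.Perm S)) :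
    Subgroup (Equiv.Perm (EuclideanSpace ℝ (Fin n) × EuclideanSpace ℝ (Fin n))) where
  carrier := {σ | ∃ Θ ∈ G, ∀ z : S, tangentCoords φ (Θ z) = σ (tangentCoords φ z)}
  one_mem' := ⟨1, one_mem _, fun _ => rfl⟩
  mul_mem' := by
    rintro σ τ ⟨Θ, hΘ, h⟩ ⟨Θ', hΘ', h'⟩
    exact ⟨Θ * Θ', mul_mem hΘ hΘ', fun z => by
      rw [Equiv.Perm.mul_apply, Equiv.Perm.mul_apply, h, h']⟩
  inv_mem' := by
    rintro σ ⟨Θ, hΘ, h⟩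
    exact ⟨Θ⁻¹, inv_mem hΘ, fun z => by
      
      rw [Equiv.Perm.eq_inv_iff_eq, ← h]
      exact congrArg (fun w : S => tangentCoords φ w) (Θ.apply_symm_apply z)⟩

theorem mem_tangentConeAt_of_hasDerivAt {z : S} {c : ℝ → S} (hc : c 0 = z)
    (hcont : ContinuousAt (fun t => (c t : TangentBundle (𝓡 n) M)) 0) {v : E × E}
    (h : HasDerivAt (fun t => extChartAt (𝓡 n).tangent (z : TangentBundle (𝓡 n) M) (c t)) v 0) :
    v ∈ tangentConeAt ℝ ((extChartAt (𝓡 n).tangent (z : TangentBundle (𝓡 n) M)).symm ⁻¹' S ∩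
      range (𝓡 n).tangent) (extChartAt (𝓡 n).tangent (z : TangentBundle (𝓡 n) M) z) := by
  -- Times are restricted to those where the curve lies in the chart domain; there the inverse chart
  -- really returns the point of `S`.
  have hN : {t | (c t : TangentBundle (𝓡 n) M) ∈
      (extChartAt (𝓡 n).tangent (z : TangentBundle (𝓡 n) M)).source} ∈ 𝓝 (0 : ℝ) :=
    hcont.preimage_mem_nhds (by rw [hc]; exact extChartAt_source_mem_nhds _)
  have h1 := h.hasFDerivAt.hasFDerivWithinAt.mapsTo_tangent_cone
    (by rw [tangentConeAt_of_mem_nhds hN]; exact mem_univ (1 : ℝ))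
  simp only [hc, ContinuousLinearMap.toSpanSingleton_apply, one_smul] at h1
  refine tangentConeAt_mono ?_ h1
  rintro _ ⟨t, ht, rfl⟩
  refine ⟨?_, by simp⟩
  rw [mem_preimage, (extChartAt (𝓡 n).tangent (z : TangentBundle (𝓡 n) M)).left_inv ht]
  exact (c t).2

variable {φ} {U : Set (EuclideanSpace ℝ (Fin n) × EuclideanSpace ℝ (Fin n))} {G : Subgroup (Equiv.Perm S)} {ξ : FieldOn (𝓡 n).tangent S}
  {ξ' : EuclideanSpace ℝ (Fin n) × EuclideanSpace ℝ (Fin n) →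
    EuclideanSpace ℝ (Fin n) × EuclideanSpace ℝ (Fin n)}

theorem eq_fieldOfCoords (hξ : ∀ w : S, tangentCoordsDeriv φ w (ξ w) = ξ' (tangentCoords φ w)) (z : S) :
    (ξ z : E × E) = fieldOfCoords φ ξ' z := by
  rw [fieldOfCoords, ← hξ]
  exact ((tangentCoordsDeriv φ z).symm_apply_apply _).symm

theorem contMDiffOn_extendField (hU : IsOpen U) (hS : ∀ z : S, tangentCoords φ z ∈ U)
    (hξ' : ContDiffOn ℝ ∞ ξ' U)
    (hξ : ∀ w : S, tangentCoordsDeriv φ w (ξ w) = ξ' (tangentCoords φ w)) :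
    ContMDiffOn (𝓡 n).tangent (𝓡 n).tangent.tangent ∞
      (fun z => (⟨z, extendField (𝓡 n).tangent ξ z⟩ :
        TangentBundle (𝓡 n).tangent (TangentBundle (𝓡 n) M))) S := by
  refine ContMDiffOn.congr (f := fun z => (⟨z, fieldOfCoords φ ξ' z⟩ :
    TangentBundle (𝓡 n).tangent (TangentBundle (𝓡 n) M))) (fun z hz =>
    (contMDiffAt_fieldOfCoords φ (hξ'.contDiffAt
      (hU.mem_nhds (hS ⟨z, hz⟩)))).contMDiffWithinAt) fun z hz => ?_
  rw [extendField, dif_pos hz]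
  exact congrArg (Bundle.TotalSpace.mk z) (eq_fieldOfCoords hξ ⟨z, hz⟩)

/-- The orbits of the family are curves in `S`, so tangency of the field to `S` comes from being a
velocity, without any description of the tangent space of `S` by equations. -/
theorem isTangentTo_of_isVelocityField (hU : IsOpen U) (hS : ∀ z : S, tangentCoords φ z ∈ U)
    (hξ' : ContDiffOn ℝ ∞ ξ' U) (h : IsVelocityField (coordGroup φ G) U ξ')
    (hξ : ∀ w : S, tangentCoordsDeriv φ w (ξ w) = ξ' (tangentCoords φ w)) :
    IsTangentTo (𝓡 n).tangent G ξ := by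
  obtain ⟨σ, hσ, -, hsm, h0, hd⟩ := h
  choose Θ hΘ hΘσ using hσ
  have e : ∀ t (z : S), (Θ t z : TangentBundle (𝓡 n) M) =
      (tangentCoords φ).symm (σ t (tangentCoords φ z)) := fun t z => by
    rw [← hΘσ, Diffeomorph.symm_apply_apply]
  have hΘ0 : Θ 0 = 1 := Equiv.ext fun z => Subtype.ext (by
    rw [e, h0 _ (hS z), Diffeomorph.symm_apply_apply, Equiv.Perm.one_apply])
  have hder : ∀ z : S, HasDerivAt (fun t => extChartAt (𝓡 n).tangent
      (z : TangentBundle (𝓡 n) M) (Θ t z : TangentBundle (𝓡 n) M)) (ξ z : E × E) 0 := fun z => by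
    have h1 := hasFDerivAt_extChartAt_tangentCoords_symm φ (z : TangentBundle (𝓡 n) M)
    simp only [e]
    refine ((h1.comp_hasDerivAt_of_eq (0 : ℝ) (hd _ (hS z)) (h0 _ (hS z)).symm)).congr_deriv ?_
    exact (eq_fieldOfCoords hξ z).symm
  refine ⟨⟨contMDiffOn_extendField hU hS hξ' hξ, fun z => ?_⟩, 1, Θ, one_pos, fun t _ => hΘ t,
    contMDiffOn_extendMap_param φ (by simp) hS (hsm.mono (prod_mono_left (subset_univ _)))
      fun t _ z => hΘσ t z, hΘ0, hder⟩
  refine mem_tangentConeAt_of_hasDerivAt (c := fun t => Θ t z) (by rw [hΘ0]; rfl) ?_ (hder z)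
  simp only [e]
  exact (tangentCoords φ).symm.continuous.continuousAt.comp (hd _ (hS z)).continuousAt

theorem exists_mem_strongSpan_of_inLieSpan (hU : IsOpen U) (hS : ∀ z : S, tangentCoords φ z ∈ U)
    {A : Set (FieldOn (𝓡 n).tangent S)}
    (hA : ∀ η ∈ A, ∃ η' ∈ strongSpan (coordGroup φ G) U,
      ∀ w : S, tangentCoordsDeriv φ w (η w) = η' (tangentCoords φ w))
    (h : InLieSpan (𝓡 n).tangent A ξ) : ∃ ξ' ∈ strongSpan (coordGroup φ G) U,
      ∀ w : S, tangentCoordsDeriv φ w (ξ w) = ξ' (tangentCoords φ w) := by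
  induction h with
  | base ξ h => exact hA ξ h
  | zero => exact ⟨0, zero_mem _, fun w => (tangentCoordsDeriv φ w).map_zero⟩
  | add ξ η _ _ h₁ h₂ =>
    obtain ⟨ξ', hξ', hξ⟩ := h₁
    obtain ⟨η', hη', hη⟩ := h₂
    refine ⟨ξ' + η', add_mem hξ' hη', fun w => ?_⟩
    rw [Pi.add_apply, ← hξ, ← hη]
    exact (tangentCoordsDeriv φ w).map_add _ _
  | smul a ξ _ h =>
    obtain ⟨ξ', hξ', hξ⟩ := h
    refine ⟨a • ξ', Submodule.smul_mem _ a hξ', fun w => ?_⟩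
    rw [Pi.smul_apply, ← hξ]
    exact (tangentCoordsDeriv φ w).map_smul _ _
  | bracket ξ η _ _ h₁ h₂ =>
    obtain ⟨ξ', hξ', hξ⟩ := h₁
    obtain ⟨η', hη', hη⟩ := h₂
    obtain ⟨ζ, hζ, hζe⟩ := exists_lieBracket_mem_strongSpan hU hξ' hη'
    -- Tangency of the two factors has to be established before their bracket along `S` can be
    -- computed in the ambient space; it holds because members of the strong span are velocities.
    have ht : ∀ {ξ : FieldOn (𝓡 n).tangent S} {ξ' : E × E → E × E},
        ξ' ∈ strongSpan (coordGroup φ G) U →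
        (∀ w : S, tangentCoordsDeriv φ w (ξ w) = ξ' (tangentCoords φ w)) →
        IsTangentTo (𝓡 n).tangent G ξ := fun h h' =>
      isTangentTo_of_isVelocityField hU hS (contDiffOn_of_mem_strongSpan h)
        (isVelocityField_of_mem_strongSpan hU h) h'
    refine ⟨ζ, hζ, fun w => ?_⟩
    rw [hζe (hS w)]
    exact tangentCoordsDeriv_bracketOn φ w hξ hη
      ((contDiffOn_of_mem_strongSpan hξ').contDiffAt (hU.mem_nhds (hS w)))
      ((contDiffOn_of_mem_strongSpan hη').contDiffAt (hU.mem_nhds (hS w)))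
      ((ht hξ' hξ).1.2 w) ((ht hη' hη).1.2 w)

end TangentFields

end FinslerHol

namespace FinslerHol

/-! ### The curvature vector fields are tangent to the fibred holonomy group -/

/-! ### Mixed second derivatives of commutator-like families -/

section MixedDerivative

variable {W B : Type*} [NormedAddCommGroup W] [NormedSpace ℝ W] [NormedAddCommGroup B]
  [NormedSpace ℝ B]

theorem fderiv_fderiv_comp_mul_smul {P : Type*} [NormedAddCommGroup P] [NormedSpace ℝ P]
    {a b : P →L[ℝ] ℝ} {u v : P} (hau : a u = 1) (hbu : b u = 0) (hbv : b v = 1)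
    {c : W → B} {c' : W →L[ℝ] B} {z : W} (hc : ContDiffAt ℝ ∞ c z) (hc' : HasFDerivAt c c' z)
    {κ : P → W} (hκ : ContDiff ℝ ∞ κ) :
    fderiv ℝ (fderiv ℝ fun t : P => c (z + (a t * b t) • κ t)) 0 u v = c' (κ 0) := by
  have hg : ∀ t : P, HasFDerivAt (fun t : P => z + (a t * b t) • κ t) _ t := fun t =>
    ((a.hasFDerivAt.mul b.hasFDerivAt).smul (hκ.differentiable (by simp) t).hasFDerivAt).const_add z
  have hgs : ContDiff ℝ ∞ (fun t : P => z + (a t * b t) • κ t) := by fun_prop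
  have hf : ContDiffAt ℝ ∞ (fun t : P => c (z + (a t * b t) • κ t)) 0 :=
    ContDiffAt.comp (g := c) (f := fun t : P => z + (a t * b t) • κ t) 0
      (by simpa using hc) hgs.contDiffAt
  set f := fun t : P => c (z + (a t * b t) • κ t)
  have h1 : HasFDerivAt (fderiv ℝ f) (fderiv ℝ (fderiv ℝ f) 0) 0 :=
    ((hf.fderiv_right (m := ∞) (by simp)).differentiableAt (by simp)).hasFDerivAt
  have h2 : HasDerivAt (fun s : ℝ => s • u) u 0 := by
    simpa using (hasDerivAt_id' (0 : ℝ)).smul_const u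
  have h3 : HasDerivAt (fun s : ℝ => fderiv ℝ f (s • u) v) (fderiv ℝ (fderiv ℝ f) 0 u v) 0 := by
    have := (h1.comp_hasDerivAt_of_eq (0 : ℝ) h2 (zero_smul ℝ u).symm).clm_apply
      (hasDerivAt_const _ v)
    simpa using this
  -- On the line `s • u` one has `b = 0`, so the inner map stays at `z`; in the direction `v` the
  -- product `a * b` has derivative `s`. The value of `a` at `v` plays no role.
  have h4 : ∀ s : ℝ, fderiv ℝ f (s • u) v = s • c' (κ (s • u)) := fun s => by
    have h : HasFDerivAt f _ (s • u) :=
      HasFDerivAt.comp (g := c) (g' := c') (s • u) (by simpa [hbu] using hc') (hg (s • u))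
    rw [h.fderiv]
    simp [hau, hbu, hbv]
  simp only [h4] at h3
  have h5 : DifferentiableAt ℝ (fun s : ℝ => c' (κ (s • u))) 0 :=
    ((c'.contDiff.comp hκ).comp (f := fun s : ℝ => s • u) (by fun_prop)).differentiable
      (n := ∞) (by simp) 0
  simpa using h3.unique ((hasDerivAt_id' (0 : ℝ)).fun_smul h5.hasDerivAt)

theorem iteratedFDeriv_two_comp_mul_smul {c : W → B} {c' : W →L[ℝ] B} {z : W}
    (hc : ContDiffAt ℝ ∞ c z) (hc' : HasFDerivAt c c' z) {κ : (Fin 2 → ℝ) → W}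
    (hκ : ContDiff ℝ ∞ κ) :
    iteratedFDeriv ℝ 2 (fun t : Fin 2 → ℝ => c (z + (t 0 * t 1) • κ t)) 0
      (fun i => Pi.single i 1) = c' (κ 0) := by
  rw [iteratedFDeriv_two_apply]
  exact fderiv_fderiv_comp_mul_smul
    (a := ContinuousLinearMap.proj (R := ℝ) (φ := fun _ : Fin 2 => ℝ) 0)
    (b := ContinuousLinearMap.proj (R := ℝ) (φ := fun _ : Fin 2 => ℝ) 1)
    (by simp) (by simp) (by simp) hc hc' hκ

end MixedDerivative

section Curvature

variable {n : ℕ} {M : Type*} [TopologicalSpace M] [ChartedSpace (EuclideanSpace ℝ (Fin n)) M]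
  [IsManifold (𝓡 n) ∞ M] (φ : M ≃ₘ⟮𝓡 n, 𝓡 n⟯ EuclideanSpace ℝ (Fin n))
  {F : TangentBundle (𝓡 n) M → ℝ} (hF : IsFinsler F)

local notation "E" => EuclideanSpace ℝ (Fin n)

/-- The parallel translations of the indicatrices around the parallelograms spanned by the values
of `t 0 • X` and `t 1 • Y`. -/
def parallelogramHolonomy (X Y : ∀ p : M, TangentSpace (𝓡 n) p) (t : Fin 2 → ℝ) :
    Equiv.Perm (indicatrixBundle F) :=
  inducedPerm φ (coordLoop φ hF (baseField φ X) (baseField φ Y) (t 0) (t 1))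
    (coordLoop_mem_indicatrixBundle φ hF _ _ _ _)

variable {X Y : ∀ p : M, TangentSpace (𝓡 n) p}

theorem exhibitsStrongTangency_parallelogramHolonomy (hX : IsSmoothVectorField X)
    (hY : IsSmoothVectorField Y) :
    ExhibitsStrongTangency (𝓡 n).tangent (fibredHolonomyGroup F) (curvatureField F X Y) 2 1
      (parallelogramHolonomy φ hF X Y) := by
  have hL := isFinslerOn_globalFinsler φ hF
  have hc := continuous_globalFinsler φ hF
  have hX' := contDiff_baseField φ hX
  have hY' := contDiff_baseField φ hY
  have hS : ∀ z : indicatrixBundle F, tangentCoords φ z ∈ (univ : Set E) ×ˢ ({0}ᶜ : Set E) :=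
    fun z => tangentCoords_mem_slit φ hF z.2
  have hmem : ∀ t, parallelogramHolonomy φ hF X Y t ∈ fibredHolonomyGroup F := fun t =>
    inducedPerm_coordLoop_mem_fibredHolonomyGroup φ hF hX' hY' _ _
  obtain ⟨K, hK, hKe, hK0⟩ := exists_coeff_loopPerm hL hc hX' hY'
  have e : ∀ t (z : indicatrixBundle F), (parallelogramHolonomy φ hF X Y t z : TangentBundle (𝓡 n) M) =
      (tangentCoords φ).symm (tangentCoords φ z +
        (t 0 * t 1) • K ((t 0, t 1), tangentCoords φ z)) := fun t z =>
    (inducedPerm_apply _ z).trans (congrArg (tangentCoords φ).symm (hKe (t 0) (t 1) _ (hS z)))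
  refine ⟨⟨fun t _ => (hmem t).1, ?_, ?_⟩, fun t _ => hmem t, fun z => ?_⟩
  · have hsm : ContDiffOn ℝ ∞ (fun q : (Fin 2 → ℝ) × (E × E) =>
        coordLoop φ hF (baseField φ X) (baseField φ Y) (q.1 0) (q.1 1) q.2)
        (cube 2 1 ×ˢ (univ ×ˢ {0}ᶜ)) :=
      (contDiffOn_loopPerm hL hc hX' hY').comp
        (f := fun q : (Fin 2 → ℝ) × (E × E) => ((q.1 0, q.1 1), q.2)) (by fun_prop)
        fun q hq => ⟨mem_univ _, hq.2⟩
    exact contMDiffOn_extendMap_param φ le_rfl hS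
      (f := fun t => parallelogramHolonomy φ hF X Y t)
      (g := fun t => coordLoop φ hF (baseField φ X) (baseField φ Y) (t 0) (t 1)) hsm
      fun t _ z => tangentCoords_inducedPerm _ z
  · rintro t - ⟨j, hj⟩
    have h0 : t 0 * t 1 = 0 := by fin_cases j <;> simp_all
    refine Equiv.ext fun z => Subtype.ext ?_
    rw [e, h0, zero_smul, add_zero, Diffeomorph.symm_apply_apply, Equiv.Perm.one_apply]
  · simp only [e]
    refine (iteratedFDeriv_two_comp_mul_smul
      (contDiffAt_extChartAt_tangentCoords_symm φ (z : TangentBundle (𝓡 n) M))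
      (hasFDerivAt_extChartAt_tangentCoords_symm φ (z : TangentBundle (𝓡 n) M))
      (κ := fun t => K ((t 0, t 1), tangentCoords φ z)) ?_).trans ?_
    · rw [← contDiffOn_univ]
      exact hK.comp (f := fun t : Fin 2 → ℝ => ((t 0, t 1), tangentCoords φ z)) (by fun_prop)
        fun t _ => ⟨mem_univ _, hS z⟩
    · refine ((tangentCoordsDeriv φ (z : TangentBundle (𝓡 n) M)).symm_apply_eq).2 ?_
      exact (hK0 _ (hS z)).trans (tangentCoordsDeriv_curvatureField φ hF hX hY z).symm

theorem parallelTranslates_parallelogramHolonomy (t : Fin 2 → ℝ) (z : indicatrixBundle F) :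
    ParallelTranslates F (parallelogram φ (z : TangentBundle (𝓡 n) M).proj
      (t 0 • baseDeriv φ (z : TangentBundle (𝓡 n) M).proj (X (z : TangentBundle (𝓡 n) M).proj))
      (t 1 • baseDeriv φ (z : TangentBundle (𝓡 n) M).proj (Y (z : TangentBundle (𝓡 n) M).proj)))
      z (parallelogramHolonomy φ hF X Y t z) := by
  rw [← baseField_apply, ← baseField_apply]
  exact parallelTranslates_coordLoop φ hF _ _ _ _ z.2

include φ hF in
theorem isTangentTo_of_inCurvatureAlgebra {ξ : FieldOn (𝓡 n).tangent (indicatrixBundle F)}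
    (hξ : InCurvatureAlgebra F ξ) : IsTangentTo (𝓡 n).tangent (fibredHolonomyGroup F) ξ := by
  have hL := isFinslerOn_globalFinsler φ hF
  have hS : ∀ z : indicatrixBundle F, tangentCoords φ z ∈ (univ : Set E) ×ˢ ({0}ᶜ : Set E) :=
    fun z => tangentCoords_mem_slit φ hF z.2
  have hA : ∀ η ∈ {η | ∃ X Y : ∀ p : M, TangentSpace (𝓡 n) p,
      IsSmoothVectorField X ∧ IsSmoothVectorField Y ∧ η = curvatureField F X Y},
      ∃ η' ∈ strongSpan (coordGroup φ (fibredHolonomyGroup F)) (univ ×ˢ {0}ᶜ),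
        ∀ w : indicatrixBundle F, tangentCoordsDeriv φ w (η w) = η' (tangentCoords φ w) := by
    rintro _ ⟨X, Y, hX, hY, rfl⟩
    have hX' := contDiff_baseField φ hX
    have hY' := contDiff_baseField φ hY
    refine ⟨_, Submodule.subset_span (isStrongField_curv hL (continuous_globalFinsler φ hF) hX' hY'
      fun s t => ?_), tangentCoordsDeriv_curvatureField φ hF hX hY⟩
    exact ⟨_, inducedPerm_coordLoop_mem_fibredHolonomyGroup φ hF hX' hY' s t,
      tangentCoords_inducedPerm _⟩
  obtain ⟨ξ', hξ', h⟩ := exists_mem_strongSpan_of_inLieSpan hL.isOpen_slit hS hA hξ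
  exact isTangentTo_of_isVelocityField hL.isOpen_slit hS (contDiffOn_of_mem_strongSpan hξ')
    (isVelocityField_of_mem_strongSpan hL.isOpen_slit hξ') h

-- Smoothness and tangency to `IM` of the curvature field are inherited from its being a generator
-- of the curvature algebra; the parallelogram family supplies the rest, with two parameters in
-- `(-1, 1)`.
include φ hF in
theorem isStronglyTangentTo_curvatureField (hX : IsSmoothVectorField X)
    (hY : IsSmoothVectorField Y) :
    IsStronglyTangentTo (𝓡 n).tangent (fibredHolonomyGroup F) (curvatureField F X Y) :=
  ⟨(isTangentTo_of_inCurvatureAlgebra φ hF (.base _ ⟨X, Y, hX, hY, rfl⟩)).1, 2, 1, _, two_pos,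
    one_pos, exhibitsStrongTangency_parallelogramHolonomy φ hF hX hY⟩

end Curvature

end FinslerHol

end

theorem mainTheorem5 (n : ℕ) (M : Type*) [TopologicalSpace M]
    [ChartedSpace (EuclideanSpace ℝ (Fin n)) M] [IsManifold (𝓡 n) ∞ M]
    (φ : M ≃ₘ⟮𝓡 n, 𝓡 n⟯ EuclideanSpace ℝ (Fin n))
    (F : TangentBundle (𝓡 n) M → ℝ) (hF : FinslerHol.IsFinsler F) :
    (∀ X Y : ∀ p : M, TangentSpace (𝓡 n) p,
      FinslerHol.IsSmoothVectorField X → FinslerHol.IsSmoothVectorField Y →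
      FinslerHol.IsStronglyTangentTo (𝓡 n).tangent (FinslerHol.fibredHolonomyGroup F)
        (FinslerHol.curvatureField F X Y) ∧
      ∃ Φ : (Fin 2 → ℝ) → Equiv.Perm (FinslerHol.indicatrixBundle F),
        FinslerHol.ExhibitsStrongTangency (𝓡 n).tangent (FinslerHol.fibredHolonomyGroup F)
          (FinslerHol.curvatureField F X Y) 2 1 Φ ∧
        ∀ t ∈ FinslerHol.cube 2 1, ∀ z : FinslerHol.indicatrixBundle F,
          FinslerHol.ParallelTranslates F
            (FinslerHol.parallelogram φ (z : TangentBundle (𝓡 n) M).proj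
              (t 0 • mfderiv (𝓡 n) (𝓡 n) φ (z : TangentBundle (𝓡 n) M).proj
                (X (z : TangentBundle (𝓡 n) M).proj))
              (t 1 • mfderiv (𝓡 n) (𝓡 n) φ (z : TangentBundle (𝓡 n) M).proj
                (Y (z : TangentBundle (𝓡 n) M).proj)))
            z (Φ t z)) ∧
    (∀ ξ : FinslerHol.FieldOn (𝓡 n).tangent (FinslerHol.indicatrixBundle F),
      FinslerHol.InCurvatureAlgebra F ξ →
        FinslerHol.IsTangentTo (𝓡 n).tangent (FinslerHol.fibredHolonomyGroup F) ξ) :=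
  ⟨fun X Y hX hY => ⟨FinslerHol.isStronglyTangentTo_curvatureField φ hF hX hY,
    FinslerHol.parallelogramHolonomy φ hF X Y,
    FinslerHol.exhibitsStrongTangency_parallelogramHolonomy φ hF hX hY,
    fun t _ z => FinslerHol.parallelTranslates_parallelogramHolonomy φ hF t z⟩,
  fun _ hξ => FinslerHol.isTangentTo_of_inCurvatureAlgebra φ hF hξ⟩
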